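/- **Proposition.** Let $\mathbb T^3=\mathbb R^3/\mathbb Z^3$ and let $H^\infty(\mathbb T^3_x;\mathcal S(\mathbb R^3_v))$ be the space of real-valued smooth functions of $(x,v)\in\mathbb T^3\times\mathbb R^3$ all of whose derivatives in $(x,v)$ decay faster than any power of $|v|$ uniformly in $x$. Fix $\gamma\ge 0$ and set $$\mu(v)=(2\pi)^{-3/2}e^{-|v|^2/2},\qquad a_{jk}(v)=(\delta_{jk}|v|^2-v_jv_k)|v|^\gamma,\qquad \bar a_{jk}=a_{jk}*\mu\qquad(1\le j,k\le 3),$$ $$Q(G,F)(v)=\sum_{j,k=1}^3\partial_{v_j}\int_{\mathbb R^3}a_{jk}(v-v_*)\big[G(v_*)\,\partial_{v_k}F(v)-\partial_{v_k}G(v_*)\,F(v)\big]dv_*,\qquad \Gamma(f,g)=\mu^{-1/2}Q(\sqrt\mu f,\sqrt\mu g),$$ where $Q$ acts in $v$ and $x$ is a parameter. For $\delta>\frac32$ and $t\ge 0$ let $$H_\delta=\frac{t^{\delta+1}}{\delta+1}\,\partial_{x_1}-t^\delta A_{+,1},\qquad A_{+,1}=\frac{v_1}{2}-\partial_{v_1}.$$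 Let $$(f,g)_{H^2_xL^2_v}=\sum_{|\alpha|\le 2}\int_{\mathbb T^3}\int_{\mathbb R^3}\partial_x^\alpha f\,\partial_x^\alpha g\,dv\,dx,\qquad \|f\|_{H^2_xL^2_v}^2=(f,f)_{H^2_xL^2_v},$$ $$|||u|||_\sigma^2=\sum_{j,k=1}^3\int_{\mathbb R^3}\Big(\bar a_{jk}\,\partial_{v_j}u\,\partial_{v_k}u+\tfrac14\bar a_{jk}v_jv_ku^2\Big)dv,\qquad |||f|||_{H^2_x,\sigma}^2=\sum_{|\alpha|\le 2}\int_{\mathbb T^3}|||\partial_x^\alpha f(x,\cdot)|||_\sigma^2\,dx.$$ (1) For all $\delta_1,\delta_2>\frac32$, $t\ge0$, $m,n\in\mathbb N=\{0,1,2,\dots\}$ and $f,g\in H^\infty(\mathbb T^3_x;\mathcal S(\mathbb R^3_v))$, $$H_{\delta_1}^mH_{\delta_2}^n\Gamma(f,g)=\sum_{l=0}^m\sum_{p=0}^n\binom ml\binom np\,\Gamma\big(H_{\delta_1}^lH_{\delta_2}^pf,\;H_{\delta_1}^{m-l}H_{\delta_2}^{n-p}g\big).$$ (2) There is a constant $C>0$,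 depending only on $\gamma$ (in particular independent of $m$ and $n$), such that for all $\delta_1,\delta_2>\frac32$, $t\ge0$, $m,n\in\mathbb N$ and $f,g,h\in H^\infty(\mathbb T^3_x;\mathcal S(\mathbb R^3_v))$, $$\Big|\big(H_{\delta_1}^mH_{\delta_2}^n\Gamma(f,g),\,H_{\delta_1}^mH_{\delta_2}^nh\big)_{H^2_xL^2_v}\Big|\le C\sum_{l=0}^m\sum_{p=0}^n\binom ml\binom np\,\|H_{\delta_1}^lH_{\delta_2}^pf\|_{H^2_xL^2_v}\,|||H_{\delta_1}^{m-l}H_{\delta_2}^{n-p}g|||_{H^2_x,\sigma}\,|||H_{\delta_1}^mH_{\delta_2}^nh|||_{H^2_x,\sigma}.$$ -/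

import Mathlib

open scoped ContDiff

noncomputable section

namespace Landau

/-- Space variable. A function on the torus `𝕋³ = ℝ³ / ℤ³` is a function on `ℝ³` that is
`1`-periodic in each coordinate. -/
abbrev X : Type := Fin 3 → ℝ

/-- Velocity variable, with the Euclidean norm. -/
abbrev V : Type := EuclideanSpace ℝ (Fin 3)

/-- A fundamental domain of the torus `𝕋³ = ℝ³ / ℤ³`. -/
def torusBox : Set X := Set.Icc 0 1

/-- The space `H^∞(𝕋³ₓ; 𝒮(ℝ³ᵥ)) = C^∞(𝕋³ₓ; 𝒮(ℝ³ᵥ))`: smooth functions of `(x, v)`, periodic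
in `x`, all of whose derivatives decay faster than any power of `|v|`, uniformly in `x`. -/
structure IsHInfSchwartz (f : X → V → ℝ) : Prop where
  smooth : ContDiff ℝ ∞ (fun p : X × V => f p.1 p.2)
  periodic : ∀ (i : Fin 3) (x : X) (v : V), f (x + Pi.single i 1) v = f x v
  decay : ∀ k n : ℕ, ∃ C : ℝ, ∀ (x : X) (v : V),
    ‖v‖ ^ k * ‖iteratedFDeriv ℝ n (fun p : X × V => f p.1 p.2) (x, v)‖ ≤ C

/-- The partial derivative `∂_{v_j}` of a function of `v`. -/
def dv (j : Fin 3) (u : V → ℝ) (v : V) : ℝ :=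
  fderiv ℝ u v (EuclideanSpace.single j 1)

/-- The partial derivative `∂_{x_i}` of a function of `(x, v)`. -/
def dx (i : Fin 3) (f : X → V → ℝ) (x : X) (v : V) : ℝ :=
  fderiv ℝ (fun y : X => f y v) x (Pi.single i 1)

/-- The multi-indices `α ∈ ℕ³` with `|α| ≤ 2`. -/
def multiIdx : Finset (Fin 3 → ℕ) :=
  {α ∈ Fintype.piFinset (fun _ : Fin 3 => Finset.range 3) | ∑ i, α i ≤ 2}

/-- `∂_x^α = ∂_{x_1}^{α_1} ∂_{x_2}^{α_2} ∂_{x_3}^{α_3}`. -/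
def dxMulti (α : Fin 3 → ℕ) (f : X → V → ℝ) : X → V → ℝ :=
  (dx 0)^[α 0] ((dx 1)^[α 1] ((dx 2)^[α 2] f))

/-- The Maxwellian `μ(v) = (2π)^{-3/2} e^{-|v|²/2}`. -/
def maxwellian (v : V) : ℝ :=
  (2 * Real.pi) ^ (-(3 / 2) : ℝ) * Real.exp (-‖v‖ ^ 2 / 2)

/-- `√μ`. -/
def sqrtMu (v : V) : ℝ := Real.sqrt (maxwellian v)

/-- The collision matrix `a_{jk}(v) = (δ_{jk} |v|² - v_j v_k) |v|^γ`. -/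
def aMat (γ : ℝ) (j k : Fin 3) (v : V) : ℝ :=
  ((if j = k then ‖v‖ ^ 2 else 0) - v j * v k) * ‖v‖ ^ γ

/-- The Landau bilinear collision operator
`Q(G, F)(v) = ∑_{j,k} ∂_j ∫ a_{jk}(v - w) [G(w) ∂_k F(v) - ∂_k G(w) F(v)] dw`. -/
def landauQ (γ : ℝ) (G F : V → ℝ) (v : V) : ℝ :=
  ∑ j : Fin 3, ∑ k : Fin 3,
    dv j (fun v' : V => ∫ w : V, aMat γ j k (v' - w) * (G w * dv k F v' - dv k G w * F v')) v

/-- `Γ(f, g) = μ^{-1/2} Q(√μ f, √μ g)`, the variable `x` being a parameter. -/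
def Gam (γ : ℝ) (f g : X → V → ℝ) (x : X) (v : V) : ℝ :=
  (sqrtMu v)⁻¹ * landauQ γ (fun w => sqrtMu w * f x w) (fun w => sqrtMu w * g x w) v

/-- The creation operator `A_{+,k} = v_k / 2 - ∂_{v_k}`. -/
def aPlus (k : Fin 3) (u : V → ℝ) (v : V) : ℝ :=
  v k / 2 * u v - dv k u v

/-- The vector field `H_δ = t^{δ+1} / (δ+1) ∂_{x_1} - t^δ A_{+,1}` at time `t`
(the first coordinate has index `0` in `Fin 3`). -/
def hField (δ t : ℝ) (f : X → V → ℝ) (x : X) (v : V) : ℝ :=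
  1 / (δ + 1) * t ^ (δ + 1) * dx 0 f x v - t ^ δ * aPlus 0 (f x) v

/-- `H_{δ₁}^m H_{δ₂}^n f`. -/
def hPow (δ₁ δ₂ t : ℝ) (m n : ℕ) (f : X → V → ℝ) : X → V → ℝ :=
  (hField δ₁ t)^[m] ((hField δ₂ t)^[n] f)

/-- The inner product of `H²_x L²_v = H²(𝕋³ₓ; L²(ℝ³ᵥ))`. -/
def innerH2L2 (f g : X → V → ℝ) : ℝ :=
  ∑ α ∈ multiIdx, ∫ x in torusBox, ∫ v : V, dxMulti α f x v * dxMulti α g x v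

/-- The norm of `H²_x L²_v`. -/
def normH2L2 (f : X → V → ℝ) : ℝ := Real.sqrt (innerH2L2 f f)

/-- `ā_{jk} = a_{jk} * μ`. -/
def aBar (γ : ℝ) (j k : Fin 3) (v : V) : ℝ :=
  ∫ w : V, aMat γ j k (v - w) * maxwellian w

/-- `|||u|||_σ² = ∑_{j,k} ∫ (ā_{jk} ∂_j u ∂_k u + ¼ ā_{jk} v_j v_k u²) dv`. -/
def sigmaSq (γ : ℝ) (u : V → ℝ) : ℝ :=
  ∑ j : Fin 3, ∑ k : Fin 3, ∫ v : V,
    (aBar γ j k v * dv j u v * dv k u v + 1 / 4 * aBar γ j k v * v j * v k * u v ^ 2)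

/-- `|||f|||_{H²_x,σ}`, the square root of `∑_{|α| ≤ 2} ∫_{𝕋³} |||∂_x^α f(x, ·)|||_σ² dx`. -/
def normH2Sigma (γ : ℝ) (f : X → V → ℝ) : ℝ :=
  Real.sqrt (∑ α ∈ multiIdx, ∫ x in torusBox, sigmaSq γ (dxMulti α f x))

end Landau

end

/-! Part (1) is a matter of conjugation. Since `∇√μ = -(v/2)√μ`, the operator `H_δ` is `√μ⁻¹ ∘ D_e ∘
√μ`, where `D_e` is the constant-coefficient derivative in the `(x, v)`-direction `e =
(t^{δ+1}/(δ+1) e₁, t^δ e₁)`. As `Q` is bilinear and commutes with translations, `D_e Q(G, F) = Q(D_e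
G, F) + Q(G, D_e F)`. Hence each `H_δ` is a derivation for `Γ` (`tw_Gam`), and the binomial formula
`hPow_Gam` follows. No commutator appears.

By part (1), part (2) reduces to a bound for `(Γ(φ, ψ), χ)` in `H²_x L²_v` whose constant ignores
`m`, `n` and `δ`.

In `v`: `Γ` is a twisted divergence, so integration by parts puts the outer derivative on `χ`. The
matrix satisfies `a(z)ξ·η = |z|^γ (z × ξ)·(z × η)`. With `z = v - w`, each cross product is at most
`(1 + |w|)(|ξ| + |v × ξ|)`; since `v × v = 0`, the terms `± v/2` from the twist drop out of `v × ξ`.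
When the derivative falls on `√μ f`, it is moved to the kernel, and the growth `|z|^{γ+1}` leaves a
factor `1 + |v|` for the undifferentiated `g`. The `w`-integrals are Gaussian moments of `f`, at
most its `L²` norm. This gives `abs_integral_Gam_mul_le`, with `bForm` in place of the `σ`-norm.

Coercivity: `ā(v)ξ·ξ` is the `μ(w)dw`-average of `|v - w|^γ |(v - w) × ξ|²`. Restricting `w` to a
shell on which `|v - w| ≥ (1 + |v|)/3` bounds it below by `(1 + |v|)^γ (|ξ|² + |v × ξ|²)`. The
missing `u²` near `v = 0` comes from the harmonic oscillator inequality, so the `σ`-norm dominates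
`bForm` (`bForm_le_sigmaSq`).

In `x`: `H² ⊂ L^∞` and `H¹ ⊂ L⁴` in dimension three, in a form valid for any `v`-integrated sum of
squares commuting with `∂_x` (`SobForm`). They bound every distribution of at most two
`x`-derivatives over the product. -/

noncomputable section

/-! ### Twisted derivatives on the Schwartz class -/

namespace Landau

open MeasureTheory Filter Topology

/-- The uncurried form of a function of `(x, v)`. -/
abbrev J (u : X → V → ℝ) : X × V → ℝ := fun p => u p.1 p.2

/-- The derivative in the direction `e`, conjugated by `√μ`. -/
def tw (e : X × V) (u : X → V → ℝ) (x : X) (v : V) : ℝ :=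
  fderiv ℝ (J u) (x, v) e - inner ℝ e.2 v / 2 * u x v

lemma inner_single_one (j : Fin 3) (v : V) :
    inner ℝ (EuclideanSpace.single j (1 : ℝ)) v = v j := by
  rw [EuclideanSpace.inner_single_left]; simp

lemma one_add_pow_le (a : ℝ) (ha : 0 ≤ a) (k : ℕ) : (1 + a) ^ k ≤ 2 ^ k * (1 + a ^ k) := by
  have h := add_pow_le zero_le_one ha k
  rw [one_pow] at h
  refine h.trans ?_
  gcongr
  · norm_num
  · omega

namespace IsHInfSchwartz

variable {f g : X → V → ℝ}

lemma decay' (hf : IsHInfSchwartz f) (k n : ℕ) : ∃ C : ℝ, 0 ≤ C ∧ ∀ (x : X) (v : V),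
    (1 + ‖v‖) ^ k * ‖iteratedFDeriv ℝ n (J f) (x, v)‖ ≤ C := by
  obtain ⟨C0, h0⟩ := hf.decay 0 n
  obtain ⟨C1, h1⟩ := hf.decay k n
  have key : ∀ (x : X) (v : V),
      (1 + ‖v‖) ^ k * ‖iteratedFDeriv ℝ n (J f) (x, v)‖ ≤ 2 ^ k * (C0 + C1) := by
    intro x v
    have e0 := h0 x v
    have e1 := h1 x v
    rw [pow_zero, one_mul] at e0
    calc _ ≤ (2 ^ k * (1 + ‖v‖ ^ k)) * ‖iteratedFDeriv ℝ n (J f) (x, v)‖ := by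
          gcongr
          exact one_add_pow_le _ (norm_nonneg v) k
      _ = 2 ^ k * (‖iteratedFDeriv ℝ n (J f) (x, v)‖ +
            ‖v‖ ^ k * ‖iteratedFDeriv ℝ n (J f) (x, v)‖) := by ring
      _ ≤ _ := by gcongr
  exact ⟨_, le_trans (by positivity) (key 0 0), key⟩

lemma add (hf : IsHInfSchwartz f) (hg : IsHInfSchwartz g) : IsHInfSchwartz (f + g) where
  smooth := hf.smooth.add hg.smooth
  periodic i x v := by simp [hf.periodic, hg.periodic]
  decay k n := by
    obtain ⟨C, h⟩ := hf.decay k n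
    obtain ⟨D, h'⟩ := hg.decay k n
    refine ⟨C + D, fun x v => ?_⟩
    have : (fun p : X × V => (f + g) p.1 p.2) = J f + J g := rfl
    rw [this, iteratedFDeriv_add_apply (hf.smooth.contDiffAt.of_le (by exact_mod_cast le_top))
      (hg.smooth.contDiffAt.of_le (by exact_mod_cast le_top))]
    calc _ ≤ ‖v‖ ^ k * (‖iteratedFDeriv ℝ n (J f) (x, v)‖ + ‖iteratedFDeriv ℝ n (J g) (x, v)‖) := by
          gcongr; exact norm_add_le _ _
      _ ≤ C + D := by rw [mul_add]; exact add_le_add (h x v) (h' x v)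

lemma smul (c : ℝ) (hf : IsHInfSchwartz f) : IsHInfSchwartz (c • f) where
  smooth := hf.smooth.const_smul c
  periodic i x v := by simp [hf.periodic]
  decay k n := by
    obtain ⟨C, h⟩ := hf.decay k n
    refine ⟨|c| * C, fun x v => ?_⟩
    have : (fun p : X × V => (c • f) p.1 p.2) = c • J f := rfl
    rw [this, iteratedFDeriv_const_smul_apply (hf.smooth.contDiffAt.of_le (by exact_mod_cast le_top)),
      norm_smul, Real.norm_eq_abs, mul_left_comm]
    gcongr
    exact h x v

lemma neg (hf : IsHInfSchwartz f) : IsHInfSchwartz (-f) := by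
  simpa using hf.smul (-1)

lemma sub (hf : IsHInfSchwartz f) (hg : IsHInfSchwartz g) : IsHInfSchwartz (f - g) := by
  simpa [sub_eq_add_neg] using hf.add hg.neg

lemma mul_left {m : V → ℝ} (hm : m.HasTemperateGrowth) (hf : IsHInfSchwartz f) :
    IsHInfSchwartz (fun x v => m v * f x v) where
  smooth := (hm.1.comp contDiff_snd).mul hf.smooth
  periodic i x v := by simp [hf.periodic]
  decay k n := by
    have hms : ContDiff ℝ ∞ (fun p : X × V => m p.2) := hm.1.comp contDiff_snd
    have hmb : ∀ i : ℕ, ∃ N : ℕ, ∃ C : ℝ, 0 ≤ C ∧ ∀ (x : X) (v : V),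
        ‖iteratedFDeriv ℝ i (fun p : X × V => m p.2) (x, v)‖ ≤ C * (1 + ‖v‖) ^ N := by
      intro i
      obtain ⟨N, C, h⟩ := hm.2 i
      have h0 : 0 ≤ C := by simpa using (norm_nonneg _).trans (h 0)
      refine ⟨N, C, h0, fun x v => ?_⟩
      have e : (fun p : X × V => m p.2) = m ∘ (ContinuousLinearMap.snd ℝ X V) := rfl
      rw [e, ContinuousLinearMap.iteratedFDeriv_comp_right _ hm.1 _
        (i := i) (by exact_mod_cast le_top)]
      refine (ContinuousMultilinearMap.norm_compContinuousLinearMap_le _ _).trans ?_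
      refine le_trans ?_ (h v)
      simp only [ContinuousLinearMap.coe_snd']
      refine mul_le_of_le_one_right (norm_nonneg _) ?_
      exact Finset.prod_le_one (fun _ _ => norm_nonneg _)
        (fun _ _ => ContinuousLinearMap.norm_snd_le ..)
    choose N C hC0 hC using hmb
    choose D hD0 hD using fun (K j : ℕ) => hf.decay' K j
    refine ⟨∑ i ∈ Finset.range (n + 1), n.choose i * C i * D (k + N i) (n - i), fun x v => ?_⟩
    have := norm_iteratedFDeriv_mul_le hms hf.smooth (x, v) (n := n) (by exact_mod_cast le_top)
    refine (mul_le_mul_of_nonneg_left this (by positivity)).trans ?_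
    rw [Finset.mul_sum]
    refine Finset.sum_le_sum fun i _ => ?_
    calc _ ≤ (1 + ‖v‖) ^ k * ((n.choose i) * (C i * (1 + ‖v‖) ^ N i) *
            ‖iteratedFDeriv ℝ (n - i) (J f) (x, v)‖) := by
          gcongr
          · linarith
          · exact hC i x v
      _ = n.choose i * C i * ((1 + ‖v‖) ^ (k + N i) *
            ‖iteratedFDeriv ℝ (n - i) (J f) (x, v)‖) := by rw [pow_add]; ring
      _ ≤ _ := by
          have := hC0 i
          gcongr
          exact hD _ _ _ _

lemma fderiv_apply (hf : IsHInfSchwartz f) (e : X × V) :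
    IsHInfSchwartz (fun x v => fderiv ℝ (J f) (x, v) e) where
  smooth := by
    have := hf.smooth.fderiv_right (m := ∞) (by simp)
    exact this.clm_apply contDiff_const
  periodic i x v := by
    have : (fun p : X × V => J f (p + (Pi.single i 1, 0))) = J f := by
      ext p
      change f (p.1 + Pi.single i 1) (p.2 + 0) = f p.1 p.2
      rw [add_zero, hf.periodic]
    have h2 := fderiv_comp_add_right (𝕜 := ℝ) (f := J f) (x := (x, v)) (Pi.single i 1, 0)
    rw [this] at h2
    rw [h2]; simp
  decay k n := by
    obtain ⟨C, hC⟩ := hf.decay k (n + 1)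
    refine ⟨‖e‖ * C, fun x v => ?_⟩
    have h1 : ContDiff ℝ ∞ (fderiv ℝ (J f)) := hf.smooth.fderiv_right (m := ∞) (by simp)
    have h2 := (ContinuousLinearMap.apply ℝ ℝ e).norm_iteratedFDeriv_comp_left
      (f := fderiv ℝ (J f)) (x := (x, v)) (n := n) h1.contDiffAt (by exact_mod_cast le_top)
    have h3 : ‖ContinuousLinearMap.apply ℝ ℝ e‖ ≤ ‖e‖ := by
      refine ContinuousLinearMap.opNorm_le_bound _ (norm_nonneg _) fun L => ?_
      simpa [mul_comm] using L.le_opNorm e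
    rw [norm_iteratedFDeriv_fderiv] at h2
    calc _ ≤ ‖v‖ ^ k * (‖e‖ * ‖iteratedFDeriv ℝ (n + 1) (J f) (x, v)‖) := by
          gcongr
          exact h2.trans (by gcongr)
      _ ≤ _ := by
          rw [mul_left_comm]; gcongr; exact hC x v

lemma inner_mul (hf : IsHInfSchwartz f) (e : V) :
    IsHInfSchwartz (fun x v => inner ℝ e v * f x v) :=
  hf.mul_left (m := fun v => inner ℝ e v) ((innerSL ℝ e).hasTemperateGrowth)

lemma coord_mul (hf : IsHInfSchwartz f) (j : Fin 3) :
    IsHInfSchwartz (fun x v => v j * f x v) := by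
  simpa only [inner_single_one] using hf.inner_mul (EuclideanSpace.single j 1)

lemma tw (hf : IsHInfSchwartz f) (e : X × V) : IsHInfSchwartz (tw e f) := by
  have := (hf.fderiv_apply e).sub ((hf.inner_mul e.2).smul (1 / 2))
  convert this using 1
  ext x v
  simp [Landau.tw]; ring

lemma differentiable (hf : IsHInfSchwartz f) : Differentiable ℝ (J f) :=
  hf.smooth.differentiable (by simp)

end IsHInfSchwartz

lemma dx_eq {u : X → V → ℝ} (hu : Differentiable ℝ (J u)) (i : Fin 3) :
    dx i u = tw (Pi.single i 1, 0) u := by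
  ext x v
  have h1 : HasFDerivAt (fun y : X => u y v) ((fderiv ℝ (J u) (x, v)).comp
      (ContinuousLinearMap.inl ℝ X V)) x :=
    HasFDerivAt.comp (g := J u) x (hu (x, v)).hasFDerivAt (hasFDerivAt_prodMk_left (𝕜 := ℝ) x v)
  simp [dx, tw, h1.fderiv]

lemma dv_eq_fderiv {u : X → V → ℝ} (hu : Differentiable ℝ (J u)) (j : Fin 3) (x : X) (v : V) :
    dv j (u x) v = fderiv ℝ (J u) (x, v) (0, EuclideanSpace.single j 1) := by
  have h1 : HasFDerivAt (u x) ((fderiv ℝ (J u) (x, v)).comp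
      (ContinuousLinearMap.inr ℝ X V)) v :=
    HasFDerivAt.comp (g := J u) v (hu (x, v)).hasFDerivAt (hasFDerivAt_prodMk_right x v)
  simp [dv, h1.fderiv]

lemma dv_eq {u : X → V → ℝ} (hu : Differentiable ℝ (J u)) (j : Fin 3) (x : X) (v : V) :
    dv j (u x) v = tw (0, EuclideanSpace.single j 1) u x v + v j / 2 * u x v := by
  rw [dv_eq_fderiv hu, tw, inner_single_one]; ring

/-- Here `-t^δ A_{+,1} = t^δ (∂_{v₁} - v₁/2)` is the twisted derivative along `v₁`, and a direction
with no `v`-component carries no twist; `tw` is linear in the direction. -/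
lemma hField_eq {u : X → V → ℝ} (hu : Differentiable ℝ (J u)) (δ t : ℝ) :
    hField δ t u = tw ((1 / (δ + 1) * t ^ (δ + 1)) • (Pi.single 0 1, 0) +
      t ^ δ • (0, EuclideanSpace.single 0 1)) u := by
  ext x v
  rw [hField, aPlus, dv_eq hu, dx_eq hu]
  simp only [tw, map_add, map_smul]
  simp [inner_smul_left]
  ring

lemma tw_add_apply {u w : X → V → ℝ} (hu : Differentiable ℝ (J u)) (hw : Differentiable ℝ (J w))
    (e : X × V) : tw e (u + w) = tw e u + tw e w := by
  ext x v
  have : J (u + w) = J u + J w := rfl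
  simp only [tw, this, Pi.add_apply]
  rw [fderiv_add (hu _) (hw _)]
  simp; ring

lemma tw_smul {u : X → V → ℝ} (hu : Differentiable ℝ (J u)) (c : ℝ)
    (e : X × V) : tw e (c • u) = c • tw e u := by
  ext x v
  have : J (c • u) = c • J u := rfl
  simp only [tw, this, Pi.smul_apply]
  rw [fderiv_const_smul (hu _)]
  simp; ring

/-- Conjugates of commuting derivatives commute. Concretely, the second derivative is symmetric, and
differentiating the twist of `e'` along `e` produces `⟨e', e⟩/2`, which is symmetric too. -/
lemma tw_comm {u : X → V → ℝ} (hu : ContDiff ℝ ∞ (J u)) (e e' : X × V) :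
    tw e (tw e' u) = tw e' (tw e u) := by
  ext x v
  have key : ∀ e e' : X × V, fderiv ℝ (J (tw e' u)) (x, v) e =
      fderiv ℝ (fderiv ℝ (J u)) (x, v) e e' - (inner ℝ e'.2 v / 2 * fderiv ℝ (J u) (x, v) e
        + inner ℝ e'.2 e.2 / 2 * u x v) := by
    intro e e'
    have h1 : HasFDerivAt (fun p => fderiv ℝ (J u) p e')
        ((ContinuousLinearMap.apply ℝ ℝ e').comp (fderiv ℝ (fderiv ℝ (J u)) (x, v))) (x, v) := by
      have : DifferentiableAt ℝ (fderiv ℝ (J u)) (x, v) :=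
        (hu.fderiv_right (m := ∞) (by simp)).differentiable (by simp) _
      exact (ContinuousLinearMap.apply ℝ ℝ e').hasFDerivAt.comp _ this.hasFDerivAt
    have h2 : HasFDerivAt (fun p : X × V => inner ℝ e'.2 p.2 / 2)
        ((1 / 2 : ℝ) • (innerSL ℝ e'.2).comp (ContinuousLinearMap.snd ℝ X V)) (x, v) := by
      have := (((innerSL ℝ e'.2).comp (ContinuousLinearMap.snd ℝ X V)).hasFDerivAt
        (x := (x, v))).const_smul (1 / 2 : ℝ)
      refine this.congr_of_eventuallyEq (Eventually.of_forall fun p => ?_)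
      simp; ring
    have h3 : HasFDerivAt (J u) (fderiv ℝ (J u) (x, v)) (x, v) :=
      ((hu.differentiable (by simp)) _).hasFDerivAt
    have h4 := h1.sub (h2.mul h3)
    have : J (tw e' u) = fun p => fderiv ℝ (J u) p e' - inner ℝ e'.2 p.2 / 2 * J u p := rfl
    rw [this]
    erw [h4.fderiv]
    simp
    ring
  have hsym : fderiv ℝ (fderiv ℝ (J u)) (x, v) e e' = fderiv ℝ (fderiv ℝ (J u)) (x, v) e' e := by
    have : IsSymmSndFDerivAt ℝ (J u) (x, v) :=
      hu.contDiffAt.isSymmSndFDerivAt (by simp only [minSmoothness_of_isRCLikeNormedField]; exact WithTop.coe_le_coe.2 le_top)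
    exact this.eq e e'
  have hc := real_inner_comm e.2 e'.2
  change fderiv ℝ (J (tw e' u)) (x, v) e - inner ℝ e.2 v / 2 * tw e' u x v =
    fderiv ℝ (J (tw e u)) (x, v) e' - inner ℝ e'.2 v / 2 * tw e u x v
  rw [key e e', key e' e, hsym, tw, tw, hc]
  ring

end Landau

end

/-! ### Decay and growth classes; convolution with a polynomially growing kernel -/

noncomputable section

namespace Landau

open MeasureTheory Filter Topology

/-- Jointly continuous functions, rapidly decaying in `v` uniformly in `x`. -/
structure Dec (u : X → V → ℝ) : Prop where
  cont : Continuous (J u)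
  decay : ∀ k : ℕ, ∃ C : ℝ, 0 ≤ C ∧ ∀ x v, (1 + ‖v‖) ^ k * |u x v| ≤ C

/-- Jointly continuous functions, of polynomial growth in `v` uniformly in `x`. -/
structure Grow (m : X → V → ℝ) : Prop where
  cont : Continuous (J m)
  bound : ∃ (N : ℕ) (C : ℝ), 0 ≤ C ∧ ∀ x v, |m x v| ≤ C * (1 + ‖v‖) ^ N

lemma integrable_inv_one_add_norm_pow : Integrable (fun w : V => ((1 + ‖w‖) ^ 4)⁻¹) := by
  have := integrable_one_add_norm (E := V) (μ := volume) (r := 4) (by simp; norm_num)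
  refine this.congr (Eventually.of_forall fun w => ?_)
  simp only
  rw [Real.rpow_neg (by positivity)]
  norm_cast

namespace Dec

variable {u w : X → V → ℝ}

lemma abs_le (hu : Dec u) (k : ℕ) : ∃ C : ℝ, 0 ≤ C ∧ ∀ x v, |u x v| ≤ C * ((1 + ‖v‖) ^ k)⁻¹ := by
  obtain ⟨C, hC, h⟩ := hu.decay k
  refine ⟨C, hC, fun x v => ?_⟩
  rw [← div_eq_mul_inv, le_div_iff₀ (by positivity), mul_comm]
  exact h x v

lemma add (hu : Dec u) (hw : Dec w) : Dec (fun x v => u x v + w x v) where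
  cont := hu.cont.add hw.cont
  decay k := by
    obtain ⟨C, hC, h⟩ := hu.decay k
    obtain ⟨D, hD, h'⟩ := hw.decay k
    refine ⟨C + D, by positivity, fun x v => ?_⟩
    calc _ ≤ (1 + ‖v‖) ^ k * (|u x v| + |w x v|) := by gcongr; exact abs_add_le _ _
      _ ≤ _ := by rw [mul_add]; exact add_le_add (h x v) (h' x v)

lemma grow_mul {m : X → V → ℝ} (hm : Grow m) (hu : Dec u) : Dec (fun x v => m x v * u x v) where
  cont := hm.cont.mul hu.cont
  decay k := by
    obtain ⟨N, C, hC, h⟩ := hm.bound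
    obtain ⟨D, hD, h'⟩ := hu.decay (k + N)
    refine ⟨C * D, by positivity, fun x v => ?_⟩
    rw [abs_mul]
    calc _ ≤ (1 + ‖v‖) ^ k * (C * (1 + ‖v‖) ^ N * |u x v|) := by gcongr; exact h x v
      _ = C * ((1 + ‖v‖) ^ (k + N) * |u x v|) := by rw [pow_add]; ring
      _ ≤ _ := by gcongr; exact h' x v

lemma grow (hu : Dec u) : Grow u where
  cont := hu.cont
  bound := by
    obtain ⟨C, hC, h⟩ := hu.decay 0
    exact ⟨0, C, hC, fun x v => by simpa using h x v⟩

lemma mul (hu : Dec u) (hw : Dec w) : Dec (fun x v => u x v * w x v) := hw.grow_mul hu.grow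

lemma const_mul (c : ℝ) (hu : Dec u) : Dec (fun x v => c * u x v) :=
  hu.grow_mul (m := fun _ _ => c) ⟨continuous_const, 0, |c|, abs_nonneg _, by simp⟩

lemma zero : Dec (fun _ _ => 0) where
  cont := continuous_const
  decay k := ⟨0, le_rfl, by simp⟩

lemma sum {ι : Type*} (s : Finset ι) {U : ι → X → V → ℝ} (h : ∀ i ∈ s, Dec (U i)) :
    Dec (fun x v => ∑ i ∈ s, U i x v) := by
  classical
  induction s using Finset.induction_on with
  | empty => simpa using zero
  | insert a s ha ih =>
    simp only [Finset.sum_insert ha]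
    exact (h a (by simp)).add (ih fun i hi => h i (by simp [hi]))

lemma neg (hu : Dec u) : Dec (fun x v => - u x v) := by
  simpa using hu.const_mul (-1)

lemma sub (hu : Dec u) (hw : Dec w) : Dec (fun x v => u x v - w x v) := by
  simpa [sub_eq_add_neg] using hu.add hw.neg

lemma cont_left (hu : Dec u) (x : X) : Continuous (u x) :=
  hu.cont.comp (Continuous.prodMk_right x)

lemma cont_right (hu : Dec u) (v : V) : Continuous (fun x => u x v) :=
  hu.cont.comp (Continuous.prodMk_left v)

lemma integrable (hu : Dec u) (x : X) : Integrable (u x) := by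
  obtain ⟨C, hC, h⟩ := hu.abs_le 4
  exact (integrable_inv_one_add_norm_pow.const_mul C).mono' (hu.cont_left x).aestronglyMeasurable
    (Eventually.of_forall fun v => h x v)

lemma continuous_integral (hu : Dec u) : Continuous (fun x => ∫ v, u x v) := by
  obtain ⟨C, hC, h⟩ := hu.abs_le 4
  exact continuous_of_dominated (fun x => (hu.cont_left x).aestronglyMeasurable)
    (fun x => Eventually.of_forall fun v => h x v)
    (integrable_inv_one_add_norm_pow.const_mul C)
    (Eventually.of_forall fun v => hu.cont_right v)

end Dec

lemma IsHInfSchwartz.dec {f : X → V → ℝ} (hf : IsHInfSchwartz f) : Dec f where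
  cont := hf.smooth.continuous
  decay k := by
    obtain ⟨C, hC, h⟩ := hf.decay' k 0
    refine ⟨C, hC, fun x v => ?_⟩
    simpa using h x v

namespace Grow

variable {m m' : X → V → ℝ}

lemma add (hu : Grow m) (hw : Grow m') : Grow (fun x v => m x v + m' x v) where
  cont := hu.cont.add hw.cont
  bound := by
    obtain ⟨N, C, hC, h⟩ := hu.bound
    obtain ⟨M, D, hD, h'⟩ := hw.bound
    refine ⟨N + M, C + D, by positivity, fun x v => (abs_add_le _ _).trans ?_⟩
    rw [add_mul]
    have h1 : 1 ≤ 1 + ‖v‖ := by linarith [norm_nonneg v]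
    refine add_le_add ((h x v).trans ?_) ((h' x v).trans ?_) <;> gcongr <;> first | exact h1 | omega

lemma mul (hu : Grow m) (hw : Grow m') : Grow (fun x v => m x v * m' x v) where
  cont := hu.cont.mul hw.cont
  bound := by
    obtain ⟨N, C, hC, h⟩ := hu.bound
    obtain ⟨M, D, hD, h'⟩ := hw.bound
    refine ⟨N + M, C * D, by positivity, fun x v => ?_⟩
    rw [abs_mul]
    calc _ ≤ (C * (1 + ‖v‖) ^ N) * (D * (1 + ‖v‖) ^ M) := by
          gcongr
          · exact h x v
          · exact h' x v
      _ = _ := by rw [pow_add]; ring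

lemma const (c : ℝ) : Grow (fun _ _ => c) := ⟨continuous_const, 0, |c|, abs_nonneg _, by simp⟩

lemma norm : Grow (fun _ v => ‖v‖) :=
  ⟨by fun_prop, 1, 1, zero_le_one, fun x v => by simp⟩

lemma coord (j : Fin 3) : Grow (fun _ v => v j) :=
  ⟨by fun_prop, 1, 1, zero_le_one, fun x v => by
    have := PiLp.norm_apply_le v j
    rw [Real.norm_eq_abs] at this
    simp; linarith⟩

lemma neg (hu : Grow m) : Grow (fun x v => - m x v) := by
  simpa using (const (-1)).mul hu

lemma sub (hu : Grow m) (hw : Grow m') : Grow (fun x v => m x v - m' x v) := by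
  simpa [sub_eq_add_neg] using hu.add hw.neg

lemma rpow {γ : ℝ} (hγ : 0 ≤ γ) : Grow (fun _ v => ‖v‖ ^ γ) where
  cont := by
    have : Continuous fun r : ℝ => r ^ γ := Real.continuous_rpow_const hγ
    exact this.comp (by fun_prop)
  bound := by
    refine ⟨⌈γ⌉₊, 1, zero_le_one, fun x v => ?_⟩
    rw [abs_of_nonneg (by positivity), one_mul]
    calc ‖v‖ ^ γ ≤ (1 + ‖v‖) ^ γ := by gcongr; linarith
      _ ≤ (1 + ‖v‖) ^ (⌈γ⌉₊ : ℝ) := by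
          apply Real.rpow_le_rpow_of_exponent_le (by linarith [norm_nonneg v]) (Nat.le_ceil γ)
      _ = _ := Real.rpow_natCast _ _

lemma weight {γ : ℝ} (hγ : 0 ≤ γ) : Grow (fun _ v => (1 + ‖v‖) ^ γ) where
  cont := by
    have : Continuous fun r : ℝ => r ^ γ := Real.continuous_rpow_const hγ
    exact this.comp (by fun_prop)
  bound := by
    refine ⟨⌈γ⌉₊, 1, zero_le_one, fun x v => ?_⟩
    rw [abs_of_nonneg (by positivity), one_mul]
    calc _ ≤ (1 + ‖v‖) ^ (⌈γ⌉₊ : ℝ) := by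
          apply Real.rpow_le_rpow_of_exponent_le (by linarith [norm_nonneg v]) (Nat.le_ceil γ)
      _ = _ := Real.rpow_natCast _ _

lemma aMat {γ : ℝ} (hγ : 0 ≤ γ) (j k : Fin 3) : Grow (fun _ => aMat γ j k) := by
  have h : Grow (fun _ v => (if j = k then ‖v‖ ^ 2 else 0) - v j * v k) := by
    refine Grow.sub ?_ ((coord j).mul (coord k))
    split_ifs
    · simpa [pow_two] using norm.mul norm
    · exact const 0
  exact h.mul (rpow hγ)

end Grow

/-- Multiplication by `√μ`. -/
def gm (f : X → V → ℝ) (x : X) (v : V) : ℝ := sqrtMu v * f x v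

/-- Convolution in `v`. -/
def cv (a : V → ℝ) (G : X → V → ℝ) (x : X) (v : V) : ℝ := ∫ w, a w * G x (v - w)

lemma one_add_norm_le_mul (v w : V) : 1 + ‖w‖ ≤ (1 + ‖v‖) * (1 + ‖v - w‖) := by
  have : ‖w‖ ≤ ‖v‖ + ‖v - w‖ := by
    have := norm_sub_le v (v - w)
    simpa using this
  nlinarith [norm_nonneg v, norm_nonneg (v - w)]

/-- Peetre's inequality: decay in `v - w` is decay in `w` at the price of growth in `v`. -/
lemma inv_pow_le (v w : V) (k : ℕ) :
    ((1 + ‖v - w‖) ^ k)⁻¹ ≤ (1 + ‖v‖) ^ k * ((1 + ‖w‖) ^ k)⁻¹ := by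
  rw [← div_eq_mul_inv, le_div_iff₀ (by positivity), inv_mul_le_iff₀ (by positivity), ← mul_pow,
    mul_comm (1 + ‖v - w‖)]
  exact pow_le_pow_left₀ (by positivity) (one_add_norm_le_mul v w) k

lemma mul_decay_bound {N : ℕ} {A B : ℝ} {v w : V} {a b : ℝ} (ha : |a| ≤ A * (1 + ‖w‖) ^ N)
    (hA : 0 ≤ A) (hB : 0 ≤ B) (hb : |b| ≤ B * ((1 + ‖v - w‖) ^ (N + 4))⁻¹) :
    |a| * |b| ≤ A * B * (1 + ‖v‖) ^ (N + 4) * ((1 + ‖w‖) ^ 4)⁻¹ := by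
  calc |a| * |b| ≤ (A * (1 + ‖w‖) ^ N) *
        (B * ((1 + ‖v‖) ^ (N + 4) * ((1 + ‖w‖) ^ (N + 4))⁻¹)) := by
        refine mul_le_mul ha (hb.trans ?_) (abs_nonneg _) (by positivity)
        gcongr
        exact inv_pow_le v w _
    _ = _ := by
        rw [pow_add (1 + ‖w‖)]
        field_simp

section Convolution

variable {a : V → ℝ} {G : X → V → ℝ}

lemma cv_bound (ha : Grow (fun _ => a)) (hG : Dec G) : ∃ (N : ℕ) (C : ℝ), 0 ≤ C ∧
    ∀ x v w, |a w * G x (v - w)| ≤ C * (1 + ‖v‖) ^ N * ((1 + ‖w‖) ^ 4)⁻¹ := by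
  obtain ⟨N, A, hA, h⟩ := ha.bound
  -- `N` powers absorb the growth of the kernel; the other four exceed the dimension three and make
  -- the bound integrable.
  obtain ⟨B, hB, h'⟩ := hG.abs_le (N + 4)
  refine ⟨N + 4, A * B, by positivity, fun x v w => ?_⟩
  rw [abs_mul]
  exact mul_decay_bound (h x w) hA hB (h' x (v - w))

lemma cv_integrand_continuous (hG : Dec G) (w : V) :
    Continuous (fun p : X × V => a w * G p.1 (p.2 - w)) := by
  have := hG.cont
  exact continuous_const.mul (this.comp (f := fun p : X × V => (p.1, p.2 - w)) (by fun_prop))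

lemma cv_integrand_continuous' (ha : Grow (fun _ => a)) (hG : Dec G) (p : X × V) :
    Continuous (fun w => a w * G p.1 (p.2 - w)) := by
  have := hG.cont
  have h1 : Continuous a := ha.cont.comp (Continuous.prodMk_right (0 : X))
  exact h1.mul (this.comp (f := fun w : V => (p.1, p.2 - w)) (by fun_prop))

lemma cv_integrable (ha : Grow (fun _ => a)) (hG : Dec G) (x : X) (v : V) :
    Integrable (fun w => a w * G x (v - w)) := by
  obtain ⟨N, C, hC, h⟩ := cv_bound ha hG
  exact (integrable_inv_one_add_norm_pow.const_mul _).mono'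
    (cv_integrand_continuous' ha hG (x, v)).aestronglyMeasurable
    (Eventually.of_forall fun w => h x v w)

lemma cv_grow (ha : Grow (fun _ => a)) (hG : Dec G) : Grow (cv a G) where
  cont := by
    obtain ⟨N, C, hC, h⟩ := cv_bound ha hG
    refine continuous_iff_continuousAt.2 fun p₀ => ?_
    refine continuousAt_of_dominated (bound := fun w =>
      C * (2 + ‖p₀.2‖) ^ N * ((1 + ‖w‖) ^ 4)⁻¹)
      (Eventually.of_forall fun p => (cv_integrand_continuous' ha hG p).aestronglyMeasurable) ?_
      (integrable_inv_one_add_norm_pow.const_mul _)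
      (Eventually.of_forall fun w => (cv_integrand_continuous hG w).continuousAt)
    filter_upwards [Metric.ball_mem_nhds p₀ one_pos] with p hp
    refine Eventually.of_forall fun w => (h p.1 p.2 w).trans ?_
    have : ‖p.2‖ ≤ ‖p₀.2‖ + 1 := by
      have h1 : ‖p.2 - p₀.2‖ ≤ ‖p - p₀‖ := norm_snd_le (p - p₀)
      have h2 : ‖p - p₀‖ < 1 := by simpa [dist_eq_norm] using hp
      have h3 := norm_le_norm_add_norm_sub' p.2 p₀.2
      linarith
    gcongr ?_ * ?_ ^ N * ?_
    linarith
  bound := by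
    obtain ⟨N, C, hC, h⟩ := cv_bound ha hG
    refine ⟨N, C * ∫ w : V, ((1 + ‖w‖) ^ 4)⁻¹, ?_, fun x v => ?_⟩
    · exact mul_nonneg hC (integral_nonneg fun w => by positivity)
    · calc |cv a G x v| ≤ ∫ w, |a w * G x (v - w)| := abs_integral_le_integral_abs
        _ ≤ ∫ w : V, C * (1 + ‖v‖) ^ N * ((1 + ‖w‖) ^ 4)⁻¹ :=
            integral_mono (cv_integrable ha hG x v).abs
              (integrable_inv_one_add_norm_pow.const_mul _) (h x v)
        _ = _ := by rw [integral_const_mul]; ring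

/-- The kernel sits at `w` and `G` at `v - w`, so the derivative falls on `G` alone; the kernel only
needs continuity and polynomial growth. -/
lemma cv_hasFDerivAt (ha : Grow (fun _ => a)) (hG : Dec G) (hd : ContDiff ℝ 1 (J G))
    (hD : ∀ k : ℕ, ∃ C : ℝ, 0 ≤ C ∧ ∀ x v, (1 + ‖v‖) ^ k * ‖fderiv ℝ (J G) (x, v)‖ ≤ C)
    (x : X) (v : V) : HasFDerivAt (J (cv a G)) (∫ w, a w • fderiv ℝ (J G) (x, v - w)) (x, v) ∧
      Integrable (fun w => a w • fderiv ℝ (J G) (x, v - w)) := by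
  obtain ⟨N, A, hA, h⟩ := ha.bound
  obtain ⟨B, hB, h'⟩ := hD (N + 4)
  have h1 : Continuous a := ha.cont.comp (Continuous.prodMk_right (0 : X))
  have hfc : Continuous (fderiv ℝ (J G)) := hd.continuous_fderiv (by simp)
  have hm : AEStronglyMeasurable (fun w => a w • fderiv ℝ (J G) (x, v - w)) :=
    (h1.smul (hfc.comp (f := fun w : V => (x, v - w)) (by fun_prop))).aestronglyMeasurable
  have hbd : ∀ (p : X × V) (w : V), ‖a w • fderiv ℝ (J G) (p.1, p.2 - w)‖ ≤
      A * B * (1 + ‖p.2‖) ^ (N + 4) * ((1 + ‖w‖) ^ 4)⁻¹ := by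
    intro p w
    rw [norm_smul, Real.norm_eq_abs]
    have := mul_decay_bound (v := p.2) (b := ‖fderiv ℝ (J G) (p.1, p.2 - w)‖) (h x w) hA hB
    rw [abs_norm] at this
    refine this ?_
    rw [← div_eq_mul_inv, le_div_iff₀ (by positivity), mul_comm]
    exact h' _ _
  refine ⟨?_, (integrable_inv_one_add_norm_pow.const_mul _).mono' hm
    (Eventually.of_forall (hbd (x, v)))⟩
  refine hasFDerivAt_integral_of_dominated_of_fderiv_le
    (F := fun (p : X × V) w => a w * G p.1 (p.2 - w))
    (F' := fun (p : X × V) w => a w • fderiv ℝ (J G) (p.1, p.2 - w))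
    (bound := fun w => A * B * (2 + ‖v‖) ^ (N + 4) * ((1 + ‖w‖) ^ 4)⁻¹)
    (Metric.ball_mem_nhds (x, v) one_pos)
    (Eventually.of_forall fun p => (cv_integrand_continuous' ha hG p).aestronglyMeasurable)
    (cv_integrable ha hG x v) hm ?_ (integrable_inv_one_add_norm_pow.const_mul _) ?_
  · refine Eventually.of_forall fun w p hp => (hbd p w).trans ?_
    have : ‖p.2‖ ≤ ‖v‖ + 1 := by
      have h1 : ‖p.2 - v‖ ≤ ‖p - (x, v)‖ := norm_snd_le (p - (x, v))
      have h2 : ‖p - (x, v)‖ < 1 := by simpa [dist_eq_norm] using hp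
      have h3 := norm_le_norm_add_norm_sub' p.2 v
      linarith
    gcongr ?_ * ?_ ^ (N + 4) * ?_
    linarith
  · refine Eventually.of_forall fun w p _ => ?_
    have h3 : HasFDerivAt (J G) (fderiv ℝ (J G) (p - (0, w))) (p - (0, w)) :=
      (hd.differentiable (by simp) _).hasFDerivAt
    have h4 := (h3.comp p ((hasFDerivAt_id p).sub_const (0, w))).const_smul (a w)
    have e : p - (0, w) = (p.1, p.2 - w) := by ext <;> simp
    rw [e] at h4
    have e2 : a w • J G ∘ (fun x : X × V => id x - (0, w)) =
        fun p : X × V => a w * G p.1 (p.2 - w) := by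
      ext q; simp [J]
    rw [e2, ContinuousLinearMap.comp_id] at h4
    exact h4

end Convolution

end Landau

end

/-! ### Conjugation by `√μ`, divergence form of `Γ`, and the derivation property -/

noncomputable section

namespace Landau

open MeasureTheory Filter Topology

lemma maxwellian_pos (v : V) : 0 < maxwellian v := by
  unfold maxwellian; positivity

lemma sqrtMu_pos (v : V) : 0 < sqrtMu v := Real.sqrt_pos.2 (maxwellian_pos v)

lemma sqrtMu_mul_self (v : V) : sqrtMu v * sqrtMu v = maxwellian v :=
  Real.mul_self_sqrt (maxwellian_pos v).le

/-- The normalising constant of `√μ`. -/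
def muConst : ℝ := Real.sqrt ((2 * Real.pi) ^ (-(3 / 2) : ℝ))

lemma sqrtMu_eq (v : V) : sqrtMu v = muConst * Real.exp (-‖v‖ ^ 2 / 4) := by
  rw [sqrtMu, maxwellian, Real.sqrt_mul (by positivity), muConst]
  congr 1
  rw [Real.sqrt_eq_iff_mul_self_eq (by positivity) (by positivity), ← Real.exp_add]
  congr 1; ring

lemma muConst_le_one : muConst ≤ 1 := by
  rw [muConst, Real.sqrt_le_one]
  apply Real.rpow_le_one_of_one_le_of_nonpos
  · linarith [Real.two_le_pi]
  · norm_num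

lemma sqrtMu_le_one (v : V) : sqrtMu v ≤ 1 := by
  rw [sqrtMu_eq]
  refine mul_le_one₀ muConst_le_one (by positivity) ?_
  rw [Real.exp_le_one_iff]
  have := sq_nonneg ‖v‖
  linarith

lemma sqrtMu_contDiff : ContDiff ℝ ∞ sqrtMu := by
  have : sqrtMu = fun v => muConst * Real.exp (-‖v‖ ^ 2 / 4) := funext sqrtMu_eq
  rw [this]
  exact contDiff_const.mul ((((contDiff_norm_sq ℝ).neg).div_const 4).exp)

lemma sqrtMu_hasFDerivAt (v : V) :
    HasFDerivAt sqrtMu (-(sqrtMu v / 2) • innerSL ℝ v) v := by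
  have e : sqrtMu = fun v => muConst * Real.exp (-‖v‖ ^ 2 / 4) := funext sqrtMu_eq
  have h1 := (((hasStrictFDerivAt_norm_sq v).hasFDerivAt.const_smul (-1 / 4 : ℝ)).exp).const_mul
    muConst
  have e2 : (fun v : V => muConst * Real.exp (((-1 / 4 : ℝ) • fun x : V => ‖x‖ ^ 2) v)) = sqrtMu := by
    rw [e]; ext w
    simp only [Pi.smul_apply, smul_eq_mul]
    congr 2; ring
  rw [e2] at h1
  refine h1.congr_fderiv (ContinuousLinearMap.ext fun w => ?_)
  have e3 : (-1 / 4 : ℝ) * ‖v‖ ^ 2 = - ‖v‖ ^ 2 / 4 := by ring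
  simp only [sqrtMu_eq, Pi.smul_apply, smul_eq_mul, e3, smul_apply]
  simp
  ring

lemma sqrtMu_decay (k : ℕ) : ∃ C : ℝ, 0 ≤ C ∧ ∀ v : V, (1 + ‖v‖) ^ k * sqrtMu v ≤ C := by
  refine ⟨k.factorial * Real.exp 2, by positivity, fun v => ?_⟩
  have h1 : (1 + ‖v‖) ^ k ≤ k.factorial * Real.exp (1 + ‖v‖) := by
    have := Real.pow_div_factorial_le_exp (1 + ‖v‖) (by positivity) k
    rwa [div_le_iff₀' (by positivity)] at this
  have h2 : sqrtMu v ≤ Real.exp (-‖v‖ ^ 2 / 4) := by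
    rw [sqrtMu_eq]
    exact mul_le_of_le_one_left (by positivity) muConst_le_one
  calc _ ≤ (k.factorial * Real.exp (1 + ‖v‖)) * Real.exp (-‖v‖ ^ 2 / 4) := by
        gcongr; exact (sqrtMu_pos v).le
    _ = k.factorial * Real.exp (1 + ‖v‖ + -‖v‖ ^ 2 / 4) := by rw [Real.exp_add (1 + ‖v‖)]; ring
    _ ≤ _ := by
        gcongr
        nlinarith [sq_nonneg (‖v‖ - 2)]

lemma dec_sqrtMu : Dec (fun _ => sqrtMu) where
  cont := sqrtMu_contDiff.continuous.comp continuous_snd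
  decay k := by
    obtain ⟨C, hC, h⟩ := sqrtMu_decay k
    exact ⟨C, hC, fun x v => by rw [abs_of_pos (sqrtMu_pos v)]; exact h v⟩

lemma dec_maxwellian : Dec (fun _ => maxwellian) := by
  simpa only [sqrtMu_mul_self] using dec_sqrtMu.mul dec_sqrtMu

lemma gm_dec {f : X → V → ℝ} (hf : IsHInfSchwartz f) : Dec (gm f) := dec_sqrtMu.mul hf.dec

lemma gm_hasFDerivAt {f : X → V → ℝ} (hf : Differentiable ℝ (J f)) (p : X × V) :
    HasFDerivAt (J (gm f)) (sqrtMu p.2 • (fderiv ℝ (J f) p -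
      (f p.1 p.2 / 2) • (innerSL ℝ p.2).comp (ContinuousLinearMap.snd ℝ X V))) p := by
  have h1 : HasFDerivAt (fun p : X × V => sqrtMu p.2) _ p :=
    (sqrtMu_hasFDerivAt p.2).comp p hasFDerivAt_snd
  have h2 := h1.mul (hf p).hasFDerivAt
  refine h2.congr_fderiv (ContinuousLinearMap.ext fun q => ?_)
  simp
  ring

/-- The intertwining `D_e ∘ √μ = √μ ∘ tw e`, through which translation invariance of `Q` becomes a
property of `Γ`. -/
lemma gm_fderiv_apply {f : X → V → ℝ} (hf : Differentiable ℝ (J f)) (e : X × V) (x : X) (v : V) :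
    fderiv ℝ (J (gm f)) (x, v) e = gm (tw e f) x v := by
  rw [(gm_hasFDerivAt hf (x, v)).fderiv]
  simp [gm, tw, real_inner_comm]
  ring_nf
  simp

lemma gm_contDiff {f : X → V → ℝ} (hf : IsHInfSchwartz f) : ContDiff ℝ ∞ (J (gm f)) :=
  (sqrtMu_contDiff.comp contDiff_snd).mul hf.smooth

lemma gm_fderiv_decay {f : X → V → ℝ} (hf : IsHInfSchwartz f) (k : ℕ) :
    ∃ C : ℝ, 0 ≤ C ∧ ∀ x v, (1 + ‖v‖) ^ k * ‖fderiv ℝ (J (gm f)) (x, v)‖ ≤ C := by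
  obtain ⟨C, hC, h⟩ := hf.decay' k 1
  obtain ⟨D, hD, h'⟩ := hf.dec.decay (k + 1)
  refine ⟨C + D, by positivity, fun x v => ?_⟩
  rw [(gm_hasFDerivAt hf.differentiable (x, v)).fderiv, norm_smul, Real.norm_eq_abs,
    abs_of_pos (sqrtMu_pos _)]
  have h1 := h x v
  rw [norm_iteratedFDeriv_one] at h1
  have h2 : ‖(innerSL ℝ v).comp (ContinuousLinearMap.snd ℝ X V)‖ ≤ ‖v‖ := by
    refine (ContinuousLinearMap.opNorm_comp_le _ _).trans ?_
    rw [innerSL_apply_norm]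
    exact mul_le_of_le_one_right (norm_nonneg _) (ContinuousLinearMap.norm_snd_le ..)
  calc _ ≤ (1 + ‖v‖) ^ k * (1 * (‖fderiv ℝ (J f) (x, v)‖ + |f x v| / 2 * ‖v‖)) := by
        gcongr
        · exact sqrtMu_le_one v
        · refine (norm_sub_le _ _).trans ?_
          rw [norm_smul]
          gcongr
          rw [Real.norm_eq_abs, abs_div, abs_two]
    _ ≤ (1 + ‖v‖) ^ k * ‖fderiv ℝ (J f) (x, v)‖ + (1 + ‖v‖) ^ (k + 1) * |f x v| := by
        rw [one_mul, mul_add, pow_succ, mul_assoc _ (1 + ‖v‖)]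
        have := mul_nonneg (abs_nonneg (f x v)) (norm_nonneg v)
        have h4 : |f x v| / 2 * ‖v‖ ≤ (1 + ‖v‖) * |f x v| := by nlinarith [abs_nonneg (f x v)]
        gcongr
    _ ≤ _ := add_le_add h1 (h' x v)

/-- The convolution of a kernel with `√μ f`. -/
def cm (a : V → ℝ) (f : X → V → ℝ) : X → V → ℝ := cv a (gm f)

section

variable {a : V → ℝ} {f g : X → V → ℝ}

lemma cm_grow (ha : Grow (fun _ => a)) (hf : IsHInfSchwartz f) : Grow (cm a f) :=
  cv_grow ha (gm_dec hf)

lemma cm_differentiable (ha : Grow (fun _ => a)) (hf : IsHInfSchwartz f) :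
    Differentiable ℝ (J (cm a f)) := fun p =>
  (cv_hasFDerivAt ha (gm_dec hf) ((gm_contDiff hf).of_le (by simp))
    (gm_fderiv_decay hf) p.1 p.2).1.differentiableAt

lemma cm_fderiv_apply (ha : Grow (fun _ => a)) (hf : IsHInfSchwartz f) (e : X × V)
    (x : X) (v : V) : fderiv ℝ (J (cm a f)) (x, v) e = cm a (tw e f) x v := by
  obtain ⟨h1, h2⟩ := cv_hasFDerivAt ha (gm_dec hf) ((gm_contDiff hf).of_le (by simp))
    (gm_fderiv_decay hf) x v
  erw [h1.fderiv]
  rw [ContinuousLinearMap.integral_apply h2]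
  simp only [smul_apply, gm_fderiv_apply hf.differentiable, smul_eq_mul]
  rfl

/-- The basic bilinear term: convolution times function. -/
def bil (a : V → ℝ) (f g : X → V → ℝ) : X → V → ℝ := fun x v => cm a f x v * g x v

lemma bil_differentiable (ha : Grow (fun _ => a)) (hf : IsHInfSchwartz f)
    (hg : IsHInfSchwartz g) : Differentiable ℝ (J (bil a f g)) :=
  (cm_differentiable ha hf).mul hg.differentiable

lemma bil_dec (ha : Grow (fun _ => a)) (hf : IsHInfSchwartz f)
    (hg : IsHInfSchwartz g) : Dec (bil a f g) :=
  hg.dec.grow_mul (cm_grow ha hf)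

/-- The plain derivative of `a * (√μ f)` is already `a * (√μ tw e f)`, so the zeroth-order part of
`tw e` on the product is needed once, by `g`. -/
lemma tw_bil (ha : Grow (fun _ => a)) (hf : IsHInfSchwartz f) (hg : IsHInfSchwartz g)
    (e : X × V) : tw e (bil a f g) = bil a (tw e f) g + bil a f (tw e g) := by
  ext x v
  have h := ((cm_differentiable ha hf (x, v)).hasFDerivAt.mul
    (hg.differentiable (x, v)).hasFDerivAt).fderiv
  have e1 : J (bil a f g) = J (cm a f) * J g := rfl
  rw [tw, e1, h]
  simp only [add_apply, smul_apply, smul_eq_mul,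
    cm_fderiv_apply ha hf, Pi.add_apply, bil, tw]
  ring

end

/-- The direction of the `k`-th velocity coordinate. -/
def ev (k : Fin 3) : X × V := (0, EuclideanSpace.single k 1)

/-- The `(j, k)` term of the flux of `Γ(f, g)`. -/
def flux (γ : ℝ) (f g : X → V → ℝ) (j k : Fin 3) : X → V → ℝ :=
  bil (aMat γ j k) f (tw (ev k) g) - bil (aMat γ j k) (tw (ev k) f) g

lemma J_sum {ι : Type*} (s : Finset ι) (U : ι → X → V → ℝ) :
    J (∑ i ∈ s, U i) = ∑ i ∈ s, J (U i) := by
  ext p; simp [J]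

lemma tw_sum {ι : Type*} (s : Finset ι) {U : ι → X → V → ℝ} (h : ∀ i ∈ s, Differentiable ℝ (J (U i)))
    (e : X × V) : tw e (∑ i ∈ s, U i) = ∑ i ∈ s, tw e (U i) := by
  ext x v
  simp only [tw, J_sum]
  rw [fderiv_sum fun i hi => h i hi (x, v)]
  simp [tw, Finset.mul_sum]

lemma tw_sub {u w : X → V → ℝ} (hu : Differentiable ℝ (J u)) (hw : Differentiable ℝ (J w))
    (e : X × V) : tw e (u - w) = tw e u - tw e w := by
  have h : Differentiable ℝ (J ((-1 : ℝ) • w)) := hw.const_smul (-1 : ℝ)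
  have := tw_add_apply hu h e
  rw [tw_smul hw] at this
  simpa [sub_eq_add_neg] using this

section Gamma

variable {γ : ℝ} {f g : X → V → ℝ}

lemma flux_differentiable (hγ : 0 ≤ γ) (hf : IsHInfSchwartz f) (hg : IsHInfSchwartz g)
    (j k : Fin 3) : Differentiable ℝ (J (flux γ f g j k)) :=
  (bil_differentiable (Grow.aMat hγ j k) hf (hg.tw _)).sub
    (bil_differentiable (Grow.aMat hγ j k) (hf.tw _) hg)

lemma flux_dec (hγ : 0 ≤ γ) (hf : IsHInfSchwartz f) (hg : IsHInfSchwartz g)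
    (j k : Fin 3) : Dec (flux γ f g j k) :=
  (bil_dec (Grow.aMat hγ j k) hf (hg.tw _)).sub (bil_dec (Grow.aMat hγ j k) (hf.tw _) hg)

lemma cm_eq_integral {a : V → ℝ} (ha : Grow (fun _ => a)) (hf : IsHInfSchwartz f) (x : X) (v : V) :
    cm a f x v = ∫ w : V, a (v - w) * gm f x w ∧
      Integrable (fun w : V => a (v - w) * gm f x w) := by
  constructor
  · rw [cm, cv, ← integral_sub_left_eq_self _ _ v]
    simp
  · simpa using (cv_integrable ha (gm_dec hf) x v).comp_sub_left v

lemma dv_gm (hf : Differentiable ℝ (J f)) (k : Fin 3) (x : X) (v : V) :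
    dv k (gm f x) v = gm (tw (ev k) f) x v := by
  have : Differentiable ℝ (J (gm f)) := fun p => (gm_hasFDerivAt hf p).differentiableAt
  rw [dv_eq_fderiv this, gm_fderiv_apply hf]
  rfl

lemma gm_flux (hγ : 0 ≤ γ) (hf : IsHInfSchwartz f) (hg : IsHInfSchwartz g)
    (j k : Fin 3) (x : X) (v : V) :
    gm (flux γ f g j k) x v = ∫ w : V, aMat γ j k (v - w) *
      (gm f x w * dv k (gm g x) v - dv k (gm f x) w * gm g x v) := by
  simp only [dv_gm hf.differentiable, dv_gm hg.differentiable]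
  have ha := Grow.aMat hγ j k
  have e : ∀ w : V, aMat γ j k (v - w) * (gm f x w * gm (tw (ev k) g) x v -
      gm (tw (ev k) f) x w * gm g x v) =
      (aMat γ j k (v - w) * gm f x w) * gm (tw (ev k) g) x v -
      (aMat γ j k (v - w) * gm (tw (ev k) f) x w) * gm g x v := by
    intro w; ring
  simp only [e]
  rw [integral_sub ((cm_eq_integral ha hf x v).2.mul_const _)
    ((cm_eq_integral ha (hf.tw _) x v).2.mul_const _),
    integral_mul_const, integral_mul_const, ← (cm_eq_integral ha hf x v).1,
    ← (cm_eq_integral ha (hf.tw _) x v).1]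
  simp only [gm, flux, bil, Pi.sub_apply]
  ring

/-- Both derivatives in `Q` become twisted: the inner ones act on `√μ f` and `√μ g`, and the outer
one obeys `√μ⁻¹ ∂_j √μ = tw (ev j)`. This form serves the Leibniz rule and the integration by parts.
-/
lemma Gam_eq_sum_flux (hγ : 0 ≤ γ) (hf : IsHInfSchwartz f) (hg : IsHInfSchwartz g) :
    Gam γ f g = ∑ j, ∑ k, tw (ev j) (flux γ f g j k) := by
  ext x v
  have h2 : ∀ j k, dv j (fun v' : V => ∫ w : V, aMat γ j k (v' - w) *
      (gm f x w * dv k (gm g x) v' - dv k (gm f x) w * gm g x v')) v =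
      sqrtMu v * tw (ev j) (flux γ f g j k) x v := by
    intro j k
    simp only [← gm_flux hγ hf hg]
    exact dv_gm (flux_differentiable hγ hf hg j k) j x v
  change (sqrtMu v)⁻¹ * (∑ j, ∑ k, dv j (fun v' : V => ∫ w : V, aMat γ j k (v' - w) *
      (gm f x w * dv k (gm g x) v' - dv k (gm f x) w * gm g x v')) v) = _
  simp only [h2, ← Finset.mul_sum]
  rw [← mul_assoc, inv_mul_cancel₀ (sqrtMu_pos v).ne', one_mul]
  simp

lemma tw_flux (hγ : 0 ≤ γ) (hf : IsHInfSchwartz f) (hg : IsHInfSchwartz g) (e : X × V)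
    (j k : Fin 3) : tw e (flux γ f g j k) = flux γ (tw e f) g j k + flux γ f (tw e g) j k := by
  have ha := Grow.aMat hγ j k
  rw [flux, tw_sub (bil_differentiable ha hf (hg.tw _)) (bil_differentiable ha (hf.tw _) hg),
    tw_bil ha hf (hg.tw _), tw_bil ha (hf.tw _) hg, tw_comm hg.smooth e, tw_comm hf.smooth e,
    flux, flux]
  abel

lemma tw_flux_differentiable (hγ : 0 ≤ γ) (hf : IsHInfSchwartz f) (hg : IsHInfSchwartz g)
    (e : X × V) (j k : Fin 3) : Differentiable ℝ (J (tw e (flux γ f g j k))) := by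
  rw [tw_flux hγ hf hg]
  exact (flux_differentiable hγ (hf.tw e) hg j k).add (flux_differentiable hγ hf (hg.tw e) j k)

lemma Gam_differentiable (hγ : 0 ≤ γ) (hf : IsHInfSchwartz f) (hg : IsHInfSchwartz g) :
    Differentiable ℝ (J (Gam γ f g)) := by
  rw [Gam_eq_sum_flux hγ hf hg, J_sum]
  refine Differentiable.sum fun j _ => ?_
  rw [J_sum]
  exact Differentiable.sum fun k _ => tw_flux_differentiable hγ hf hg _ j k

lemma Gam_dec (hγ : 0 ≤ γ) (hf : IsHInfSchwartz f) (hg : IsHInfSchwartz g) :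
    Dec (Gam γ f g) := by
  rw [Gam_eq_sum_flux hγ hf hg]
  have := Dec.sum Finset.univ fun j _ => Dec.sum Finset.univ fun k _ =>
    (flux_dec hγ (hf.tw (ev j)) hg j k).add (flux_dec hγ hf (hg.tw (ev j)) j k)
  convert this using 3
  simp [tw_flux hγ hf hg]

/-- The Leibniz rule for a twisted derivative of `Γ`. -/
lemma tw_Gam (hγ : 0 ≤ γ) (hf : IsHInfSchwartz f) (hg : IsHInfSchwartz g) (e : X × V) :
    tw e (Gam γ f g) = Gam γ (tw e f) g + Gam γ f (tw e g) := by
  have hd := fun j k => tw_flux_differentiable hγ hf hg (ev j) j k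
  have hd2 := fun j k => flux_differentiable hγ (hf.tw e) hg j k
  have hd3 := fun j k => flux_differentiable hγ hf (hg.tw e) j k
  have hd4 : ∀ j k, Differentiable ℝ (J (flux γ (tw (ev j) f) g j k)) :=
    fun j k => flux_differentiable hγ (hf.tw (ev j)) hg j k
  have hd5 : ∀ j k, Differentiable ℝ (J (flux γ f (tw (ev j) g) j k)) :=
    fun j k => flux_differentiable hγ hf (hg.tw (ev j)) j k
  rw [Gam_eq_sum_flux hγ hf hg, Gam_eq_sum_flux hγ (hf.tw e) hg, Gam_eq_sum_flux hγ hf (hg.tw e),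
    tw_sum _ (fun j _ => by rw [J_sum]; exact Differentiable.sum fun k _ => hd j k),
    ← Finset.sum_add_distrib]
  refine Finset.sum_congr rfl fun j _ => ?_
  rw [tw_sum _ (fun k _ => hd j k), ← Finset.sum_add_distrib]
  refine Finset.sum_congr rfl fun k _ => ?_
  -- Only first-order rules for fluxes of Schwartz functions are used: each outer derivative is
  -- first distributed over `f` and `g`, then `tw e` is commuted past `tw (ev j)`.
  rw [tw_flux hγ hf hg, tw_add_apply (hd4 j k) (hd5 j k), tw_flux hγ (hf.tw _) hg,
    tw_flux hγ hf (hg.tw _), tw_flux hγ (hf.tw _) hg, tw_flux hγ hf (hg.tw _),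
    tw_comm hf.smooth e, tw_comm hg.smooth e]
  abel

end Gamma

end Landau

end

/-! ### Iterated Leibniz rule on the span of the `Γ(f, g)` -/

noncomputable section

namespace Landau

open MeasureTheory Filter Topology

/-- The space spanned by the functions `Γ(f, g)`. -/
def gamSpan (γ : ℝ) : Submodule ℝ (X → V → ℝ) :=
  Submodule.span ℝ {u | ∃ f g, IsHInfSchwartz f ∧ IsHInfSchwartz g ∧ u = Gam γ f g}

section

variable {γ : ℝ} {u : X → V → ℝ}

lemma Gam_mem (γ : ℝ) {f g : X → V → ℝ} (hf : IsHInfSchwartz f) (hg : IsHInfSchwartz g) :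
    Gam γ f g ∈ gamSpan γ := Submodule.subset_span ⟨f, g, hf, hg, rfl⟩

lemma differentiable_of_mem (hγ : 0 ≤ γ) (hu : u ∈ gamSpan γ) : Differentiable ℝ (J u) := by
  induction hu using Submodule.span_induction with
  | mem u h =>
    obtain ⟨f, g, hf, hg, rfl⟩ := h
    exact Gam_differentiable hγ hf hg
  | zero => exact differentiable_const 0
  | add a b _ _ ha hb => exact ha.add hb
  | smul c a _ ha => exact ha.const_smul c

lemma dec_of_mem (hγ : 0 ≤ γ) (hu : u ∈ gamSpan γ) : Dec u := by
  induction hu using Submodule.span_induction with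
  | mem u h =>
    obtain ⟨f, g, hf, hg, rfl⟩ := h
    exact Gam_dec hγ hf hg
  | zero => exact Dec.zero
  | add a b _ _ ha hb => exact ha.add hb
  | smul c a _ ha => exact ha.const_mul c

/-- The derivation property returns to the span. Derivatives of `Γ(f, g)` of any order are thus
differentiable and rapidly decaying, with no separate proof that `Γ(f, g)` is itself of Schwartz
class. -/
lemma tw_mem (hγ : 0 ≤ γ) (e : X × V) (hu : u ∈ gamSpan γ) : tw e u ∈ gamSpan γ := by
  induction hu using Submodule.span_induction with
  | mem u h =>
    obtain ⟨f, g, hf, hg, rfl⟩ := h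
    rw [tw_Gam hγ hf hg]
    exact add_mem (Gam_mem γ (hf.tw e) hg) (Gam_mem γ hf (hg.tw e))
  | zero =>
    have := tw_smul (u := (0 : X → V → ℝ)) (differentiable_const 0) 0 e
    rw [smul_zero, zero_smul] at this
    rw [this]
    exact zero_mem _
  | add a b ha' hb' ha hb =>
    rw [tw_add_apply (differentiable_of_mem hγ ha') (differentiable_of_mem hγ hb')]
    exact add_mem ha hb
  | smul c a ha' ha =>
    rw [tw_smul (differentiable_of_mem hγ ha')]
    exact Submodule.smul_mem _ _ ha

lemma tw_iterate_mem (hγ : 0 ≤ γ) (e : X × V) (n : ℕ) (hu : u ∈ gamSpan γ) :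
    (tw e)^[n] u ∈ gamSpan γ := by
  induction n with
  | zero => exact hu
  | succ n ih => rw [Function.iterate_succ_apply']; exact tw_mem hγ e ih

lemma tw_sum_smul (hγ : 0 ≤ γ) {ι : Type*} (s : Finset ι) (c : ι → ℝ) {U : ι → X → V → ℝ}
    (hU : ∀ i ∈ s, U i ∈ gamSpan γ) (e : X × V) :
    tw e (∑ i ∈ s, c i • U i) = ∑ i ∈ s, c i • tw e (U i) := by
  rw [tw_sum _ (fun i hi => (differentiable_of_mem hγ (hU i hi)).const_smul (c i))]
  exact Finset.sum_congr rfl fun i hi => tw_smul (differentiable_of_mem hγ (hU i hi)) _ _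

lemma tw_iterate_sum_smul (hγ : 0 ≤ γ) {ι : Type*} (s : Finset ι) (c : ι → ℝ) {U : ι → X → V → ℝ}
    (hU : ∀ i ∈ s, U i ∈ gamSpan γ) (e : X × V) (n : ℕ) :
    (tw e)^[n] (∑ i ∈ s, c i • U i) = ∑ i ∈ s, c i • (tw e)^[n] (U i) := by
  induction n with
  | zero => simp
  | succ n ih =>
    simp only [Function.iterate_succ_apply', ih]
    exact tw_sum_smul hγ s c (fun i hi => tw_iterate_mem hγ e n (hU i hi)) e

lemma IsHInfSchwartz.tw_iterate {f : X → V → ℝ} (hf : IsHInfSchwartz f) (e : X × V) (n : ℕ) :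
    IsHInfSchwartz ((Landau.tw e)^[n] f) := by
  induction n with
  | zero => exact hf
  | succ n ih => rw [Function.iterate_succ_apply']; exact ih.tw e

lemma tw_iterate_Gam_antidiagonal (hγ : 0 ≤ γ) {f g : X → V → ℝ} (hf : IsHInfSchwartz f)
    (hg : IsHInfSchwartz g) (e : X × V) (n : ℕ) :
    (tw e)^[n] (Gam γ f g) = ∑ p ∈ Finset.HasAntidiagonal.antidiagonal n,
      n.choose p.1 • Gam γ ((tw e)^[p.1] f) ((tw e)^[p.2] g) := by
  induction n with
  | zero => simp
  | succ n ih =>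
    rw [Function.iterate_succ_apply', ih]
    -- Pascal's rule splits the target into two sums over `antidiagonal n`; one carries `n.choose
    -- p.2`, matched at the end by symmetry of the binomial coefficient.
    rw [Finset.sum_antidiagonal_choose_succ_nsmul
      (fun a b => Gam γ ((tw e)^[a] f) ((tw e)^[b] g))]
    have := tw_sum_smul hγ (Finset.HasAntidiagonal.antidiagonal n) (fun p => (n.choose p.1 : ℝ))
      (U := fun p => Gam γ ((tw e)^[p.1] f) ((tw e)^[p.2] g))
      (fun p _ => Gam_mem γ (hf.tw_iterate e _) (hg.tw_iterate e _)) e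
    simp only [Nat.cast_smul_eq_nsmul] at this
    rw [this, ← Finset.sum_add_distrib]
    refine Finset.sum_congr rfl fun p hp => ?_
    rw [tw_Gam hγ (hf.tw_iterate e _) (hg.tw_iterate e _), smul_add, add_comm,
      Function.iterate_succ_apply', Function.iterate_succ_apply']
    rw [← Finset.HasAntidiagonal.mem_antidiagonal.1 hp, Nat.choose_symm_add]

lemma tw_iterate_Gam (hγ : 0 ≤ γ) {f g : X → V → ℝ} (hf : IsHInfSchwartz f)
    (hg : IsHInfSchwartz g) (e : X × V) (n : ℕ) :
    (tw e)^[n] (Gam γ f g) = ∑ p ∈ Finset.range (n + 1),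
      (n.choose p : ℝ) • Gam γ ((tw e)^[p] f) ((tw e)^[n - p] g) := by
  rw [tw_iterate_Gam_antidiagonal hγ hf hg, Finset.Nat.sum_antidiagonal_eq_sum_range_succ
    (fun a b => n.choose a • Gam γ ((tw e)^[a] f) ((tw e)^[b] g))]
  simp only [Nat.cast_smul_eq_nsmul]

/-- The direction of the field `H_δ`. -/
def hDir (δ t : ℝ) : X × V :=
  (1 / (δ + 1) * t ^ (δ + 1)) • (Pi.single 0 1, 0) + t ^ δ • (0, EuclideanSpace.single 0 1)

lemma hField_iterate_of_schwartz {f : X → V → ℝ} (hf : IsHInfSchwartz f) (δ t : ℝ) (n : ℕ) :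
    (hField δ t)^[n] f = (tw (hDir δ t))^[n] f := by
  induction n with
  | zero => rfl
  | succ n ih =>
    rw [Function.iterate_succ_apply', Function.iterate_succ_apply', ih,
      hField_eq (hf.tw_iterate _ n).differentiable]
    rfl

lemma hField_iterate_of_mem (hγ : 0 ≤ γ) (hu : u ∈ gamSpan γ) (δ t : ℝ) (n : ℕ) :
    (hField δ t)^[n] u = (tw (hDir δ t))^[n] u := by
  induction n with
  | zero => rfl
  | succ n ih =>
    rw [Function.iterate_succ_apply', Function.iterate_succ_apply', ih,
      hField_eq (differentiable_of_mem hγ (tw_iterate_mem hγ _ n hu))]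
    rfl

lemma hPow_of_schwartz {f : X → V → ℝ} (hf : IsHInfSchwartz f) (δ₁ δ₂ t : ℝ) (m n : ℕ) :
    hPow δ₁ δ₂ t m n f = (tw (hDir δ₁ t))^[m] ((tw (hDir δ₂ t))^[n] f) := by
  rw [hPow, hField_iterate_of_schwartz hf, hField_iterate_of_schwartz (hf.tw_iterate _ _)]

lemma IsHInfSchwartz.hPow {f : X → V → ℝ} (hf : IsHInfSchwartz f) (δ₁ δ₂ t : ℝ) (m n : ℕ) :
    IsHInfSchwartz (hPow δ₁ δ₂ t m n f) := by
  rw [hPow_of_schwartz hf]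
  exact (hf.tw_iterate _ _).tw_iterate _ _

lemma hPow_of_mem (hγ : 0 ≤ γ) (hu : u ∈ gamSpan γ) (δ₁ δ₂ t : ℝ) (m n : ℕ) :
    hPow δ₁ δ₂ t m n u = (tw (hDir δ₁ t))^[m] ((tw (hDir δ₂ t))^[n] u) := by
  rw [hPow, hField_iterate_of_mem hγ hu, hField_iterate_of_mem hγ (tw_iterate_mem hγ _ _ hu)]

/-- The Leibniz rule for `H_{δ₁}^m H_{δ₂}^n Γ(f, g)`. -/
theorem hPow_Gam (hγ : 0 ≤ γ) {f g : X → V → ℝ} (hf : IsHInfSchwartz f) (hg : IsHInfSchwartz g)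
    (δ₁ δ₂ t : ℝ) (m n : ℕ) :
    hPow δ₁ δ₂ t m n (Gam γ f g) =
      ∑ l ∈ Finset.range (m + 1), ∑ p ∈ Finset.range (n + 1),
        ((m.choose l : ℝ) * (n.choose p : ℝ)) •
          Gam γ (hPow δ₁ δ₂ t l p f) (hPow δ₁ δ₂ t (m - l) (n - p) g) := by
  rw [hPow_of_mem hγ (Gam_mem γ hf hg), tw_iterate_Gam hγ hf hg, tw_iterate_sum_smul hγ _ _
    (fun p _ => Gam_mem γ (hf.tw_iterate _ _) (hg.tw_iterate _ _)), Finset.sum_comm]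
  refine Finset.sum_congr rfl fun p _ => ?_
  rw [tw_iterate_Gam hγ (hf.tw_iterate _ _) (hg.tw_iterate _ _), Finset.smul_sum]
  refine Finset.sum_congr rfl fun l _ => ?_
  rw [hPow_of_schwartz hf, hPow_of_schwartz hg, smul_smul, mul_comm]

end

end Landau

end

/-! ### Pointwise bounds for the collision kernel and its convolutions -/

noncomputable section

namespace Landau

open MeasureTheory Filter Topology

/-- The quadratic polynomial `t ↦ ∫ (t f + g)²` is nonnegative, so its discriminant is not positive.
-/
lemma sq_integral_mul_le {α : Type*} [MeasurableSpace α] {μ : Measure α} {f g : α → ℝ}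
    (hf : Integrable (fun a => f a ^ 2) μ) (hg : Integrable (fun a => g a ^ 2) μ)
    (hfg : Integrable (fun a => f a * g a) μ) :
    (∫ a, f a * g a ∂μ) ^ 2 ≤ (∫ a, f a ^ 2 ∂μ) * ∫ a, g a ^ 2 ∂μ := by
  have key : ∀ t : ℝ, 0 ≤ (∫ a, f a ^ 2 ∂μ) * (t * t) + (2 * ∫ a, f a * g a ∂μ) * t +
      ∫ a, g a ^ 2 ∂μ := by
    intro t
    have : 0 ≤ ∫ a, (t * f a + g a) ^ 2 ∂μ := integral_nonneg fun a => sq_nonneg _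
    have e : ∀ a, (t * f a + g a) ^ 2 = (t * t) * f a ^ 2 + (2 * t) * (f a * g a) + g a ^ 2 := by
      intro a; ring
    simp only [e] at this
    have h1 : Integrable (fun a => t * t * f a ^ 2 + 2 * t * (f a * g a)) μ :=
      (hf.const_mul _).add (hfg.const_mul _)
    rw [integral_add h1 hg, integral_add (hf.const_mul _) (hfg.const_mul _), integral_const_mul, integral_const_mul] at this
    linarith
  have := discrim_le_zero key
  rw [discrim] at this
  linarith

lemma integral_mul_le_sqrt {α : Type*} [MeasurableSpace α] {μ : Measure α} {f g : α → ℝ}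
    (hf : Integrable (fun a => f a ^ 2) μ) (hg : Integrable (fun a => g a ^ 2) μ)
    (hfg : Integrable (fun a => f a * g a) μ) :
    ∫ a, f a * g a ∂μ ≤ √(∫ a, f a ^ 2 ∂μ) * √(∫ a, g a ^ 2 ∂μ) := by
  rw [← Real.sqrt_mul (integral_nonneg fun a => sq_nonneg _)]
  exact (le_abs_self _).trans (Real.abs_le_sqrt (sq_integral_mul_le hf hg hfg))

/-- The cross product on the Euclidean space `V`. -/
def crs (z ξ : V) : V := WithLp.toLp 2 ![z 1 * ξ 2 - z 2 * ξ 1, z 2 * ξ 0 - z 0 * ξ 2, z 0 * ξ 1 - z 1 * ξ 0]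

lemma crs_sub (z w ξ : V) : crs (z - w) ξ = crs z ξ - crs w ξ := by
  ext i; fin_cases i <;> simp [crs] <;> ring

lemma crs_add_right (z ξ η : V) : crs z (ξ + η) = crs z ξ + crs z η := by
  ext i; fin_cases i <;> simp [crs] <;> ring

lemma crs_smul_right (z ξ : V) (c : ℝ) : crs z (c • ξ) = c • crs z ξ := by
  ext i; fin_cases i <;> simp [crs] <;> ring

lemma crs_self (z : V) : crs z z = 0 := by
  ext i; fin_cases i <;> simp [crs] <;> ring

lemma norm_crs_le (z ξ : V) : ‖crs z ξ‖ ≤ ‖z‖ * ‖ξ‖ := by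
  refine abs_le_of_sq_le_sq' ?_ (by positivity) |>.2
  rw [mul_pow, EuclideanSpace.real_norm_sq_eq, EuclideanSpace.real_norm_sq_eq,
    EuclideanSpace.real_norm_sq_eq]
  simp only [Fin.sum_univ_three, crs]
  simp
  nlinarith [sq_nonneg (z 0 * ξ 0 + z 1 * ξ 1 + z 2 * ξ 2)]

/-- This separates `v` from `w` while keeping `v × ξ` whole; bounding it by `|v||ξ|` would lose the
anisotropy of the `σ`-norm. -/
lemma norm_crs_sub_le (v w ξ : V) : ‖crs (v - w) ξ‖ ≤ (1 + ‖w‖) * (‖ξ‖ + ‖crs v ξ‖) := by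
  rw [crs_sub]
  have h1 := norm_sub_le (crs v ξ) (crs w ξ)
  have h2 := norm_crs_le w ξ
  nlinarith [norm_nonneg w, norm_nonneg ξ, norm_nonneg (crs v ξ)]

/-- Lagrange's identity: `|z|² ξ·η - (z·ξ)(z·η) = (z × ξ)·(z × η)`. -/
lemma sum_aMat (γ : ℝ) (z ξ η : V) :
    ∑ j, ∑ k, aMat γ j k z * ξ j * η k = ‖z‖ ^ γ * inner ℝ (crs z ξ) (crs z η) := by
  have h := EuclideanSpace.real_norm_sq_eq z
  rw [Fin.sum_univ_three] at h
  simp only [aMat, h, PiLp.inner_apply, Fin.sum_univ_three, crs]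
  simp
  ring

lemma rpow_norm_sub_le {γ : ℝ} (hγ : 0 ≤ γ) (v w : V) :
    ‖v - w‖ ^ γ ≤ (1 + ‖v‖) ^ γ * (1 + ‖w‖) ^ γ := by
  rw [← Real.mul_rpow (by positivity) (by positivity)]
  apply Real.rpow_le_rpow (norm_nonneg _) _ hγ
  have := norm_sub_le v w
  nlinarith [norm_nonneg v, norm_nonneg w]

/-- The weighted `L¹` moment of `√μ f` controlling the convolutions. -/
def mom (γ : ℝ) (f : X → V → ℝ) (x : X) : ℝ := ∫ w, (1 + ‖w‖) ^ (γ + 2) * |gm f x w|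

section

variable {γ : ℝ} {f g h : X → V → ℝ}

lemma mom_integrable {s : ℝ} (hs : 0 ≤ s) (hf : IsHInfSchwartz f) (x : X) :
    Integrable (fun w => (1 + ‖w‖) ^ s * |gm f x w|) := by
  have := (((gm_dec hf).grow_mul (Grow.weight hs)).integrable x).abs
  refine this.congr (Eventually.of_forall fun w => ?_)
  simp only
  rw [abs_mul, abs_of_nonneg (by positivity : 0 ≤ (1 + ‖w‖) ^ s)]

lemma mom_nonneg (γ : ℝ) (f : X → V → ℝ) (x : X) : 0 ≤ mom γ f x :=
  integral_nonneg fun w => by positivity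

/-- The moment exponent `γ + 2` in `mom` collects `(1 + |w|)^γ` from `|v - w|^γ` and one factor `1 +
|w|` from each cross product. -/
lemma abs_sum_cm_le (hγ : 0 ≤ γ) (hf : IsHInfSchwartz f) (x : X) (v ξ η : V) :
    |∑ j, ∑ k, cm (aMat γ j k) f x v * ξ j * η k| ≤
      (1 + ‖v‖) ^ γ * (‖ξ‖ + ‖crs v ξ‖) * (‖η‖ + ‖crs v η‖) * mom γ f x := by
  have hi : ∀ j k, Integrable (fun w : V => aMat γ j k (v - w) * gm f x w * ξ j * η k) :=
    fun j k => ((cm_eq_integral (Grow.aMat hγ j k) hf x v).2.mul_const _).mul_const _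
  have e : ∑ j, ∑ k, cm (aMat γ j k) f x v * ξ j * η k =
      ∫ w, (‖v - w‖ ^ γ * inner ℝ (crs (v - w) ξ) (crs (v - w) η)) * gm f x w := by
    simp only [← sum_aMat, Finset.sum_mul]
    rw [integral_finsetSum _ fun j _ => integrable_finsetSum _ fun k _ => by
      refine (hi j k).congr (Eventually.of_forall fun w => ?_); simp only; ring]
    refine Finset.sum_congr rfl fun j _ => ?_
    rw [integral_finsetSum _ fun k _ => by
      refine (hi j k).congr (Eventually.of_forall fun w => ?_); simp only; ring]
    refine Finset.sum_congr rfl fun k _ => ?_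
    rw [(cm_eq_integral (Grow.aMat hγ j k) hf x v).1, ← integral_mul_const, ← integral_mul_const]
    congr 1; ext w; ring
  rw [e, mom, ← integral_const_mul]
  refine (abs_integral_le_integral_abs).trans ?_
  refine integral_mono_of_nonneg (Eventually.of_forall fun w => abs_nonneg _)
    ((mom_integrable (by linarith) hf x).const_mul _) (Eventually.of_forall fun w => ?_)
  simp only
  rw [abs_mul, abs_mul, abs_of_nonneg (by positivity : 0 ≤ ‖v - w‖ ^ γ)]
  calc _ ≤ (((1 + ‖v‖) ^ γ * (1 + ‖w‖) ^ γ) * (((1 + ‖w‖) * (‖ξ‖ + ‖crs v ξ‖)) *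
        ((1 + ‖w‖) * (‖η‖ + ‖crs v η‖)))) * |gm f x w| := by
        gcongr
        · exact rpow_norm_sub_le hγ v w
        · refine (abs_real_inner_le_norm _ _).trans ?_
          gcongr <;> exact norm_crs_sub_le _ _ _
    _ = _ := by
        rw [Real.rpow_add (by positivity)]
        norm_cast
        ring

/-- The quadratic part of the collision matrix. -/
def qMat (j k : Fin 3) (z : V) : ℝ := (if j = k then ‖z‖ ^ 2 else 0) - z j * z k

lemma abs_coord_le (z : V) (j : Fin 3) : |z j| ≤ ‖z‖ := by
  simpa using PiLp.norm_apply_le z j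

lemma abs_qMat_le (j k : Fin 3) (z : V) : |qMat j k z| ≤ 2 * ‖z‖ ^ 2 := by
  have h1 : |z j * z k| ≤ ‖z‖ ^ 2 := by
    rw [abs_mul, pow_two]; gcongr <;> exact abs_coord_le _ _
  have h2 : |(if j = k then ‖z‖ ^ 2 else 0)| ≤ ‖z‖ ^ 2 := by
    split_ifs
    · simp
    · simp
  have := abs_sub (if j = k then ‖z‖ ^ 2 else 0) (z j * z k)
  rw [qMat]; linarith

lemma norm_two_nsmul_innerSL (z : V) : ‖(2 : ℕ) • innerSL ℝ z‖ = 2 * ‖z‖ := by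
  rw [← Nat.cast_smul_eq_nsmul ℝ, norm_smul, innerSL_apply_norm]; simp

lemma qMat_hasFDerivAt (j k : Fin 3) (z : V) : ∃ L : V →L[ℝ] ℝ, HasFDerivAt (qMat j k) L z ∧
    ‖L‖ ≤ 4 * ‖z‖ := by
  have hp : ∀ j : Fin 3, HasFDerivAt (fun z : V => z j) (innerSL ℝ (EuclideanSpace.single j 1)) z := by
    intro j
    have := (innerSL ℝ (EuclideanSpace.single j (1 : ℝ))).hasFDerivAt (x := z)
    refine this.congr_of_eventuallyEq (Eventually.of_forall fun w => ?_)
    rw [innerSL_apply_apply, inner_single_one]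
  have hn : ∀ j : Fin 3, ‖innerSL ℝ (EuclideanSpace.single j (1 : ℝ))‖ = 1 := by
    intro j; rw [innerSL_apply_norm]; simp
  have h1 : ∃ L : V →L[ℝ] ℝ, HasFDerivAt (fun z : V => if j = k then ‖z‖ ^ 2 else 0) L z ∧
      ‖L‖ ≤ 2 * ‖z‖ := by
    split_ifs
    · refine ⟨_, (hasStrictFDerivAt_norm_sq z).hasFDerivAt, ?_⟩
      rw [norm_two_nsmul_innerSL]
    · exact ⟨0, hasFDerivAt_const _ _, by simp⟩
  obtain ⟨L, hL, hLn⟩ := h1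
  refine ⟨_, hL.sub ((hp j).mul (hp k)), ?_⟩
  refine (norm_sub_le _ _).trans ?_
  have := norm_add_le (z j • innerSL ℝ (EuclideanSpace.single k (1 : ℝ)))
    (z k • innerSL ℝ (EuclideanSpace.single j (1 : ℝ)))
  rw [norm_smul, norm_smul, hn, hn, Real.norm_eq_abs, Real.norm_eq_abs] at this
  linarith [abs_coord_le z j, abs_coord_le z k]

/-- The factor `|z|^γ` may fail to be differentiable at the origin, but there the kernel is
`O(|z|²)` and has derivative zero. Elsewhere `|z|^γ = (|z|²)^{γ/2}` is differentiated by the product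
rule: `4` comes from the quadratic part and `2γ` from the power. -/
lemma aMat_hasFDerivAt (hγ : 0 ≤ γ) (j k : Fin 3) (z : V) : ∃ L : V →L[ℝ] ℝ,
    HasFDerivAt (aMat γ j k) L z ∧ ‖L‖ ≤ (4 + 2 * γ) * ‖z‖ ^ (γ + 1) := by
  have hab : ∀ z, |aMat γ j k z| ≤ 2 * ‖z‖ ^ 2 * ‖z‖ ^ γ := by
    intro z
    change |qMat j k z * ‖z‖ ^ γ| ≤ _
    rw [abs_mul, abs_of_nonneg (by positivity : 0 ≤ ‖z‖ ^ γ)]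
    gcongr
    exact abs_qMat_le j k z
  by_cases hz : z = 0
  · subst hz
    refine ⟨0, ?_, by simp; positivity⟩
    refine Asymptotics.IsBigO.hasFDerivAt (n := 2) ?_ one_lt_two
    refine Asymptotics.IsBigO.of_bound 2 ?_
    filter_upwards [Metric.ball_mem_nhds (0 : V) one_pos] with w hw
    have hw1 : ‖w‖ ≤ 1 := by rw [mem_ball_zero_iff] at hw; exact hw.le
    have h1 : ‖w‖ ^ γ ≤ 1 := Real.rpow_le_one (norm_nonneg _) hw1 hγ
    rw [sub_zero, Real.norm_eq_abs, norm_pow, norm_norm]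
    refine (hab w).trans ?_
    exact mul_le_of_le_one_right (by positivity) h1
  · have hz0 : 0 < ‖z‖ := norm_pos_iff.2 hz
    obtain ⟨L, hL, hLn⟩ := qMat_hasFDerivAt j k z
    have h1 := ((hasStrictFDerivAt_norm_sq z).hasFDerivAt).rpow_const (p := γ / 2)
      (Or.inl (by positivity))
    have e : ∀ w : V, (‖w‖ ^ 2) ^ (γ / 2) = ‖w‖ ^ γ := by
      intro w
      rw [← Real.rpow_natCast, ← Real.rpow_mul (norm_nonneg _)]
      congr 1; push_cast; ring
    simp only [e] at h1
    refine ⟨_, hL.mul h1, ?_⟩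
    refine (norm_add_le _ _).trans ?_
    have e2 : (‖z‖ ^ 2) ^ (γ / 2 - 1) = ‖z‖ ^ γ / ‖z‖ ^ 2 := by
      rw [Real.rpow_sub (by positivity), e, Real.rpow_one]
    rw [norm_smul, norm_smul, norm_two_nsmul_innerSL, norm_smul, e2,
      Real.norm_eq_abs, Real.norm_eq_abs, Real.norm_eq_abs,
      abs_of_nonneg (by positivity : 0 ≤ γ / 2 * (‖z‖ ^ γ / ‖z‖ ^ 2)),
      abs_of_nonneg (by positivity : 0 ≤ ‖z‖ ^ γ), Real.rpow_add hz0, Real.rpow_one]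
    calc _ ≤ 2 * ‖z‖ ^ 2 * (γ / 2 * (‖z‖ ^ γ / ‖z‖ ^ 2) * (2 * ‖z‖)) +
          ‖z‖ ^ γ * (4 * ‖z‖) := by
          gcongr
          exact abs_qMat_le j k z
      _ = _ := by field_simp; ring

/-- Moving a twisted derivative from `f` to the kernel. -/
lemma abs_cm_tw_le (hγ : 0 ≤ γ) (hf : IsHInfSchwartz f) (j k : Fin 3) (x : X) (v : V) :
    |cm (aMat γ j k) (tw (ev k) f) x v| ≤
      (4 + 2 * γ) * (1 + ‖v‖) ^ (γ + 1) * mom γ f x := by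
  have ha := Grow.aMat hγ j k
  have hD : ∀ w : V, HasFDerivAt (fun w => aMat γ j k (v - w)) (-fderiv ℝ (aMat γ j k) (v - w)) w := by
    intro w
    obtain ⟨L, hL, _⟩ := aMat_hasFDerivAt hγ j k (v - w)
    rw [hL.fderiv]
    have := hL.comp w ((hasFDerivAt_id w).const_sub v)
    refine this.congr_fderiv ?_
    ext; simp
  have hDn : ∀ w : V, |fderiv ℝ (aMat γ j k) (v - w) (EuclideanSpace.single k 1)| ≤
      (4 + 2 * γ) * (1 + ‖v‖) ^ (γ + 1) * (1 + ‖w‖) ^ (γ + 1) := by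
    intro w
    obtain ⟨L, hL, hn⟩ := aMat_hasFDerivAt hγ j k (v - w)
    rw [hL.fderiv]
    have h1 := L.le_opNorm (EuclideanSpace.single k 1)
    rw [Real.norm_eq_abs] at h1
    refine h1.trans ?_
    simp only [PiLp.norm_single, norm_one, mul_one]
    refine hn.trans ?_
    rw [mul_assoc]
    gcongr
    exact rpow_norm_sub_le (by linarith) v w
  -- Continuity of the kernel's derivative is not needed: directional derivatives given by `fderiv`
  -- are measurable.
  have hm : AEStronglyMeasurable (fun w => fderiv ℝ (aMat γ j k) (v - w)
      (EuclideanSpace.single k 1)) := by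
    have := measurable_fderiv_apply_const ℝ (aMat γ j k) (EuclideanSpace.single k (1 : ℝ))
    exact (this.comp (measurable_const.sub measurable_id)).aestronglyMeasurable
  have hi : Integrable (fun w => fderiv ℝ (aMat γ j k) (v - w) (EuclideanSpace.single k 1)
      * gm f x w) := by
    refine ((mom_integrable (s := γ + 1) (by linarith) hf x).const_mul
      ((4 + 2 * γ) * (1 + ‖v‖) ^ (γ + 1))).mono'
      (hm.mul ((gm_dec hf).cont_left x).aestronglyMeasurable) (Eventually.of_forall fun w => ?_)
    rw [Real.norm_eq_abs, abs_mul, ← mul_assoc]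
    gcongr
    exact hDn w
  have hgd : ∀ w, fderiv ℝ (gm f x) w (EuclideanSpace.single k 1) = gm (tw (ev k) f) x w :=
    fun w => dv_gm hf.differentiable k x w
  -- The minus sign of integration by parts cancels the one from differentiating `a(v - w)` in `w`.
  have hibp := integral_mul_fderiv_eq_neg_fderiv_mul_of_integrable (μ := volume)
    (f := fun w => aMat γ j k (v - w)) (g := gm f x) (v := EuclideanSpace.single k (1 : ℝ))
    (by
      refine hi.neg.congr (Eventually.of_forall fun w => ?_)
      simp [(hD w).fderiv])
    (by simpa only [hgd] using (cm_eq_integral ha (hf.tw _) x v).2)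
    (cm_eq_integral ha hf x v).2 (fun w _ => (hD w).differentiableAt)
    (fun w _ => by
      have : Differentiable ℝ (J (gm f)) := (gm_contDiff hf).differentiable (by simp)
      exact (this (x, w)).comp (f := fun w : V => (x, w)) w
        (hasFDerivAt_prodMk_right (𝕜 := ℝ) x w).differentiableAt)
  simp only [hgd] at hibp
  rw [(cm_eq_integral ha (hf.tw _) x v).1, hibp, ← integral_neg, mom, ← integral_const_mul]
  refine (abs_integral_le_integral_abs).trans ?_
  refine integral_mono_of_nonneg (Eventually.of_forall fun w => abs_nonneg _)
    ((mom_integrable (by linarith) hf x).const_mul _) (Eventually.of_forall fun w => ?_)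
  simp only [(hD w).fderiv]
  simp only [neg_apply, neg_mul, neg_neg, abs_mul, ← mul_assoc]
  gcongr
  refine (hDn w).trans ?_
  gcongr
  · linarith [norm_nonneg w]
  · linarith

end

end Landau

end

/-! ### The trilinear estimate in velocity -/

noncomputable section

namespace Landau

open MeasureTheory Filter Topology

/-- The gradient in `v`. -/
def grd (u : V → ℝ) (v : V) : V := WithLp.toLp 2 (fun j => dv j u v)

/-- The pointwise density dominated by the `σ`-norm, up to the weight `(1 + |v|)^γ`. -/
def qd (u : V → ℝ) (v : V) : ℝ :=
  ‖grd u v‖ ^ 2 + ‖crs v (grd u v)‖ ^ 2 + ‖v‖ ^ 2 * u v ^ 2 + u v ^ 2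

/-- The weighted quadratic form with density `qd`. -/
def bForm (γ : ℝ) (u : V → ℝ) : ℝ := ∫ v, (1 + ‖v‖) ^ γ * qd u v

/-- The ten components whose squares sum to `qd`. -/
def comp : Option (Fin 3 × Fin 3) → (X → V → ℝ) → X → V → ℝ
  | none, u => u
  | some (0, j), u => fun x v => dv j (u x) v
  | some (1, j), u => fun x v => crs v (grd (u x) v) j
  | some (2, j), u => fun x v => v j * u x v

lemma qd_nonneg (u : V → ℝ) (v : V) : 0 ≤ qd u v := by
  unfold qd; positivity

lemma qd_eq_sum (u : X → V → ℝ) (x : X) (v : V) : qd (u x) v = ∑ o, comp o u x v ^ 2 := by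
  rw [Fintype.sum_option, Fintype.sum_prod_type, Fin.sum_univ_three, qd,
    EuclideanSpace.real_norm_sq_eq, EuclideanSpace.real_norm_sq_eq, EuclideanSpace.real_norm_sq_eq]
  simp only [comp, mul_pow, Finset.sum_mul, grd]
  ring

section

variable {γ : ℝ} {f g h u : X → V → ℝ}

lemma IsHInfSchwartz.dv (hu : IsHInfSchwartz u) (j : Fin 3) :
    IsHInfSchwartz (fun x v => dv j (u x) v) := by
  simp only [dv_eq_fderiv hu.differentiable]
  exact hu.fderiv_apply _

lemma comp_schwartz (hu : IsHInfSchwartz u) (o : Option (Fin 3 × Fin 3)) :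
    IsHInfSchwartz (comp o u) := by
  rcases o with _ | ⟨i, j⟩
  · exact hu
  · fin_cases i
    · exact hu.dv j
    · fin_cases j
      · exact ((hu.dv 2).coord_mul 1).sub ((hu.dv 1).coord_mul 2)
      · exact ((hu.dv 0).coord_mul 2).sub ((hu.dv 2).coord_mul 0)
      · exact ((hu.dv 1).coord_mul 0).sub ((hu.dv 0).coord_mul 1)
    · exact hu.coord_mul j

lemma qd_dec (hu : IsHInfSchwartz u) : Dec (fun x v => qd (u x) v) := by
  simp only [qd_eq_sum, pow_two]
  exact Dec.sum _ fun o _ => (comp_schwartz hu o).dec.mul (comp_schwartz hu o).dec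

lemma weight_qd_dec (hγ : 0 ≤ γ) (hu : IsHInfSchwartz u) :
    Dec (fun x v => (1 + ‖v‖) ^ γ * qd (u x) v) := (qd_dec hu).grow_mul (Grow.weight hγ)

lemma continuous_weight {s : ℝ} (hs : 0 ≤ s) : Continuous (fun v : V => (1 + ‖v‖) ^ s) := by
  have : Continuous fun r : ℝ => r ^ s := Real.continuous_rpow_const hs
  exact this.comp (by fun_prop)

/-- The linear quantity controlled by `qd`. -/
def nn (u : V → ℝ) (v : V) : ℝ := ‖grd u v‖ + ‖crs v (grd u v)‖ + (1 + ‖v‖) * |u v|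

lemma nn_nonneg (u : V → ℝ) (v : V) : 0 ≤ nn u v := by unfold nn; positivity

/-- `6 = 3 · 2`: three summands are squared, and `(1 + |v|)² ≤ 2(1 + |v|²)`. -/
lemma nn_sq_le (u : V → ℝ) (v : V) : nn u v ^ 2 ≤ 6 * qd u v := by
  have h := sq_abs (u v)
  rw [nn, qd, ← h]
  nlinarith [sq_nonneg (‖grd u v‖ - ‖crs v (grd u v)‖), sq_nonneg (‖grd u v‖ - (1 + ‖v‖) * |u v|),
    sq_nonneg (‖crs v (grd u v)‖ - (1 + ‖v‖) * |u v|), sq_nonneg ((1 - ‖v‖) * |u v|),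
    sq_nonneg ‖grd u v‖, sq_nonneg ‖crs v (grd u v)‖]

lemma nn_continuous (hu : IsHInfSchwartz u) (x : X) : Continuous (nn (u x)) := by
  have hg : Continuous (grd (u x)) := by
    refine (PiLp.continuous_toLp 2 _).comp (continuous_pi fun j => (hu.dv j).dec.cont_left x)
  have hc : Continuous (fun v => crs v (grd (u x) v)) := by
    have h1 : ∀ j, Continuous (fun v => crs v (grd (u x) v) j) :=
      fun j => (comp_schwartz hu (some (1, j))).dec.cont_left x
    exact (PiLp.continuous_toLp 2 (fun _ : Fin 3 => ℝ)).comp (continuous_pi h1)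
  have hu' := hu.dec.cont_left x
  exact (hg.norm.add hc.norm).add ((continuous_const.add continuous_norm).mul hu'.abs)

lemma integral_nn_mul_le (hγ : 0 ≤ γ) (hg : IsHInfSchwartz g) (hh : IsHInfSchwartz h) (x : X) :
    Integrable (fun v => (1 + ‖v‖) ^ γ * nn (h x) v * nn (g x) v) ∧
    ∫ v, (1 + ‖v‖) ^ γ * nn (h x) v * nn (g x) v ≤ 6 * √(bForm γ (g x)) * √(bForm γ (h x)) := by
  have hw : Continuous (fun v : V => (1 + ‖v‖) ^ (γ / 2)) :=
    continuous_weight (by linarith)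
  have hww : ∀ v : V, (1 + ‖v‖) ^ (γ / 2) * (1 + ‖v‖) ^ (γ / 2) = (1 + ‖v‖) ^ γ := by
    intro v; rw [← Real.rpow_add (by positivity)]; congr 1; ring
  have key : ∀ {u}, IsHInfSchwartz u →
      Integrable (fun v => ((1 + ‖v‖) ^ (γ / 2) * nn (u x) v) ^ 2) ∧
      ∫ v, ((1 + ‖v‖) ^ (γ / 2) * nn (u x) v) ^ 2 ≤ 6 * bForm γ (u x) := by
    intro u hu
    have hb : ∀ v, ((1 + ‖v‖) ^ (γ / 2) * nn (u x) v) ^ 2 ≤ 6 * ((1 + ‖v‖) ^ γ * qd (u x) v) := by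
      intro v
      rw [mul_pow, pow_two ((1 + ‖v‖) ^ (γ / 2)), hww, mul_left_comm]
      gcongr
      exact nn_sq_le _ _
    have hi := ((weight_qd_dec hγ hu).integrable x).const_mul 6
    constructor
    · refine hi.mono' ((hw.mul (nn_continuous hu x)).pow 2).aestronglyMeasurable
        (Eventually.of_forall fun v => ?_)
      rw [Real.norm_eq_abs, abs_of_nonneg (sq_nonneg _)]
      exact hb v
    · rw [bForm, ← integral_const_mul]
      exact integral_mono_of_nonneg (Eventually.of_forall fun v => sq_nonneg _) hi
        (Eventually.of_forall hb)
  have e : ∀ v, (1 + ‖v‖) ^ γ * nn (h x) v * nn (g x) v =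
      ((1 + ‖v‖) ^ (γ / 2) * nn (g x) v) * ((1 + ‖v‖) ^ (γ / 2) * nn (h x) v) := by
    intro v; rw [← hww]; ring
  simp only [e]
  have hi : Integrable (fun v => ((1 + ‖v‖) ^ (γ / 2) * nn (g x) v) *
      ((1 + ‖v‖) ^ (γ / 2) * nn (h x) v)) := by
    refine ((key hg).1.add (key hh).1).mono' ((hw.mul (nn_continuous hg x)).mul
      (hw.mul (nn_continuous hh x))).aestronglyMeasurable (Eventually.of_forall fun v => ?_)
    have h1 := nn_nonneg (g x) v
    have h2 := nn_nonneg (h x) v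
    rw [Real.norm_eq_abs, abs_of_nonneg (by positivity)]
    simp only [Pi.add_apply]
    nlinarith [sq_nonneg ((1 + ‖v‖) ^ (γ / 2) * nn (g x) v - (1 + ‖v‖) ^ (γ / 2) * nn (h x) v),
      sq_nonneg ((1 + ‖v‖) ^ (γ / 2) * nn (g x) v), sq_nonneg ((1 + ‖v‖) ^ (γ / 2) * nn (h x) v)]
  refine ⟨hi, (integral_mul_le_sqrt (key hg).1 (key hh).1 hi).trans ?_⟩
  calc _ ≤ √(6 * bForm γ (g x)) * √(6 * bForm γ (h x)) := by
        gcongr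
        · exact (key hg).2
        · exact (key hh).2
    _ = _ := by
        rw [Real.sqrt_mul (by norm_num), Real.sqrt_mul (by norm_num)]
        have := Real.mul_self_sqrt (by norm_num : (0 : ℝ) ≤ 6)
        linear_combination (√(bForm γ (g x)) * √(bForm γ (h x))) * this

/-- The `L²_v` adjoint of `∂_j - v_j/2` is `-(∂_j + v_j/2)`. -/
lemma integral_tw_mul {F : X → V → ℝ} (hF : Dec F) (hFd : Differentiable ℝ (J F))
    (j : Fin 3) (hF' : Dec (tw (ev j) F)) (hh : IsHInfSchwartz h) (x : X) :
    ∫ v, tw (ev j) F x v * h x v = - ∫ v, F x v * (dv j (h x) v + v j / 2 * h x v) := by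
  have hvF : Dec (fun x v => v j / 2 * F x v) := by
    have := (hF.grow_mul (Grow.coord j)).const_mul (1 / 2)
    convert this using 3; ring
  have hvh : Dec (fun x v => v j / 2 * h x v) := by
    have := (hh.dec.grow_mul (Grow.coord j)).const_mul (1 / 2)
    convert this using 3; ring
  have hdF : ∀ v, dv j (F x) v = tw (ev j) F x v + v j / 2 * F x v := fun v => dv_eq hFd j x v
  have hdiff : ∀ {u : X → V → ℝ}, Differentiable ℝ (J u) → Differentiable ℝ (u x) := by
    intro u hu v
    exact (hu (x, v)).comp (f := fun w : V => (x, w)) v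
      (hasFDerivAt_prodMk_right (𝕜 := ℝ) x v).differentiableAt
  have h1 : Integrable (fun v => dv j (F x) v * h x v) := by
    simp only [hdF]
    exact ((hF'.add hvF).mul hh.dec).integrable x
  have hibp := integral_mul_fderiv_eq_neg_fderiv_mul_of_integrable (μ := volume)
    (f := F x) (g := h x) (v := EuclideanSpace.single j (1 : ℝ))
    h1 ((hF.mul (hh.dv j).dec).integrable x) ((hF.mul hh.dec).integrable x)
    (fun v _ => hdiff hFd v) (fun v _ => hdiff hh.differentiable v)
  change ∫ v, F x v * dv j (h x) v = - ∫ v, dv j (F x) v * h x v at hibp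
  have e1 : ∀ v, tw (ev j) F x v * h x v = dv j (F x) v * h x v - v j / 2 * F x v * h x v := by
    intro v; rw [hdF]; ring
  have e2 : ∀ v, F x v * (dv j (h x) v + v j / 2 * h x v) =
      F x v * dv j (h x) v + v j / 2 * F x v * h x v := by intro v; ring
  simp only [e1, e2]
  rw [integral_sub h1 ((hvF.mul hh.dec).integrable x),
    integral_add ((hF.mul (hh.dv j).dec).integrable x) ((hvF.mul hh.dec).integrable x), hibp]
  ring

/-- The twisted gradients are `ξ = ∇h + (h/2)v` and `η = ∇g - (g/2)v`. Since `v × v = 0`, their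
cross products with `v` are those of the plain gradients, so `nn` controls them. In the term with
the derivative on `f`, the surplus factor `1 + |v|` goes to `|g|`, as `nn` permits. -/
lemma flux_pairing_le (hγ : 0 ≤ γ) (hf : IsHInfSchwartz f) (hg : IsHInfSchwartz g)
    (x : X) (v : V) :
    |∑ j, ∑ k, flux γ f g j k x v * (dv j (h x) v + v j / 2 * h x v)| ≤
      (37 + 18 * γ) * mom γ f x * ((1 + ‖v‖) ^ γ * nn (h x) v * nn (g x) v) := by
  set ξ : V := grd (h x) v + (h x v / 2) • v with hξ
  set η : V := grd (g x) v - (g x v / 2) • v with hη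
  have e1 : ∀ j, dv j (h x) v + v j / 2 * h x v = ξ j := by
    intro j; simp [hξ, grd]; ring
  have e2 : ∀ k, tw (ev k) g x v = η k := by
    intro k
    have := dv_eq hg.differentiable k x v
    simp [hη, grd, this, ev]; ring
  have hsum : ∑ j, ∑ k, flux γ f g j k x v * (dv j (h x) v + v j / 2 * h x v) =
      (∑ j, ∑ k, cm (aMat γ j k) f x v * ξ j * η k) -
      ∑ j, ∑ k, cm (aMat γ j k) (tw (ev k) f) x v * ξ j * g x v := by
    rw [← Finset.sum_sub_distrib]
    refine Finset.sum_congr rfl fun j _ => ?_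
    rw [← Finset.sum_sub_distrib]
    refine Finset.sum_congr rfl fun k _ => ?_
    rw [e1, flux]
    simp only [Pi.sub_apply, bil, e2]
    ring
  have hM := mom_nonneg γ f x
  have hcξ : crs v ξ = crs v (grd (h x) v) := by
    rw [hξ, crs_add_right, crs_smul_right, crs_self, smul_zero, add_zero]
  have hcη : crs v η = crs v (grd (g x) v) := by
    rw [hη, sub_eq_add_neg, ← neg_smul, crs_add_right, crs_smul_right, crs_self, smul_zero, add_zero]
  have hnξ : ‖ξ‖ ≤ ‖grd (h x) v‖ + (1 + ‖v‖) * |h x v| := by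
    refine (norm_add_le _ _).trans ?_
    rw [norm_smul, Real.norm_eq_abs, abs_div, abs_two]
    nlinarith [norm_nonneg v, abs_nonneg (h x v), mul_nonneg (norm_nonneg v) (abs_nonneg (h x v))]
  have hnη : ‖η‖ ≤ ‖grd (g x) v‖ + (1 + ‖v‖) * |g x v| := by
    refine (norm_sub_le _ _).trans ?_
    rw [norm_smul, Real.norm_eq_abs, abs_div, abs_two]
    nlinarith [norm_nonneg v, abs_nonneg (g x v), mul_nonneg (norm_nonneg v) (abs_nonneg (g x v))]
  have h1 : ‖ξ‖ + ‖crs v ξ‖ ≤ nn (h x) v := by rw [hcξ, nn]; linarith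
  have h2 : ‖η‖ + ‖crs v η‖ ≤ nn (g x) v := by rw [hcη, nn]; linarith
  have hnh := nn_nonneg (h x) v
  have hng := nn_nonneg (g x) v
  have hA : |∑ j, ∑ k, cm (aMat γ j k) f x v * ξ j * η k| ≤
      mom γ f x * ((1 + ‖v‖) ^ γ * nn (h x) v * nn (g x) v) := by
    refine (abs_sum_cm_le hγ hf x v ξ η).trans ?_
    rw [mul_comm]
    gcongr
  have hB : ∀ j k, |cm (aMat γ j k) (tw (ev k) f) x v * ξ j * g x v| ≤
      (4 + 2 * γ) * mom γ f x * ((1 + ‖v‖) ^ γ * nn (h x) v * nn (g x) v) := by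
    intro j k
    have h3 : |ξ j| ≤ nn (h x) v :=
      (abs_coord_le ξ j).trans (le_trans (by linarith [norm_nonneg (crs v ξ)]) h1)
    have h4 : (1 + ‖v‖) * |g x v| ≤ nn (g x) v := by
      rw [nn]; linarith [norm_nonneg (grd (g x) v), norm_nonneg (crs v (grd (g x) v))]
    rw [abs_mul, abs_mul]
    calc _ ≤ ((4 + 2 * γ) * (1 + ‖v‖) ^ (γ + 1) * mom γ f x) * nn (h x) v * |g x v| := by
          gcongr
          exact abs_cm_tw_le hγ hf j k x v
      _ = (4 + 2 * γ) * mom γ f x * ((1 + ‖v‖) ^ γ * nn (h x) v * ((1 + ‖v‖) * |g x v|)) := by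
          rw [Real.rpow_add (by positivity), Real.rpow_one]; ring
      _ ≤ _ := by gcongr
  rw [hsum]
  refine (abs_sub _ _).trans ?_
  -- Nine terms of size `4 + 2γ`, together with the constant one of `hA`, give `37 + 18γ`.
  have hB2 : |∑ j, ∑ k, cm (aMat γ j k) (tw (ev k) f) x v * ξ j * g x v| ≤
      ∑ _j : Fin 3, ∑ _k : Fin 3,
        (4 + 2 * γ) * mom γ f x * ((1 + ‖v‖) ^ γ * nn (h x) v * nn (g x) v) :=
    (Finset.abs_sum_le_sum_abs _ _).trans (Finset.sum_le_sum fun j _ =>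
      (Finset.abs_sum_le_sum_abs _ _).trans (Finset.sum_le_sum fun k _ => hB j k))
  simp only [Finset.sum_const, Finset.card_univ, Fintype.card_fin, nsmul_eq_mul] at hB2
  push_cast at hB2
  linarith

lemma abs_integral_Gam_mul_le_mom (hγ : 0 ≤ γ) (hf : IsHInfSchwartz f) (hg : IsHInfSchwartz g)
    (hh : IsHInfSchwartz h) (x : X) :
    |∫ v, Gam γ f g x v * h x v| ≤
      6 * (37 + 18 * γ) * mom γ f x * √(bForm γ (g x)) * √(bForm γ (h x)) := by
  have hT : ∀ j k, Dec (tw (ev j) (flux γ f g j k)) := by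
    intro j k
    rw [tw_flux hγ hf hg]
    exact (flux_dec hγ (hf.tw _) hg j k).add (flux_dec hγ hf (hg.tw _) j k)
  have hP : ∀ j, Dec (fun x v => dv j (h x) v + v j / 2 * h x v) := by
    intro j
    have := (hh.dv j).dec.add ((hh.dec.grow_mul (Grow.coord j)).const_mul (1 / 2))
    convert this using 3; ring
  have e : ∫ v, Gam γ f g x v * h x v =
      - ∫ v, ∑ j, ∑ k, flux γ f g j k x v * (dv j (h x) v + v j / 2 * h x v) := by
    rw [Gam_eq_sum_flux hγ hf hg]
    simp only [Finset.sum_apply, Finset.sum_mul]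
    rw [integral_finsetSum _ fun j _ => integrable_finsetSum _ fun k _ =>
        ((hT j k).mul hh.dec).integrable x,
      integral_finsetSum _ fun j _ => integrable_finsetSum _ fun k _ =>
        ((flux_dec hγ hf hg j k).mul (hP j)).integrable x, ← Finset.sum_neg_distrib]
    refine Finset.sum_congr rfl fun j _ => ?_
    rw [integral_finsetSum _ fun k _ => ((hT j k).mul hh.dec).integrable x,
      integral_finsetSum _ fun k _ => ((flux_dec hγ hf hg j k).mul (hP j)).integrable x,
      ← Finset.sum_neg_distrib]
    exact Finset.sum_congr rfl fun k _ => integral_tw_mul (flux_dec hγ hf hg j k)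
      (flux_differentiable hγ hf hg j k) j (hT j k) hh x
  obtain ⟨hi, hle⟩ := integral_nn_mul_le hγ hg hh x
  rw [e, abs_neg]
  refine (abs_integral_le_integral_abs).trans ?_
  have hM := mom_nonneg γ f x
  calc _ ≤ ∫ v, (37 + 18 * γ) * mom γ f x * ((1 + ‖v‖) ^ γ * nn (h x) v * nn (g x) v) :=
        integral_mono_of_nonneg (Eventually.of_forall fun v => abs_nonneg _) (hi.const_mul _)
          (Eventually.of_forall fun v => flux_pairing_le hγ hf hg x v)
    _ ≤ (37 + 18 * γ) * mom γ f x * (6 * √(bForm γ (g x)) * √(bForm γ (h x))) := by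
        rw [integral_const_mul]; gcongr
    _ = _ := by ring

/-- Cauchy–Schwarz: the Gaussian factor makes the polynomial weight square integrable. -/
lemma mom_le (hγ : 0 ≤ γ) : ∃ C : ℝ, 0 ≤ C ∧ ∀ f, IsHInfSchwartz f → ∀ x,
    mom γ f x ≤ C * √(∫ v, f x v ^ 2) := by
  have hd : Dec (fun (_ : X) (w : V) => (1 + ‖w‖) ^ (γ + 2) * sqrtMu w) :=
    dec_sqrtMu.grow_mul (Grow.weight (by linarith))
  refine ⟨√(∫ w : V, ((1 + ‖w‖) ^ (γ + 2) * sqrtMu w) ^ 2), Real.sqrt_nonneg _, fun f hf x => ?_⟩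
  have e : ∀ w, (1 + ‖w‖) ^ (γ + 2) * |gm f x w| = ((1 + ‖w‖) ^ (γ + 2) * sqrtMu w) * |f x w| := by
    intro w; rw [gm, abs_mul, abs_of_pos (sqrtMu_pos w)]; ring
  have h1 : Integrable (fun w : V => ((1 + ‖w‖) ^ (γ + 2) * sqrtMu w) ^ 2) := by
    simpa only [pow_two] using (hd.mul hd).integrable x
  have h2 : Integrable (fun w : V => |f x w| ^ 2) := by
    simp only [sq_abs]
    simpa only [pow_two] using (hf.dec.mul hf.dec).integrable x
  have := integral_mul_le_sqrt h1 h2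
    (by simpa only [e] using mom_integrable (s := γ + 2) (by linarith) hf x)
  simpa only [mom, e, sq_abs] using this

/-- The trilinear estimate in the velocity variable. -/
lemma abs_integral_Gam_mul_le (hγ : 0 ≤ γ) : ∃ C : ℝ, 0 ≤ C ∧ ∀ f g h, IsHInfSchwartz f →
    IsHInfSchwartz g → IsHInfSchwartz h → ∀ x, |∫ v, Gam γ f g x v * h x v| ≤
      C * √(∫ v, f x v ^ 2) * √(bForm γ (g x)) * √(bForm γ (h x)) := by
  obtain ⟨C, hC, hM⟩ := mom_le hγ
  refine ⟨6 * (37 + 18 * γ) * C, by positivity, fun f g h hf hg hh x => ?_⟩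
  refine (abs_integral_Gam_mul_le_mom hγ hf hg hh x).trans ?_
  rw [mul_assoc (6 * (37 + 18 * γ)) C]
  gcongr
  exact hM f hf x

end

end Landau

end

/-! ### Coercivity of `ā` and of the `σ`-norm -/

noncomputable section

namespace Landau

open MeasureTheory Filter Topology

/-- The reflection in the `i`-th coordinate. -/
def refl (i : Fin 3) : V ≃ₗᵢ[ℝ] V :=
  LinearIsometryEquiv.piLpCongrRight 2
    (fun j => if j = i then LinearIsometryEquiv.neg ℝ else LinearIsometryEquiv.refl ℝ ℝ)

lemma refl_apply (i j : Fin 3) (w : V) : refl i w j = if j = i then - w j else w j := by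
  simp only [refl, LinearIsometryEquiv.piLpCongrRight_apply]
  split_ifs <;> simp

lemma integral_eq_zero_of_odd (i : Fin 3) {F : V → ℝ} (h : ∀ w, F (refl i w) = - F w) :
    ∫ w, F w = 0 := by
  have h1 := (refl i).measurePreserving.integral_comp
    (refl i).toHomeomorph.measurableEmbedding F
  simp only [h, integral_neg] at h1
  linarith

/-- The Maxwellian restricted to a spherical shell. -/
def shell (a b : ℝ) : V → ℝ := {w : V | a ≤ ‖w‖ ∧ ‖w‖ ≤ b}.indicator maxwellian

lemma shell_isometry (a b : ℝ) (R : V ≃ₗᵢ[ℝ] V) (w : V) : shell a b (R w) = shell a b w := by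
  simp [shell, Set.indicator, maxwellian]

lemma measurableSet_shell (a b : ℝ) : MeasurableSet {w : V | a ≤ ‖w‖ ∧ ‖w‖ ≤ b} :=
  (measurableSet_le measurable_const measurable_norm).inter
    (measurableSet_le measurable_norm measurable_const)

lemma shell_nonneg (a b : ℝ) (w : V) : 0 ≤ shell a b w :=
  Set.indicator_nonneg (fun w _ => (maxwellian_pos w).le) w

lemma shell_le (a b : ℝ) (w : V) : shell a b w ≤ maxwellian w :=
  Set.indicator_le_self' (fun w _ => (maxwellian_pos w).le) w

lemma integrable_mul_maxwellian {m : V → ℝ} (hm : Grow (fun _ => m)) :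
    Integrable (fun w => m w * maxwellian w) :=
  (dec_maxwellian.grow_mul hm).integrable 0

lemma integrable_mul_shell {m : V → ℝ} (hm : Grow (fun _ => m)) (a b : ℝ) :
    Integrable (fun w => m w * shell a b w) := by
  have := (integrable_mul_maxwellian hm).indicator (measurableSet_shell a b)
  refine this.congr (Eventually.of_forall fun w => ?_)
  simp only [shell, Set.indicator]
  split_ifs <;> simp

lemma integral_mul_shell_pos {m : V → ℝ} (hm : Grow (fun _ => m)) (h0 : ∀ w, 0 ≤ m w) {a b : ℝ}
    (w₀ : V) (ha : a < ‖w₀‖) (hb : ‖w₀‖ < b) (hw : 0 < m w₀) : 0 < ∫ w, m w * shell a b w := by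
  have hmc : Continuous m := hm.cont.comp (Continuous.prodMk_right (0 : X))
  rw [integral_pos_iff_support_of_nonneg (fun w => mul_nonneg (h0 w) (shell_nonneg a b w))
    (integrable_mul_shell hm a b)]
  have hU : IsOpen {w : V | a < ‖w‖ ∧ ‖w‖ < b ∧ 0 < m w} :=
    (isOpen_lt continuous_const continuous_norm).inter
      ((isOpen_lt continuous_norm continuous_const).inter (isOpen_lt continuous_const hmc))
  refine (hU.measure_pos volume ⟨w₀, ha, hb, hw⟩).trans_le (measure_mono ?_)
  rintro w ⟨h1, h2, h3⟩
  have : shell a b w = maxwellian w :=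
    Set.indicator_of_mem (s := {w : V | a ≤ ‖w‖ ∧ ‖w‖ ≤ b}) ⟨h1.le, h2.le⟩ _
  rw [Function.mem_support, this]
  exact (mul_pos h3 (maxwellian_pos w)).ne'

/-- The shell averages of `|(v - w) × ξ|²`. -/
lemma shell_lower {a b : ℝ} (h0 : 0 ≤ a) (hab : a < b) : ∃ c : ℝ, 0 < c ∧ ∀ v ξ : V,
    c * (‖ξ‖ ^ 2 + ‖crs v ξ‖ ^ 2) ≤ ∫ w, ‖crs (v - w) ξ‖ ^ 2 * shell a b w := by
  set r := (a + b) / 2 with hr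
  have hr0 : 0 < r := by rw [hr]; linarith
  have hsq : ∀ i : Fin 3, Grow (fun _ w => w i ^ 2) := by
    intro i; simpa only [pow_two] using (Grow.coord i).mul (Grow.coord i)
  have hn : ∀ i : Fin 3, ‖EuclideanSpace.single i r‖ = r := by
    intro i; rw [PiLp.norm_single, Real.norm_eq_abs, abs_of_pos hr0]
  have hm : 0 < ∫ w, (1 : ℝ) * shell a b w :=
    integral_mul_shell_pos (m := fun _ => 1) (Grow.const 1) (fun _ => zero_le_one)
      (EuclideanSpace.single 0 r) (by rw [hn, hr]; linarith) (by rw [hn, hr]; linarith) zero_lt_one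
  have hmi : ∀ i : Fin 3, 0 < ∫ w : V, w i ^ 2 * shell a b w := fun i =>
    integral_mul_shell_pos (m := fun w => w i ^ 2) (hsq i) (fun _ => sq_nonneg _)
      (EuclideanSpace.single i r) (by rw [hn, hr]; linarith) (by rw [hn, hr]; linarith)
      (by simp; positivity)
  set m := ∫ w, (1 : ℝ) * shell a b w
  set M : Fin 3 → ℝ := fun i => ∫ w : V, w i ^ 2 * shell a b w with hM
  -- The shell is invariant under coordinate reflections, so first and mixed second moments vanish
  -- and only the mass `m` and the diagonal moments `M i` survive.
  have hlin : ∀ i : Fin 3, ∫ w : V, w i * shell a b w = 0 := fun i =>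
    integral_eq_zero_of_odd i fun w => by rw [shell_isometry, refl_apply]; simp
  have hcross : ∀ i j : Fin 3, i ≠ j → ∫ w : V, (w i * w j) * shell a b w = 0 := fun i j hij =>
    integral_eq_zero_of_odd i fun w => by
      rw [shell_isometry, refl_apply, refl_apply]; simp [hij.symm]
  have hgc := fun i j : Fin 3 => integrable_mul_shell ((Grow.coord i).mul (Grow.coord j)) a b
  have hgl := fun i : Fin 3 => integrable_mul_shell (Grow.coord i) a b
  have hgs := fun i : Fin 3 => integrable_mul_shell (hsq i) a b
  have hg1 := integrable_mul_shell (Grow.const 1) a b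
  -- the contribution of a pair of coordinates
  have pair : ∀ (v ξ : V) (i j : Fin 3), i ≠ j →
      Integrable (fun w : V => ((v i - w i) * ξ j - (v j - w j) * ξ i) ^ 2 * shell a b w) ∧
      ∫ w : V, ((v i - w i) * ξ j - (v j - w j) * ξ i) ^ 2 * shell a b w =
        (v i * ξ j - v j * ξ i) ^ 2 * m + ξ j ^ 2 * M i + ξ i ^ 2 * M j := by
    intro v ξ i j hij
    have e : ∀ w : V, ((v i - w i) * ξ j - (v j - w j) * ξ i) ^ 2 * shell a b w =
        ((((v i * ξ j - v j * ξ i) ^ 2 * (1 * shell a b w) +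
        (-2 * (v i * ξ j - v j * ξ i) * ξ j) * (w i * shell a b w)) +
        (2 * (v i * ξ j - v j * ξ i) * ξ i) * (w j * shell a b w)) +
        (ξ j ^ 2 * (w i ^ 2 * shell a b w) + ξ i ^ 2 * (w j ^ 2 * shell a b w))) +
        (-2 * ξ i * ξ j) * ((w i * w j) * shell a b w) := by intro w; ring
    simp only [e]
    have i1 := hg1.const_mul ((v i * ξ j - v j * ξ i) ^ 2)
    have i2 := (hgl i).const_mul (-2 * (v i * ξ j - v j * ξ i) * ξ j)
    have i3 := (hgl j).const_mul (2 * (v i * ξ j - v j * ξ i) * ξ i)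
    have i4 := (hgs i).const_mul (ξ j ^ 2)
    have i5 := (hgs j).const_mul (ξ i ^ 2)
    have i6 := (hgc i j).const_mul (-2 * ξ i * ξ j)
    refine ⟨(((i1.add i2).add i3).add (i4.add i5)).add i6, ?_⟩
    erw [integral_add (((i1.add i2).add i3).add (i4.add i5)) i6,
      integral_add ((i1.add i2).add i3) (i4.add i5), integral_add (i1.add i2) i3,
      integral_add i1 i2, integral_add i4 i5]
    simp only [integral_const_mul]
    rw [hlin, hlin, hcross i j hij]
    have hm1 : m = ∫ w, shell a b w := by simp [m]
    simp only [hM, hm1]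
    ring
  -- Summing the three pairs gives `m |v × ξ|²` plus each `ξ_i²` twice, weighted by the moments in
  -- the two other directions.
  refine ⟨min m (min (M 0) (min (M 1) (M 2))), by simp [hm, hM, hmi], fun v ξ => ?_⟩
  set c := min m (min (M 0) (min (M 1) (M 2)))
  have c0 : c ≤ m := min_le_left _ _
  have c1 : c ≤ M 0 := (min_le_right _ _).trans (min_le_left _ _)
  have c2 : c ≤ M 1 := (min_le_right _ _).trans ((min_le_right _ _).trans (min_le_left _ _))
  have c3 : c ≤ M 2 := (min_le_right _ _).trans ((min_le_right _ _).trans (min_le_right _ _))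
  have hc : 0 < c := by simp [c, hm, hM, hmi]
  have e : ∀ w : V, ‖crs (v - w) ξ‖ ^ 2 * shell a b w =
      (((v 1 - w 1) * ξ 2 - (v 2 - w 2) * ξ 1) ^ 2 * shell a b w +
      ((v 2 - w 2) * ξ 0 - (v 0 - w 0) * ξ 2) ^ 2 * shell a b w) +
      ((v 0 - w 0) * ξ 1 - (v 1 - w 1) * ξ 0) ^ 2 * shell a b w := by
    intro w
    rw [EuclideanSpace.real_norm_sq_eq, Fin.sum_univ_three]
    simp [crs]; ring
  obtain ⟨p1, q1⟩ := pair v ξ 1 2 (by decide)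
  obtain ⟨p2, q2⟩ := pair v ξ 2 0 (by decide)
  obtain ⟨p3, q3⟩ := pair v ξ 0 1 (by decide)
  simp only [e]
  erw [integral_add (p1.add p2) p3, integral_add p1 p2]
  rw [q1, q2, q3, EuclideanSpace.real_norm_sq_eq, EuclideanSpace.real_norm_sq_eq,
    Fin.sum_univ_three, Fin.sum_univ_three]
  simp only [crs, Matrix.cons_val_zero, Matrix.cons_val_one, Matrix.cons_val]
  have k : ∀ {s t : ℝ}, c ≤ t → c * s ^ 2 ≤ s ^ 2 * t := fun {s t} h => by
    rw [mul_comm]; exact mul_le_mul_of_nonneg_left h (sq_nonneg s)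
  have l1 := k (s := v 1 * ξ 2 - v 2 * ξ 1) c0
  have l2 := k (s := v 2 * ξ 0 - v 0 * ξ 2) c0
  have l3 := k (s := v 0 * ξ 1 - v 1 * ξ 0) c0
  have l4 := k (s := ξ 2) c2
  have l5 := k (s := ξ 1) c3
  have l6 := k (s := ξ 0) c3
  have l7 := k (s := ξ 2) c1
  have l8 := k (s := ξ 1) c1
  have l9 := k (s := ξ 0) c2
  have z := fun s : ℝ => mul_nonneg hc.le (sq_nonneg s)
  have z0 := z (ξ 0)
  have z1 := z (ξ 1)
  have z2 := z (ξ 2)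
  linarith

section

variable {γ : ℝ}

lemma aBar_eq_cv (γ : ℝ) (j k : Fin 3) :
    (fun (_ : X) v => aBar γ j k v) = cv (aMat γ j k) (fun _ => maxwellian) := by
  ext x v
  rw [aBar, cv, ← integral_sub_left_eq_self _ _ v]
  simp

lemma aBar_grow (hγ : 0 ≤ γ) (j k : Fin 3) : Grow (fun _ v => aBar γ j k v) := by
  rw [aBar_eq_cv]
  exact cv_grow (Grow.aMat hγ j k) dec_maxwellian

lemma aBar_quad (hγ : 0 ≤ γ) (v ξ : V) : ∑ j, ∑ k, aBar γ j k v * ξ j * ξ k =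
    ∫ w, ‖v - w‖ ^ γ * ‖crs (v - w) ξ‖ ^ 2 * maxwellian w ∧
    Integrable (fun w => ‖v - w‖ ^ γ * ‖crs (v - w) ξ‖ ^ 2 * maxwellian w) := by
  have hi : ∀ j k, Integrable (fun w : V => aMat γ j k (v - w) * ξ j * ξ k * maxwellian w) := by
    intro j k
    have h1 := (cv_integrable (Grow.aMat hγ j k) dec_maxwellian (0 : X) v).comp_sub_left v
    refine (h1.mul_const (ξ j * ξ k)).congr (Eventually.of_forall fun w => ?_)
    simp only [sub_sub_cancel]; ring
  have e : ∀ w, ‖v - w‖ ^ γ * ‖crs (v - w) ξ‖ ^ 2 * maxwellian w =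
      ∑ j, ∑ k, aMat γ j k (v - w) * ξ j * ξ k * maxwellian w := by
    intro w
    simp only [← Finset.sum_mul]
    rw [sum_aMat, real_inner_self_eq_norm_sq]
  simp only [e]
  refine ⟨?_, integrable_finsetSum _ fun j _ => integrable_finsetSum _ fun k _ => hi j k⟩
  rw [integral_finsetSum _ fun j _ => integrable_finsetSum _ fun k _ => hi j k]
  refine Finset.sum_congr rfl fun j _ => ?_
  rw [integral_finsetSum _ fun k _ => hi j k]
  refine Finset.sum_congr rfl fun k _ => ?_
  rw [aBar, ← integral_mul_const, ← integral_mul_const]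
  congr 1; ext w; ring

/-- Coercivity of the matrix `ā`. -/
lemma aBar_lower (hγ : 0 ≤ γ) : ∃ c : ℝ, 0 < c ∧ ∀ v ξ : V,
    c * ((1 + ‖v‖) ^ γ * (‖ξ‖ ^ 2 + ‖crs v ξ‖ ^ 2)) ≤ ∑ j, ∑ k, aBar γ j k v * ξ j * ξ k := by
  -- Two shells keep `w` away from `v`: for `|v| ≥ 2` and `|w| ≤ 1`, or `|v| < 2` and `|w| ≥ 4`, the
  -- triangle inequality gives `|v - w| ≥ (1 + |v|)/3`.
  obtain ⟨c₁, hc₁, h₁⟩ := shell_lower le_rfl (zero_lt_one' ℝ)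
  obtain ⟨c₂, hc₂, h₂⟩ := shell_lower (a := 4) (b := 5) (by norm_num) (by norm_num)
  have main : ∀ (a b c : ℝ) (v ξ : V), (∀ w : V, a ≤ ‖w‖ → ‖w‖ ≤ b → (1 + ‖v‖) / 3 ≤ ‖v - w‖) →
      c * (‖ξ‖ ^ 2 + ‖crs v ξ‖ ^ 2) ≤ ∫ w, ‖crs (v - w) ξ‖ ^ 2 * shell a b w →
      (1 / 3 : ℝ) ^ γ * c * ((1 + ‖v‖) ^ γ * (‖ξ‖ ^ 2 + ‖crs v ξ‖ ^ 2)) ≤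
        ∑ j, ∑ k, aBar γ j k v * ξ j * ξ k := by
    intro a b c v ξ hw hle
    obtain ⟨e, hi⟩ := aBar_quad hγ v ξ
    rw [e]
    calc _ = ((1 + ‖v‖) / 3) ^ γ * (c * (‖ξ‖ ^ 2 + ‖crs v ξ‖ ^ 2)) := by
          have h3 : ((1 + ‖v‖) / 3) ^ γ = (1 / 3 : ℝ) ^ γ * (1 + ‖v‖) ^ γ := by
            rw [← Real.mul_rpow (by positivity) (by positivity)]; congr 1; ring
          rw [h3]; ring
      _ ≤ ((1 + ‖v‖) / 3) ^ γ * ∫ w, ‖crs (v - w) ξ‖ ^ 2 * shell a b w := by gcongr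
      _ = ∫ w, ((1 + ‖v‖) / 3) ^ γ * (‖crs (v - w) ξ‖ ^ 2 * shell a b w) :=
          (integral_const_mul _ _).symm
      _ ≤ _ := by
          refine integral_mono_of_nonneg (Eventually.of_forall fun w => ?_) hi
            (Eventually.of_forall fun w => ?_)
          · have := shell_nonneg a b w
            simp only [Pi.zero_apply]; positivity
          · simp only
            by_cases hs : a ≤ ‖w‖ ∧ ‖w‖ ≤ b
            · rw [mul_assoc]
              have := shell_nonneg a b w
              gcongr
              · exact hw w hs.1 hs.2
              · exact shell_le a b w
            · have : shell a b w = 0 :=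
                Set.indicator_of_notMem (s := {w : V | a ≤ ‖w‖ ∧ ‖w‖ ≤ b}) hs _
              rw [this]
              have := (maxwellian_pos w).le
              simp only [mul_zero]; positivity
  refine ⟨(1 / 3 : ℝ) ^ γ * min c₁ c₂, by positivity, fun v ξ => ?_⟩
  rcases le_or_gt 2 ‖v‖ with hv | hv
  · refine main 0 1 _ v ξ (fun w _ hw => ?_) (le_trans ?_ (h₁ v ξ))
    · have := norm_sub_norm_le v w
      linarith
    · gcongr; exact min_le_left _ _
  · refine main 4 5 _ v ξ (fun w hw _ => ?_) (le_trans ?_ (h₂ v ξ))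
    · have := norm_sub_norm_le w v
      rw [norm_sub_rev] at this
      linarith
    · gcongr; exact min_le_right _ _

variable {u : X → V → ℝ}

/-- One coordinate suffices: integrating by parts against `∂₀ v₀ = 1` gives `∫ u² = -2 ∫ v₀ u ∂₀u`,
and Young's inequality finishes. -/
lemma integral_sq_le_harmonic (hu : IsHInfSchwartz u) (x : X) :
    ∫ v, u x v ^ 2 ≤ ∫ v, (‖grd (u x) v‖ ^ 2 + ‖v‖ ^ 2 * u x v ^ 2) := by
  have hd : Dec (fun x v => u x v ^ 2) := by simpa only [pow_two] using hu.dec.mul hu.dec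
  have hud : Differentiable ℝ (u x) := fun v =>
    (hu.differentiable (x, v)).comp (f := fun w : V => (x, w)) v
      (hasFDerivAt_prodMk_right (𝕜 := ℝ) x v).differentiableAt
  have h1 : ∀ v : V, fderiv ℝ (fun v : V => v 0) v (EuclideanSpace.single 0 1) = 1 := by
    intro v
    have : (fun v : V => v 0) = EuclideanSpace.proj (𝕜 := ℝ) (0 : Fin 3) := rfl
    rw [this, ContinuousLinearMap.fderiv]; simp
  have h2 : ∀ v : V, fderiv ℝ (fun v => u x v ^ 2) v (EuclideanSpace.single 0 1) =
      2 * (u x v * dv 0 (u x) v) := by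
    intro v
    rw [((hud v).hasFDerivAt.pow 2).fderiv]
    simp [dv]; ring
  have hj := (hu.dec.mul (hu.dv 0).dec).const_mul 2
  have hvj := hj.grow_mul (Grow.coord 0)
  have hibp := integral_mul_fderiv_eq_neg_fderiv_mul_of_integrable (μ := volume)
    (f := fun v : V => v 0) (g := fun v => u x v ^ 2) (v := EuclideanSpace.single 0 (1 : ℝ))
    (by simpa only [h1, one_mul] using hd.integrable x)
    (by simpa only [h2] using hvj.integrable x)
    ((hd.grow_mul (Grow.coord 0)).integrable x)
    (fun v _ => (EuclideanSpace.proj (𝕜 := ℝ) (0 : Fin 3)).differentiableAt)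
    (fun v _ => (hud v).pow 2)
  simp only [h1, h2, one_mul] at hibp
  have e : ∫ v, u x v ^ 2 = ∫ v, - (v 0 * (2 * (u x v * dv 0 (u x) v))) := by
    rw [integral_neg, hibp, neg_neg]
  have hR : Dec (fun x v => ‖grd (u x) v‖ ^ 2 + ‖v‖ ^ 2 * u x v ^ 2) := by
    have h3 : Dec (fun x v => ∑ j, dv j (u x) v * dv j (u x) v) :=
      Dec.sum _ fun j _ => (hu.dv j).dec.mul (hu.dv j).dec
    have h4 := hd.grow_mul (Grow.norm.mul Grow.norm)
    have := h3.add h4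
    convert this using 4
    · rw [EuclideanSpace.real_norm_sq_eq]; simp [grd, pow_two]
    · ring
  rw [e]
  refine integral_mono (hvj.integrable x).neg (hR.integrable x) fun v => ?_
  simp only
  have k1 : dv 0 (u x) v ^ 2 ≤ ‖grd (u x) v‖ ^ 2 := by
    rw [← sq_abs]; gcongr; exact abs_coord_le (grd (u x) v) 0
  have k2 : v 0 ^ 2 ≤ ‖v‖ ^ 2 := by
    rw [← sq_abs]; gcongr; exact abs_coord_le v 0
  have k3 := mul_le_mul_of_nonneg_right k2 (sq_nonneg (u x v))
  nlinarith [sq_nonneg (v 0 * u x v + dv 0 (u x) v)]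

/-- The density of the `σ`-norm up to the weight. -/
def sd (u : V → ℝ) (v : V) : ℝ := ‖grd u v‖ ^ 2 + ‖crs v (grd u v)‖ ^ 2 + ‖v‖ ^ 2 * u v ^ 2

lemma sq_dec (hu : IsHInfSchwartz u) : Dec (fun x v => u x v ^ 2) := by
  simpa only [pow_two] using hu.dec.mul hu.dec

lemma sd_dec (hu : IsHInfSchwartz u) : Dec (fun x v => sd (u x) v) := by
  have := (qd_dec hu).sub (sq_dec hu)
  convert this using 3
  rw [qd, sd]; ring

/-- `sd` lacks the bare `u²` of `qd`. For `|v| ≥ 1` the term `|v|² u²` covers it; for `|v| < 1` the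
weight is at most `2^γ` and the harmonic oscillator inequality applies. -/
lemma bForm_le_sd (hγ : 0 ≤ γ) (hu : IsHInfSchwartz u) (x : X) :
    bForm γ (u x) ≤ (2 + 2 ^ γ) * ∫ v, (1 + ‖v‖) ^ γ * sd (u x) v := by
  have hsw := (sd_dec hu).grow_mul (Grow.weight hγ)
  have hone : ∀ v : V, 1 ≤ (1 + ‖v‖) ^ γ := fun v =>
    Real.one_le_rpow (by linarith [norm_nonneg v]) hγ
  have hsd : ∀ v, 0 ≤ sd (u x) v := fun v => by unfold sd; positivity
  have h1 : ∫ v, u x v ^ 2 ≤ ∫ v, (1 + ‖v‖) ^ γ * sd (u x) v := by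
    refine (integral_sq_le_harmonic hu x).trans ?_
    refine integral_mono_of_nonneg (Eventually.of_forall fun v => by positivity)
      (hsw.integrable x) (Eventually.of_forall fun v => ?_)
    have := mul_le_mul_of_nonneg_right (hone v) (hsd v)
    simp only [sd] at this ⊢
    linarith [sq_nonneg ‖crs v (grd (u x) v)‖]
  calc bForm γ (u x) ≤ ∫ v, (2 * ((1 + ‖v‖) ^ γ * sd (u x) v) + 2 ^ γ * u x v ^ 2) := by
        refine integral_mono_of_nonneg (Eventually.of_forall fun v => ?_)
          (((hsw.integrable x).const_mul 2).add (((sq_dec hu).integrable x).const_mul _))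
          (Eventually.of_forall fun v => ?_)
        · have := qd_nonneg (u x) v
          simp only [Pi.zero_apply]; positivity
        · have e : qd (u x) v = sd (u x) v + u x v ^ 2 := rfl
          simp only
          rw [e, mul_add]
          have hw0 : 0 ≤ (1 + ‖v‖) ^ γ := by positivity
          have hp : 0 ≤ 2 ^ γ * u x v ^ 2 := by positivity
          have : (1 + ‖v‖) ^ γ * u x v ^ 2 ≤
              (1 + ‖v‖) ^ γ * sd (u x) v + 2 ^ γ * u x v ^ 2 := by
            rcases le_or_gt 1 ‖v‖ with hv | hv
            · have h5 : u x v ^ 2 ≤ sd (u x) v := by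
                have : 1 * u x v ^ 2 ≤ ‖v‖ ^ 2 * u x v ^ 2 := by
                  gcongr; exact one_le_pow₀ hv
                rw [sd]
                linarith [sq_nonneg ‖grd (u x) v‖, sq_nonneg ‖crs v (grd (u x) v)‖]
              have := mul_le_mul_of_nonneg_left h5 hw0
              linarith
            · have h5 : (1 + ‖v‖) ^ γ ≤ 2 ^ γ := by
                apply Real.rpow_le_rpow (by positivity) (by linarith) hγ
              have h6 := mul_le_mul_of_nonneg_right h5 (sq_nonneg (u x v))
              have := mul_nonneg hw0 (hsd v)
              linarith
          linarith
    _ = 2 * (∫ v, (1 + ‖v‖) ^ γ * sd (u x) v) + 2 ^ γ * ∫ v, u x v ^ 2 := by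
        rw [integral_add ((hsw.integrable x).const_mul 2) (((sq_dec hu).integrable x).const_mul _),
          integral_const_mul, integral_const_mul]
    _ ≤ _ := by
        have : (0 : ℝ) ≤ 2 ^ γ := by positivity
        nlinarith

lemma sigmaSq_eq (hγ : 0 ≤ γ) (hu : IsHInfSchwartz u) :
    Dec (fun x v => (∑ j, ∑ k, aBar γ j k v * grd (u x) v j * grd (u x) v k) +
      1 / 4 * (∑ j, ∑ k, aBar γ j k v * v j * v k) * u x v ^ 2) ∧ ∀ x,
    sigmaSq γ (u x) = ∫ v, ((∑ j, ∑ k, aBar γ j k v * grd (u x) v j * grd (u x) v k) +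
      1 / 4 * (∑ j, ∑ k, aBar γ j k v * v j * v k) * u x v ^ 2) := by
  have h : ∀ j k, Dec (fun x v => aBar γ j k v * dv j (u x) v * dv k (u x) v +
      1 / 4 * aBar γ j k v * v j * v k * u x v ^ 2) := by
    intro j k
    have h1 := ((hu.dv j).dec.mul (hu.dv k).dec).grow_mul (aBar_grow hγ j k)
    have h2 := ((sq_dec hu).grow_mul (((aBar_grow hγ j k).mul (Grow.coord j)).mul
      (Grow.coord k))).const_mul (1 / 4)
    have := h1.add h2
    convert this using 3; ring
  have e : (fun (x : X) (v : V) => (∑ j, ∑ k, aBar γ j k v * grd (u x) v j * grd (u x) v k) +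
      1 / 4 * (∑ j, ∑ k, aBar γ j k v * v j * v k) * u x v ^ 2) =
      fun x v => ∑ j, ∑ k, (aBar γ j k v * dv j (u x) v * dv k (u x) v +
      1 / 4 * aBar γ j k v * v j * v k * u x v ^ 2) := by
    ext x v
    simp only [Finset.sum_add_distrib, Finset.sum_mul, Finset.mul_sum, grd]
    congr 1
    refine Finset.sum_congr rfl fun j _ => Finset.sum_congr rfl fun k _ => ?_
    ring
  have e' := fun x v => congr_fun (congr_fun e x) v
  simp only at e'
  refine ⟨?_, fun x => ?_⟩
  · rw [e]
    exact Dec.sum _ fun j _ => Dec.sum _ fun k _ => h j k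
  · simp only [e']
    rw [sigmaSq, integral_finsetSum _ fun j _ => (Dec.sum _ fun k _ => h j k).integrable x]
    refine Finset.sum_congr rfl fun j _ => ?_
    rw [integral_finsetSum _ fun k _ => (h j k).integrable x]

/-- The `σ`-norm controls the weighted form `bForm`. -/
lemma bForm_le_sigmaSq (hγ : 0 ≤ γ) : ∃ C : ℝ, 0 ≤ C ∧ ∀ u, IsHInfSchwartz u → ∀ x,
    bForm γ (u x) ≤ C * sigmaSq γ (u x) := by
  obtain ⟨c, hc, hl⟩ := aBar_lower hγ
  refine ⟨(2 + 2 ^ γ) * (4 / c), by positivity, fun u hu x => (bForm_le_sd hγ hu x).trans ?_⟩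
  rw [mul_assoc]
  gcongr
  obtain ⟨hd, he⟩ := sigmaSq_eq hγ hu
  rw [he, ← integral_const_mul]
  refine integral_mono_of_nonneg (Eventually.of_forall fun v => ?_)
    ((hd.integrable x).const_mul _) (Eventually.of_forall fun v => ?_)
  · simp only [Pi.zero_apply, sd]; positivity
  · simp only
    -- Coercivity is used twice: at `ξ = ∇u`, and at `ξ = v`, where the cross product vanishes and
    -- `|v|² u²` remains. The `1/4` in the `σ`-norm leads to `c / 4`.
    have h1 := hl v (grd (u x) v)
    have h2 := mul_le_mul_of_nonneg_right (hl v v) (sq_nonneg (u x v))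
    rw [crs_self, norm_zero] at h2
    have hw : 0 ≤ (1 + ‖v‖) ^ γ := by positivity
    have h3 : c / 4 * ((1 + ‖v‖) ^ γ * sd (u x) v) ≤
        (∑ j, ∑ k, aBar γ j k v * grd (u x) v j * grd (u x) v k) +
          1 / 4 * (∑ j, ∑ k, aBar γ j k v * v j * v k) * u x v ^ 2 := by
      have h4 : 0 ≤ c * ((1 + ‖v‖) ^ γ * (‖grd (u x) v‖ ^ 2 + ‖crs v (grd (u x) v)‖ ^ 2)) := by
        positivity
      rw [sd]
      nlinarith
    calc (1 + ‖v‖) ^ γ * sd (u x) v = 4 / c * (c / 4 * ((1 + ‖v‖) ^ γ * sd (u x) v)) := by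
          field_simp
      _ ≤ _ := by gcongr

end

end Landau

end

/-! ### Sobolev inequalities on the torus from averages over shrinking cubes -/

noncomputable section

namespace Landau

open MeasureTheory Filter Topology Pointwise

section Periodic

lemma isCompact_torusBox : IsCompact torusBox := isCompact_Icc

lemma volume_torusBox : volume.real torusBox = 1 := by
  simp [torusBox, Measure.real, Real.volume_Icc_pi]

/-- Periodicity with respect to `ℤ³`. -/
def Per (F : X → ℝ) : Prop := ∀ (i : Fin 3) (x : X), F (x + Pi.single i 1) = F x

lemma setIntegral_torusBox (G : X → ℝ) : ∫ y in torusBox, G y =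
    ∫ y in ZSpan.fundamentalDomain (Pi.basisFun ℝ (Fin 3)), G y := by
  rw [ZSpan.fundamentalDomain_pi_basisFun, torusBox]
  refine (setIntegral_congr_set ?_).symm
  exact Measure.univ_pi_Ico_ae_eq_Icc

/-- A translate of the unit cube is again a fundamental domain of `ℤ³`. -/
lemma Per.integral_translate {G : X → ℝ} (hG : Per G) (x : X) :
    ∫ y in torusBox, G (x + y) = ∫ y in torusBox, G y := by
  have hD := ZSpan.isAddFundamentalDomain' (Pi.basisFun ℝ (Fin 3)) (volume : Measure X)
  have hinv : ∀ (g : (Submodule.span ℤ (Set.range (Pi.basisFun ℝ (Fin 3)))).toAddSubgroup) (y : X),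
      G (g +ᵥ y) = G y := by
    rintro ⟨g, hg⟩ y
    change G (g + y) = G y
    let A : AddSubgroup X :=
      { carrier := {g | ∀ y, G (g + y) = G y}
        add_mem' := fun {a b} ha hb y => by rw [add_assoc, ha, hb]
        zero_mem' := fun y => by rw [zero_add]
        neg_mem' := fun {a} ha y => by rw [← ha (-a + y), add_neg_cancel_left] }
    have hle : Submodule.span ℤ (Set.range (Pi.basisFun ℝ (Fin 3))) ≤ A.toIntSubmodule := by
      refine Submodule.span_le.2 ?_
      rintro _ ⟨i, rfl⟩ z
      rw [Pi.basisFun_apply, add_comm]; exact hG i z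
    exact hle hg y
  have : Countable (Submodule.span ℤ (Set.range (Pi.basisFun ℝ (Fin 3)))).toAddSubgroup :=
    inferInstanceAs (Countable (Submodule.span ℤ (Set.range (Pi.basisFun ℝ (Fin 3)))))
  have hD' := hD.vadd_of_comm x
  have h1 := hD'.setIntegral_eq hD (f := G) hinv
  have h2 := (measurePreserving_add_left volume x).setIntegral_image_emb
    (MeasurableEquiv.addLeft x).measurableEmbedding G
    (ZSpan.fundamentalDomain (Pi.basisFun ℝ (Fin 3)))
  rw [setIntegral_torusBox, setIntegral_torusBox, ← h2, ← h1]
  rfl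

lemma integral_swap_compact {α β : Type*} [TopologicalSpace α] [MeasurableSpace α]
    [OpensMeasurableSpace α] [TopologicalSpace β] [MeasurableSpace β] [OpensMeasurableSpace β]
    [SecondCountableTopologyEither α β]
    {μ : Measure α} {ν : Measure β} [IsLocallyFiniteMeasure μ] [IsLocallyFiniteMeasure ν]
    [SFinite μ] [SFinite ν] {f : α → β → ℝ} (hf : Continuous (Function.uncurry f))
    {K : Set α} {L : Set β} (hK : IsCompact K) (hL : IsCompact L) (hKm : MeasurableSet (K ×ˢ L)) :
    ∫ a in K, ∫ b in L, f a b ∂ν ∂μ = ∫ b in L, ∫ a in K, f a b ∂μ ∂ν := by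
  refine integral_integral_swap ?_
  rw [Measure.prod_restrict]
  exact hf.continuousOn.integrableOn_compact' (hK.prod hL) hKm

/-- The averages of `G` over the cubes `x + r⁴ Q`. -/
def avg (G : X → ℝ) (r : ℝ) (x : X) : ℝ := ∫ y in torusBox, G (x + r ^ 4 • y)

variable {F G : X → ℝ}

lemma avg_continuous (hG : Continuous G) : Continuous (fun p : ℝ × X => avg G p.1 p.2) := by
  refine continuous_parametric_integral_of_continuous
    (f := fun (p : ℝ × X) (y : X) => G (p.2 + p.1 ^ 4 • y)) ?_ isCompact_torusBox
  exact hG.comp (by fun_prop)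

lemma Continuous.integrableOn_box (hG : Continuous G) : IntegrableOn G torusBox :=
  hG.continuousOn.integrableOn_compact isCompact_torusBox

lemma avg_nonneg (hG0 : ∀ x, 0 ≤ G x) (r : ℝ) (x : X) : 0 ≤ avg G r x :=
  integral_nonneg fun _ => hG0 _

/-- The map `y ↦ r⁴ y` has Jacobian `r¹²` in dimension three, and it maps the unit cube into itself.
-/
lemma pow_mul_avg_le (hG : Continuous G) (hG0 : ∀ x, 0 ≤ G x) (hGp : Per G) {r : ℝ}
    (hr : r ∈ Set.Icc (0 : ℝ) 1) (x : X) : r ^ 12 * avg G r x ≤ ∫ y in torusBox, G y := by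
  rcases hr.1.eq_or_lt with h | h
  · rw [← h]; simp; exact integral_nonneg hG0
  · have h1 := Measure.setIntegral_comp_smul (volume : Measure X) (fun y => G (x + y)) torusBox
      (R := r ^ 4) (by positivity)
    have h2 : r ^ 4 • torusBox ⊆ torusBox := by
      rintro _ ⟨y, hy, rfl⟩
      have hr1 : r ^ 4 ≤ 1 := pow_le_one₀ hr.1 hr.2
      refine ⟨fun i => ?_, fun i => ?_⟩
      · have := hy.1 i
        simp at this ⊢; positivity
      · have h3 := hy.2 i
        have h4 := hy.1 i
        simp at h3 h4 ⊢
        exact mul_le_one₀ hr1 h4 h3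
    rw [avg, h1, ← hGp.integral_translate x]
    have h3 : |((r ^ 4) ^ Module.finrank ℝ X)⁻¹| = (r ^ 12)⁻¹ := by
      rw [abs_of_nonneg (by positivity)]; simp [X]; ring
    rw [h3, smul_eq_mul, ← mul_assoc, mul_inv_cancel₀ (by positivity), one_mul]
    exact setIntegral_mono_set (Continuous.integrableOn_box (hG.comp (by fun_prop)))
      (Eventually.of_forall fun y => hG0 _) (Eventually.of_forall h2)

lemma integral_avg (hG : Continuous G) (hGp : Per G) (r : ℝ) :
    ∫ x in torusBox, avg G r x = ∫ y in torusBox, G y := by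
  simp only [avg]
  rw [integral_swap_compact (f := fun (x y : X) => G (x + r ^ 4 • y)) (hG.comp (by fun_prop))
    isCompact_torusBox isCompact_torusBox (isCompact_torusBox.measurableSet.prod
      isCompact_torusBox.measurableSet)]
  have e : ∀ y : X, ∫ x in torusBox, G (x + r ^ 4 • y) = ∫ y in torusBox, G y := fun y => by
    simp only [← hGp.integral_translate (r ^ 4 • y), add_comm]
  simp [e, volume_torusBox]

lemma avg_sq_le (hG : Continuous G) (r : ℝ) (x : X) : avg G r x ^ 2 ≤ avg (fun x => G x ^ 2) r x := by
  have hc : Continuous (fun y => G (x + r ^ 4 • y)) := hG.comp (by fun_prop)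
  have := sq_integral_mul_le (μ := volume.restrict torusBox) (f := fun y => G (x + r ^ 4 • y))
    (g := fun _ => 1) (Continuous.integrableOn_box (hc.pow 2))
    (Continuous.integrableOn_box (continuous_const.pow 2))
    (by simp only [mul_one]; exact Continuous.integrableOn_box hc)
  simpa [avg, volume_torusBox] using this

/-- The averaged representation inequality underlying the Sobolev embeddings. -/
def Rep (F G : X → ℝ) : Prop := ∀ x, ∀ y ∈ torusBox,
  F x ≤ 2 * F (x + y) + 96 * ∫ r in Set.Icc (0 : ℝ) 1, r ^ 6 * G (x + r ^ 4 • y)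

lemma Rep.averaged (h : Rep F G) (hF : Continuous F) (hG : Continuous G) (hFp : Per F) (x : X) :
    F x ≤ 2 * (∫ y in torusBox, F y) +
      96 * ∫ r in Set.Icc (0 : ℝ) 1, r ^ 6 * avg G r x := by
  have hc : Continuous (Function.uncurry fun (y : X) (r : ℝ) => r ^ 6 * G (x + r ^ 4 • y)) := by
    have : Continuous fun p : X × ℝ => G (x + p.2 ^ 4 • p.1) := hG.comp (by fun_prop)
    exact (by fun_prop : Continuous fun p : X × ℝ => p.2 ^ 6).mul this
  have h1 : Continuous fun y => F (x + y) := hF.comp (by fun_prop)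
  have h2 : Continuous fun y => ∫ r in Set.Icc (0 : ℝ) 1, r ^ 6 * G (x + r ^ 4 • y) :=
    continuous_parametric_integral_of_continuous hc isCompact_Icc
  have := setIntegral_mono_on (μ := volume) (s := torusBox) (f := fun _ => F x)
    (g := fun y => 2 * F (x + y) + 96 * ∫ r in Set.Icc (0 : ℝ) 1, r ^ 6 * G (x + r ^ 4 • y))
    (Continuous.integrableOn_box continuous_const)
    (Continuous.integrableOn_box ((h1.const_mul 2).add (h2.const_mul 96)))
    isCompact_torusBox.measurableSet (h x)
  rw [setIntegral_const, volume_torusBox, one_smul, integral_add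
    (Continuous.integrableOn_box (h1.const_mul 2)) (Continuous.integrableOn_box (h2.const_mul 96)),
    integral_const_mul, integral_const_mul, hFp.integral_translate,
    integral_swap_compact hc isCompact_torusBox isCompact_Icc
      (isCompact_torusBox.measurableSet.prod measurableSet_Icc)] at this
  simpa only [integral_const_mul, avg] using this

lemma Continuous.integrableOn_unit {g : ℝ → ℝ} (hg : Continuous g) :
    IntegrableOn g (Set.Icc (0 : ℝ) 1) := hg.continuousOn.integrableOn_compact isCompact_Icc

lemma integral_unit_le {g : ℝ → ℝ} (hg : Continuous g) {c : ℝ}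
    (h : ∀ r ∈ Set.Icc (0 : ℝ) 1, g r ≤ c) : ∫ r in Set.Icc (0 : ℝ) 1, g r ≤ c := by
  have := setIntegral_mono_on (μ := volume) (Continuous.integrableOn_unit hg)
    (Continuous.integrableOn_unit (g := fun _ => c) continuous_const) measurableSet_Icc h
  simpa using this

lemma avg_continuous_left (hG : Continuous G) (x : X) : Continuous (fun r => avg G r x) :=
  (avg_continuous hG).comp (by fun_prop : Continuous fun r : ℝ => (r, x))

/-- The sup bound. -/
lemma Rep.sup_le (h : Rep F G) (hF : Continuous F) (hG : Continuous G) (hFp : Per F)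
    (hGp : Per G) (x : X) :
    F x ≤ 2 * (∫ y in torusBox, F y) + 96 * √(∫ y in torusBox, G y ^ 2) := by
  refine (h.averaged hF hG hFp x).trans ?_
  gcongr
  refine integral_unit_le ((by fun_prop : Continuous fun r : ℝ => r ^ 6).mul
    (avg_continuous_left hG x)) fun r hr => Real.le_sqrt_of_sq_le ?_
  have hp : Per (fun x => G x ^ 2) := fun i x => by simp only [hGp i x]
  -- The exponent four of the path is fitted to this line: squaring its speed gives `r⁶`, and
  -- squaring that gives the Jacobian `r¹²`.
  calc (r ^ 6 * avg G r x) ^ 2 = r ^ 12 * avg G r x ^ 2 := by ring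
    _ ≤ r ^ 12 * avg (fun x => G x ^ 2) r x := by
        have := avg_sq_le hG r x
        have := hr.1
        gcongr
    _ ≤ _ := pow_mul_avg_le (hG.pow 2) (fun x => sq_nonneg _) hp hr x

/-- The square bound. -/
lemma Rep.sq_le (h : Rep F G) (hF : Continuous F) (hG : Continuous G) (hFp : Per F)
    (hGp : Per G) (hF0 : ∀ x, 0 ≤ F x) (hG0 : ∀ x, 0 ≤ G x) :
    ∫ x in torusBox, F x ^ 2 ≤
      8 * (∫ y in torusBox, F y) ^ 2 + 18432 * (∫ y in torusBox, G y) ^ 2 := by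
  set a := ∫ y in torusBox, F y
  set b := ∫ y in torusBox, G y with hb
  have hb0 : 0 ≤ b := integral_nonneg hG0
  have ha0 : 0 ≤ a := integral_nonneg hF0
  have hc1 : ∀ x, Continuous (fun r : ℝ => r ^ 6 * avg G r x) := fun x =>
    (by fun_prop : Continuous fun r : ℝ => r ^ 6).mul (avg_continuous_left hG x)
  -- After Cauchy–Schwarz in `r`, one average in `r¹² avg²` is bounded by `b` together with the
  -- power of `r`; the other has `x`-integral `b`.
  have hT : ∀ x, (∫ r in Set.Icc (0 : ℝ) 1, r ^ 6 * avg G r x) ^ 2 ≤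
      b * ∫ r in Set.Icc (0 : ℝ) 1, avg G r x := by
    intro x
    have h1 := sq_integral_mul_le (μ := volume.restrict (Set.Icc (0 : ℝ) 1))
      (f := fun r => r ^ 6 * avg G r x) (g := fun _ => 1)
      (Continuous.integrableOn_unit ((hc1 x).pow 2))
      (Continuous.integrableOn_unit (continuous_const.pow 2))
      (by simp only [mul_one]; exact Continuous.integrableOn_unit (hc1 x))
    simp only [mul_one, one_pow, integral_const, measureReal_restrict_apply_univ,
      Real.volume_real_Icc, sub_zero, zero_le_one, sup_of_le_left, smul_eq_mul] at h1
    refine h1.trans ?_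
    rw [← integral_const_mul]
    refine setIntegral_mono_on (Continuous.integrableOn_unit ((hc1 x).pow 2))
      (Continuous.integrableOn_unit ((avg_continuous_left hG x).const_mul b)) measurableSet_Icc
      fun r hr => ?_
    have h2 := pow_mul_avg_le hG hG0 hGp hr x
    have h3 := mul_le_mul_of_nonneg_right h2 (avg_nonneg hG0 r x)
    calc _ = r ^ 12 * avg G r x * avg G r x := by ring
      _ ≤ _ := h3
  have hA : Continuous (fun x => ∫ r in Set.Icc (0 : ℝ) 1, avg G r x) :=
    continuous_parametric_integral_of_continuous (f := fun (x : X) (r : ℝ) => avg G r x)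
      ((avg_continuous hG).comp continuous_swap) isCompact_Icc
  have hpt : ∀ x, F x ^ 2 ≤ 8 * a ^ 2 + 18432 * (b * ∫ r in Set.Icc (0 : ℝ) 1, avg G r x) := by
    intro x
    have h1 := h.averaged hF hG hFp x
    set T := ∫ r in Set.Icc (0 : ℝ) 1, r ^ 6 * avg G r x
    have h2 := hT x
    have h3 : F x ^ 2 ≤ (2 * a + 96 * T) ^ 2 := by
      have := hF0 x
      gcongr
    nlinarith [sq_nonneg (2 * a - 96 * T)]
  have h1 := setIntegral_mono (μ := volume) (s := torusBox) (f := fun x => F x ^ 2)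
    (g := fun x => 8 * a ^ 2 + 18432 * (b * ∫ r in Set.Icc (0 : ℝ) 1, avg G r x)) (Continuous.integrableOn_box (hF.pow 2))
    (Continuous.integrableOn_box (continuous_const.add ((hA.const_mul b).const_mul 18432))) hpt
  refine h1.trans (le_of_eq ?_)
  rw [integral_add (Continuous.integrableOn_box continuous_const)
    (Continuous.integrableOn_box ((hA.const_mul b).const_mul 18432)), integral_const_mul,
    integral_const_mul, integral_const_mul, setIntegral_const, volume_torusBox, one_smul,
    integral_swap_compact (f := fun (x : X) (r : ℝ) => avg G r x)
      ((avg_continuous hG).comp continuous_swap) isCompact_torusBox isCompact_Icc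
      (isCompact_torusBox.measurableSet.prod measurableSet_Icc)]
  simp only [integral_avg hG hGp, setIntegral_const, Real.volume_real_Icc]
  simp only [← hb]
  norm_num
  ring

end Periodic

end Landau

end

/-! ### Sobolev embeddings for quadratic forms in velocity -/

noncomputable section

namespace Landau

open MeasureTheory Filter Topology

section

variable {u w φ : X → V → ℝ}

lemma IsHInfSchwartz.dx (hu : IsHInfSchwartz u) (i : Fin 3) : IsHInfSchwartz (dx i u) := by
  rw [dx_eq hu.differentiable]; exact hu.tw _

lemma IsHInfSchwartz.differentiable_left (hu : IsHInfSchwartz u) (v : V) :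
    Differentiable ℝ (fun x => u x v) := fun x =>
  (hu.differentiable (x, v)).comp (f := fun y : X => (y, v)) x
    (hasFDerivAt_prodMk_left (𝕜 := ℝ) x v).differentiableAt

lemma dx_add (hu : IsHInfSchwartz u) (hw : IsHInfSchwartz w) (i : Fin 3) :
    dx i (fun x v => u x v + w x v) = fun x v => dx i u x v + dx i w x v := by
  ext x v
  simp only [dx]
  erw [fderiv_add (hu.differentiable_left v x) (hw.differentiable_left v x)]
  rfl

lemma dx_mul_left (hu : IsHInfSchwartz u) (m : V → ℝ) (i : Fin 3) :
    dx i (fun x v => m v * u x v) = fun x v => m v * dx i u x v := by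
  ext x v
  simp only [dx]
  rw [fderiv_const_mul (hu.differentiable_left v x)]
  rfl

lemma dx_dv (hu : IsHInfSchwartz u) (i j : Fin 3) :
    dx i (fun x v => dv j (u x) v) = fun x v => dv j (dx i u x) v := by
  have e1 : (fun x v => dv j (u x) v) = fun x v => tw (ev j) u x v + v j / 2 * u x v := by
    ext x v; exact dv_eq hu.differentiable j x v
  have hm : IsHInfSchwartz (fun x v => v j / 2 * u x v) := by
    have := (hu.coord_mul j).smul (1 / 2)
    convert this using 1
    ext x v
    simp only [Pi.smul_apply, smul_eq_mul]; ring
  rw [e1, dx_add (hu.tw _) hm, dx_mul_left hu (fun v => v j / 2)]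
  ext x v
  rw [dv_eq (hu.dx i).differentiable, dx_eq (hu.tw _).differentiable, dx_eq hu.differentiable,
    tw_comm hu.smooth]
  rfl

lemma dx_sub_mul {a b : X → V → ℝ} (ha : IsHInfSchwartz a) (hb : IsHInfSchwartz b)
    (i j k : Fin 3) : dx i (fun x v => v j * a x v - v k * b x v) =
      fun x v => v j * dx i a x v - v k * dx i b x v := by
  have h := dx_add (ha.coord_mul j) ((hb.coord_mul k).neg) i
  have e : (fun (x : X) (v : V) => v j * a x v - v k * b x v) =
      fun x v => v j * a x v + (-fun x v => v k * b x v : X → V → ℝ) x v := by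
    ext x v; simp [sub_eq_add_neg]
  have e2 : (-fun x v => v k * b x v : X → V → ℝ) = fun x v => (-v k) * b x v := by
    ext x v; simp
  rw [e, h, e2, dx_mul_left ha (fun v => v j), dx_mul_left hb (fun v => - v k)]
  ext x v; ring

lemma dx_comp (hu : IsHInfSchwartz u) (i : Fin 3) (o : Option (Fin 3 × Fin 3)) :
    dx i (comp o u) = comp o (dx i u) := by
  have key := fun j k l m : Fin 3 => dx_sub_mul (hu.dv k) (hu.dv m) i j l
  simp only [dx_dv hu] at key
  rcases o with _ | ⟨a, j⟩
  · rfl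
  · fin_cases a
    · exact dx_dv hu i j
    · fin_cases j
      · exact key 1 2 2 1
      · exact key 2 0 0 2
      · exact key 0 1 1 0
    · exact dx_mul_left hu (fun v => v j) i

lemma dx_comm (hu : IsHInfSchwartz u) (i j : Fin 3) : dx i (dx j u) = dx j (dx i u) := by
  rw [dx_eq (hu.dx j).differentiable, dx_eq hu.differentiable, dx_eq (hu.dx i).differentiable,
    dx_eq hu.differentiable, tw_comm hu.smooth]

/-- The fundamental theorem of calculus along `r ↦ x + r⁴ y`, squared. -/
lemma sq_le_path (hu : IsHInfSchwartz u) (x : X) {y : X} (hy : y ∈ torusBox) (v : V) :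
    u x v ^ 2 ≤ 2 * u (x + y) v ^ 2 +
      96 * ∫ r in Set.Icc (0 : ℝ) 1, r ^ 6 * ∑ i, dx i u (x + r ^ 4 • y) v ^ 2 := by
  set D : ℝ → ℝ := fun r => 4 * r ^ 3 * ∑ i, y i * dx i u (x + r ^ 4 • y) v with hD
  have hcd : ∀ i, Continuous (fun r : ℝ => dx i u (x + r ^ 4 • y) v) := fun i =>
    ((hu.dx i).dec.cont_right v).comp (by fun_prop)
  have hDc : Continuous D :=
    (by fun_prop : Continuous fun r : ℝ => 4 * r ^ 3).mul
      (continuous_finsetSum _ fun i _ => (hcd i).const_mul _)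
  have hL : ∀ L : X →L[ℝ] ℝ, L y = ∑ i, y i * L (Pi.single i 1) := by
    intro L
    conv_lhs => rw [pi_eq_sum_univ' y]
    simp [map_sum]
  have hder : ∀ r : ℝ, HasDerivAt (fun r : ℝ => u (x + r ^ 4 • y) v) (D r) r := by
    intro r
    have h1 := (hu.differentiable_left v (x + r ^ 4 • y)).hasFDerivAt
    have h2 : HasDerivAt (fun r : ℝ => x + r ^ 4 • y) ((4 * r ^ 3) • y) r := by
      have := ((hasDerivAt_pow 4 r).smul_const y).const_add x
      simpa using this
    have h3 := h1.comp_hasDerivAt r h2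
    refine h3.congr_deriv ?_
    rw [map_smul, smul_eq_mul, hD]
    congr 1
    exact hL _
  have hftc := intervalIntegral.integral_eq_sub_of_hasDerivAt (a := 0) (b := 1)
    (fun r _ => hder r) (hDc.intervalIntegrable _ _)
  rw [intervalIntegral.integral_of_le zero_le_one, ← integral_Icc_eq_integral_Ioc] at hftc
  simp only [one_pow, one_smul, ne_eq, OfNat.ofNat_ne_zero, not_false_eq_true, zero_pow,
    zero_smul, add_zero] at hftc
  have hcs := sq_integral_mul_le (μ := volume.restrict (Set.Icc (0 : ℝ) 1)) (f := D)
    (g := fun _ => 1) (Continuous.integrableOn_unit (hDc.pow 2))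
    (Continuous.integrableOn_unit (continuous_const.pow 2))
    (by simp only [mul_one]; exact Continuous.integrableOn_unit hDc)
  simp only [mul_one, one_pow, integral_const, measureReal_restrict_apply_univ,
    Real.volume_real_Icc, sub_zero, zero_le_one, sup_of_le_left, smul_eq_mul] at hcs
  have hS : Continuous (fun r : ℝ => r ^ 6 * ∑ i, dx i u (x + r ^ 4 • y) v ^ 2) :=
    (by fun_prop : Continuous fun r : ℝ => r ^ 6).mul
      (continuous_finsetSum _ fun i _ => (hcd i).pow 2)
  -- `48 = 4² · 3`, with `3` bounding `|y|²` on the cube; the final `96` doubles it through `a² ≤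
  -- 2b² + 2(b - a)²`.
  have hle : ∫ r in Set.Icc (0 : ℝ) 1, D r ^ 2 ≤
      48 * ∫ r in Set.Icc (0 : ℝ) 1, r ^ 6 * ∑ i, dx i u (x + r ^ 4 • y) v ^ 2 := by
    rw [← integral_const_mul]
    refine integral_mono (Continuous.integrableOn_unit (hDc.pow 2))
      (Continuous.integrableOn_unit (hS.const_mul 48)) fun r => ?_
    have hs : (∑ i, y i * dx i u (x + r ^ 4 • y) v) ^ 2 ≤
        3 * ∑ i, dx i u (x + r ^ 4 • y) v ^ 2 := by
      have h1 := Finset.sum_mul_sq_le_sq_mul_sq Finset.univ y (fun i => dx i u (x + r ^ 4 • y) v)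
      refine h1.trans ?_
      gcongr
      calc ∑ i, y i ^ 2 ≤ ∑ _i : Fin 3, (1 : ℝ) :=
            Finset.sum_le_sum fun i _ => pow_le_one₀ (hy.1 i) (hy.2 i)
        _ = 3 := by simp
    calc D r ^ 2 = 16 * r ^ 6 * (∑ i, y i * dx i u (x + r ^ 4 • y) v) ^ 2 := by
          simp only [hD]; ring
      _ ≤ 16 * r ^ 6 * (3 * ∑ i, dx i u (x + r ^ 4 • y) v ^ 2) := by gcongr
      _ = _ := by ring
  rw [hftc] at hcs
  nlinarith [sq_nonneg (u (x + y) v + (u (x + y) v - u x v))]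

section Family

variable {ι : Type*} [Fintype ι] {ρ : V → ℝ} {U : ι → X → V → ℝ}

/-- The weighted square integral in `v` of a finite family. -/
def fam (ρ : V → ℝ) (U : ι → X → V → ℝ) (x : X) : ℝ := ∫ v, ρ v * ∑ o, U o x v ^ 2

lemma fam_dec (hρ : Grow (fun _ => ρ)) (hU : ∀ o, IsHInfSchwartz (U o)) :
    Dec (fun x v => ρ v * ∑ o, U o x v ^ 2) :=
  (Dec.sum _ fun o _ => sq_dec (hU o)).grow_mul hρ

/-- The path inequality is linear in squares, so it survives summation and integration in `v`
against `ρ ≥ 0`, with Fubini exchanging `r` and `v`. Hence the square integral itself obeys a scalar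
Sobolev inequality. -/
lemma fam_rep (hρ : Grow (fun _ => ρ)) (hρ0 : ∀ v, 0 ≤ ρ v) (hU : ∀ o, IsHInfSchwartz (U o)) :
    Rep (fam ρ U) (fun x => ∑ i, fam ρ (fun o => dx i (U o)) x) := by
  intro x y hy
  have hd := fam_dec hρ hU
  have hdi := fun i => fam_dec hρ (fun o => (hU o).dx i)
  set S : X → V → ℝ := fun x v => ∑ i, ρ v * ∑ o, dx i (U o) x v ^ 2 with hSdef
  have hS : Dec S := Dec.sum _ fun i _ => hdi i
  have hGS : ∀ x, ∑ i, fam ρ (fun o => dx i (U o)) x = ∫ v, S x v := fun x =>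
    (integral_finsetSum _ fun i _ => (hdi i).integrable x).symm
  simp only [hGS]
  have hSr : ∀ v, Continuous (fun r : ℝ => r ^ 6 * S (x + r ^ 4 • y) v) := fun v =>
    (by fun_prop : Continuous fun r : ℝ => r ^ 6).mul ((hS.cont_right v).comp (by fun_prop))
  have hpt : ∀ v, ρ v * ∑ o, U o x v ^ 2 ≤ 2 * (ρ v * ∑ o, U o (x + y) v ^ 2) +
      96 * ∫ r in Set.Icc (0 : ℝ) 1, r ^ 6 * S (x + r ^ 4 • y) v := by
    intro v
    have hco : ∀ o, Continuous (fun r : ℝ => r ^ 6 * ∑ i, dx i (U o) (x + r ^ 4 • y) v ^ 2) :=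
      fun o => (by fun_prop : Continuous fun r : ℝ => r ^ 6).mul
        (continuous_finsetSum _ fun i _ =>
          ((((hU o).dx i).dec.cont_right v).comp (by fun_prop)).pow 2)
    have h1 := mul_le_mul_of_nonneg_left
      (Finset.sum_le_sum fun o (_ : o ∈ Finset.univ) => sq_le_path (hU o) x hy v) (hρ0 v)
    refine h1.trans (le_of_eq ?_)
    rw [Finset.sum_add_distrib, ← Finset.mul_sum, ← Finset.mul_sum,
      ← integral_finsetSum _ fun o _ => Continuous.integrableOn_unit (hco o), mul_add,
      mul_left_comm, mul_left_comm (ρ v) 96, ← integral_const_mul]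
    congr 3
    ext r
    simp only [hSdef, Finset.mul_sum]
    rw [Finset.sum_comm]
    refine Finset.sum_congr rfl fun i _ => Finset.sum_congr rfl fun o _ => ?_
    ring
  have hswap : Integrable (Function.uncurry fun (v : V) (r : ℝ) => r ^ 6 * S (x + r ^ 4 • y) v)
      (volume.prod (volume.restrict (Set.Icc (0 : ℝ) 1))) := by
    obtain ⟨C, hC, h⟩ := hS.abs_le 4
    have hc : Continuous (Function.uncurry fun (v : V) (r : ℝ) => r ^ 6 * S (x + r ^ 4 • y) v) := by
      have h1 : Continuous fun p : V × ℝ => S (x + p.2 ^ 4 • y) p.1 :=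
        hS.cont.comp (f := fun p : V × ℝ => (x + p.2 ^ 4 • y, p.1)) (by fun_prop)
      exact (by fun_prop : Continuous fun p : V × ℝ => p.2 ^ 6).mul h1
    have hb : Integrable (fun p : V × ℝ => C * ((1 + ‖p.1‖) ^ 4)⁻¹)
        (volume.prod (volume.restrict (Set.Icc (0 : ℝ) 1))) :=
      Integrable.comp_fst (f := fun v : V => C * ((1 + ‖v‖) ^ 4)⁻¹)
        (integrable_inv_one_add_norm_pow.const_mul C) _
    refine hb.mono' hc.aestronglyMeasurable ?_
    have hae : ∀ᵐ p : V × ℝ ∂(volume.prod (volume.restrict (Set.Icc (0 : ℝ) 1))),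
        p.2 ∈ Set.Icc (0 : ℝ) 1 :=
      Measure.quasiMeasurePreserving_snd.ae (ae_restrict_mem measurableSet_Icc)
    filter_upwards [hae] with p hp
    simp only [Function.uncurry, Real.norm_eq_abs, abs_mul]
    have h1 : |p.2 ^ 6| ≤ 1 := by
      rw [abs_of_nonneg (pow_nonneg hp.1 6)]; exact pow_le_one₀ hp.1 hp.2
    calc _ ≤ 1 * |S (x + p.2 ^ 4 • y) p.1| := by gcongr
      _ ≤ _ := by rw [one_mul]; exact h _ _
  have hint : Integrable (fun v => ∫ r in Set.Icc (0 : ℝ) 1, r ^ 6 * S (x + r ^ 4 • y) v) :=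
    hswap.integral_prod_left
  have h2 := integral_mono (hd.integrable x)
    (((hd.integrable (x + y)).const_mul 2).add (hint.const_mul 96)) hpt
  simp only [Pi.add_apply] at h2
  rw [integral_add ((hd.integrable (x + y)).const_mul 2) (hint.const_mul 96), integral_const_mul,
    integral_const_mul] at h2
  have h3 := integral_integral_swap hswap
  rw [h3] at h2
  simpa only [fam, integral_const_mul] using h2

end Family

/-- Quadratic forms in `v`, commuting with `∂_x`, to which the Sobolev embeddings in `x` apply. -/
structure SobForm (A : (X → V → ℝ) → X → ℝ) : Prop where
  nonneg : ∀ φ x, 0 ≤ A φ x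
  cont : ∀ φ, IsHInfSchwartz φ → Continuous (A φ)
  per : ∀ φ, IsHInfSchwartz φ → Per (A φ)
  rep : ∀ φ, IsHInfSchwartz φ → Rep (A φ) (fun x => ∑ i, A (dx i φ) x)

lemma sobForm_of_fam {ι : Type*} [Fintype ι] {ρ : V → ℝ} (hρ : Grow (fun _ => ρ))
    (hρ0 : ∀ v, 0 ≤ ρ v) {L : ι → (X → V → ℝ) → X → V → ℝ}
    (hL : ∀ o φ, IsHInfSchwartz φ → IsHInfSchwartz (L o φ))
    (hc : ∀ o i φ, IsHInfSchwartz φ → dx i (L o φ) = L o (dx i φ)) :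
    SobForm (fun φ => fam ρ (fun o => L o φ)) where
  nonneg φ x := integral_nonneg fun v =>
    mul_nonneg (hρ0 v) (Finset.sum_nonneg fun o _ => sq_nonneg _)
  cont φ hφ := (fam_dec hρ fun o => hL o φ hφ).continuous_integral
  per φ hφ i x := by simp only [fam, (hL _ φ hφ).periodic]
  rep φ hφ := by
    have := fam_rep hρ hρ0 fun o => hL o φ hφ
    simpa only [hc _ _ φ hφ] using this

/-- The square of the `L²_v` norm. -/
def l2Form (φ : X → V → ℝ) (x : X) : ℝ := ∫ v, φ x v ^ 2

lemma sobForm_l2Form : SobForm l2Form := by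
  have := sobForm_of_fam (ι := Unit) (ρ := fun _ => 1) (Grow.const 1) (fun _ => zero_le_one)
    (L := fun _ φ => φ) (fun _ _ h => h) (fun _ _ _ _ => rfl)
  have e : (fun φ => fam (fun _ => 1) (fun (_ : Unit) => φ)) = l2Form := by
    ext φ x; simp [fam, l2Form]
  rwa [e] at this

lemma sobForm_bForm {γ : ℝ} (hγ : 0 ≤ γ) : SobForm (fun φ x => bForm γ (φ x)) := by
  have := sobForm_of_fam (ρ := fun v => (1 + ‖v‖) ^ γ) (Grow.weight hγ) (fun _ => by positivity)
    (L := comp) (fun o φ h => comp_schwartz h o) (fun o i φ h => dx_comp h i o)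
  have e : (fun φ => fam (fun v => (1 + ‖v‖) ^ γ) (fun o => comp o φ)) =
      fun φ x => bForm γ (φ x) := by
    ext φ x; simp only [fam, bForm, qd_eq_sum]
  rwa [e] at this

/-- The `H²_x` energy attached to a form. -/
def energy (A : (X → V → ℝ) → X → ℝ) (φ : X → V → ℝ) : ℝ :=
  ∑ α ∈ multiIdx, ∫ x in torusBox, A (dxMulti α φ) x

lemma exists_dxMulti_zero (φ : X → V → ℝ) : ∃ α ∈ multiIdx, dxMulti α φ = φ :=
  ⟨0, by decide, rfl⟩

lemma exists_dxMulti_one (i : Fin 3) (φ : X → V → ℝ) : ∃ α ∈ multiIdx, dxMulti α φ = dx i φ := by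
  fin_cases i
  · exact ⟨![1, 0, 0], by decide, rfl⟩
  · exact ⟨![0, 1, 0], by decide, rfl⟩
  · exact ⟨![0, 0, 1], by decide, rfl⟩

lemma exists_dxMulti_two (hφ : IsHInfSchwartz φ) (i j : Fin 3) :
    ∃ α ∈ multiIdx, dxMulti α φ = dx i (dx j φ) := by
  fin_cases i <;> fin_cases j
  · exact ⟨![2, 0, 0], by decide, rfl⟩
  · exact ⟨![1, 1, 0], by decide, rfl⟩
  · exact ⟨![1, 0, 1], by decide, rfl⟩
  · exact ⟨![1, 1, 0], by decide, dx_comm hφ 0 1⟩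
  · exact ⟨![0, 2, 0], by decide, rfl⟩
  · exact ⟨![0, 1, 1], by decide, rfl⟩
  · exact ⟨![1, 0, 1], by decide, dx_comm hφ 0 2⟩
  · exact ⟨![0, 1, 1], by decide, dx_comm hφ 1 2⟩
  · exact ⟨![0, 0, 2], by decide, rfl⟩

lemma dxMulti_cases {α : Fin 3 → ℕ} (hα : α ∈ multiIdx) :
    dxMulti α = id ∨ (∃ i, dxMulti α = dx i) ∨ ∃ i j, dxMulti α = fun u => dx i (dx j u) := by
  simp only [multiIdx, Finset.mem_filter, Fin.sum_univ_three] at hα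
  obtain ⟨-, h⟩ := hα
  obtain ⟨a, ha⟩ : ∃ a, α 0 = a := ⟨_, rfl⟩
  obtain ⟨b, hb⟩ : ∃ a, α 1 = a := ⟨_, rfl⟩
  obtain ⟨c, hc⟩ : ∃ a, α 2 = a := ⟨_, rfl⟩
  have e : dxMulti α = fun f => (dx 0)^[a] ((dx 1)^[b] ((dx 2)^[c] f)) := by
    rw [← ha, ← hb, ← hc]; rfl
  rw [ha, hb, hc] at h
  rw [e]
  have h1 : a ≤ 2 := by omega
  have h2 : b ≤ 2 := by omega
  have h3 : c ≤ 2 := by omega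
  interval_cases a <;> interval_cases b <;> interval_cases c <;> first | omega | skip
  · exact Or.inl rfl
  · exact Or.inr (Or.inl ⟨2, rfl⟩)
  · exact Or.inr (Or.inr ⟨2, 2, rfl⟩)
  · exact Or.inr (Or.inl ⟨1, rfl⟩)
  · exact Or.inr (Or.inr ⟨1, 2, rfl⟩)
  · exact Or.inr (Or.inr ⟨1, 1, rfl⟩)
  · exact Or.inr (Or.inl ⟨0, rfl⟩)
  · exact Or.inr (Or.inr ⟨0, 2, rfl⟩)
  · exact Or.inr (Or.inr ⟨0, 1, rfl⟩)
  · exact Or.inr (Or.inr ⟨0, 0, rfl⟩)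

namespace SobForm

variable {A : (X → V → ℝ) → X → ℝ}

lemma integral_nonneg' (hA : SobForm A) (φ : X → V → ℝ) : 0 ≤ ∫ x in torusBox, A φ x :=
  integral_nonneg fun x => hA.nonneg φ x

lemma energy_nonneg (hA : SobForm A) (φ : X → V → ℝ) : 0 ≤ energy A φ :=
  Finset.sum_nonneg fun _ _ => hA.integral_nonneg' _

lemma integral_le_energy (hA : SobForm A) {φ ψ : X → V → ℝ}
    (h : ∃ α ∈ multiIdx, dxMulti α φ = ψ) : ∫ x in torusBox, A ψ x ≤ energy A φ := by
  obtain ⟨α, hα, rfl⟩ := h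
  exact Finset.single_le_sum (f := fun α => ∫ x in torusBox, A (dxMulti α φ) x)
    (fun _ _ => hA.integral_nonneg' _) hα

lemma grad_cont (hA : SobForm A) (hφ : IsHInfSchwartz φ) :
    Continuous (fun x => ∑ i, A (dx i φ) x) :=
  continuous_finsetSum _ fun i _ => hA.cont _ (hφ.dx i)

lemma grad_per (hA : SobForm A) (hφ : IsHInfSchwartz φ) : Per (fun x => ∑ i, A (dx i φ) x) :=
  fun k x => Finset.sum_congr rfl fun i _ => hA.per _ (hφ.dx i) k x

/-- This is `H¹ ⊂ L⁴` for a first derivative, as `A` is quadratic. The three second derivatives in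
the gradient give `165896 = 8 + 18432 · 3²`. -/
lemma integral_dx_sq_le (hA : SobForm A) (hφ : IsHInfSchwartz φ) (i : Fin 3) :
    ∫ x in torusBox, A (dx i φ) x ^ 2 ≤ 165896 * energy A φ ^ 2 := by
  have hi := hφ.dx i
  have h := (hA.rep _ hi).sq_le (hA.cont _ hi) (hA.grad_cont hi) (hA.per _ hi) (hA.grad_per hi)
    (hA.nonneg _) (fun x => Finset.sum_nonneg fun j _ => hA.nonneg _ x)
  have h1 := hA.integral_le_energy (exists_dxMulti_one i φ)
  have h2 : ∫ y in torusBox, ∑ j, A (dx j (dx i φ)) y ≤ 3 * energy A φ := by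
    rw [integral_finsetSum _ fun j _ => Continuous.integrableOn_box (hA.cont _ (hi.dx j))]
    calc _ ≤ ∑ _j : Fin 3, energy A φ :=
          Finset.sum_le_sum fun j _ => hA.integral_le_energy (exists_dxMulti_two hφ j i)
      _ = _ := by simp
  have h3 : 0 ≤ ∫ y in torusBox, ∑ j, A (dx j (dx i φ)) y :=
    integral_nonneg fun x => Finset.sum_nonneg fun j _ => hA.nonneg _ x
  have h4 := pow_le_pow_left₀ (hA.integral_nonneg' (dx i φ)) h1 2
  have h5 := pow_le_pow_left₀ h3 h2 2
  linarith

/-- `H² ⊂ L^∞` in two stages: the sup bound needs the gradient form in `L²`, which the `L⁴` bound on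
first derivatives supplies. Constants are rounded: `9 · 165896 ≤ 1300²` and `2 + 96 · 1300 ≤
200000`. -/
lemma sup_le_energy (hA : SobForm A) (hφ : IsHInfSchwartz φ) (x : X) :
    A φ x ≤ 200000 * energy A φ := by
  have h := (hA.rep _ hφ).sup_le (hA.cont _ hφ) (hA.grad_cont hφ) (hA.per _ hφ) (hA.grad_per hφ) x
  have h1 := hA.integral_le_energy (exists_dxMulti_zero φ)
  have hE := hA.energy_nonneg φ
  have h2 : ∫ y in torusBox, (∑ i, A (dx i φ) y) ^ 2 ≤ (1300 * energy A φ) ^ 2 := by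
    calc _ ≤ ∫ y in torusBox, 3 * ∑ i, A (dx i φ) y ^ 2 := by
          refine integral_mono (Continuous.integrableOn_box ((hA.grad_cont hφ).pow 2))
            (Continuous.integrableOn_box ((continuous_finsetSum _ fun i _ =>
              (hA.cont _ (hφ.dx i)).pow 2).const_mul 3)) fun y => ?_
          simpa using sq_sum_le_card_mul_sum_sq (s := Finset.univ) (f := fun i => A (dx i φ) y)
      _ = 3 * ∑ i, ∫ y in torusBox, A (dx i φ) y ^ 2 := by
          rw [integral_const_mul, integral_finsetSum (f := fun i y => A (dx i φ) y ^ 2) _ fun j _ =>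
            Continuous.integrableOn_box ((hA.cont _ (hφ.dx j)).pow 2)]
      _ ≤ 3 * ∑ _i : Fin 3, 165896 * energy A φ ^ 2 := by
          gcongr with i
          exact hA.integral_dx_sq_le hφ i
      _ ≤ _ := by
          simp only [Finset.sum_const, Finset.card_univ, Fintype.card_fin, nsmul_eq_mul]
          push_cast
          nlinarith [sq_nonneg (energy A φ)]
  have h3 := Real.sqrt_le_sqrt h2
  rw [Real.sqrt_sq (by positivity)] at h3
  linarith

end SobForm

end

end Landau

end

/-! ### The trilinear estimate in `H²_x` -/

noncomputable section

namespace Landau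

open MeasureTheory Filter Topology

section

variable {γ : ℝ} {φ ψ χ u w : X → V → ℝ}

lemma IsHInfSchwartz.dxMulti (hφ : IsHInfSchwartz φ) (α : Fin 3 → ℕ) :
    IsHInfSchwartz (dxMulti α φ) := by
  have key : ∀ (i : Fin 3) (n : ℕ) {f : X → V → ℝ}, IsHInfSchwartz f →
      IsHInfSchwartz ((Landau.dx i)^[n] f) := by
    intro i n f hf
    induction n with
    | zero => exact hf
    | succ n ih => rw [Function.iterate_succ_apply']; exact ih.dx i
  exact key _ _ (key _ _ (key _ _ hφ))

lemma dx_iterate_of_mem (hγ : 0 ≤ γ) (hu : u ∈ gamSpan γ) (i : Fin 3) (n : ℕ) :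
    (dx i)^[n] u = (tw (Pi.single i 1, 0))^[n] u := by
  induction n with
  | zero => rfl
  | succ n ih =>
    rw [Function.iterate_succ_apply', Function.iterate_succ_apply', ih,
      dx_eq (differentiable_of_mem hγ (tw_iterate_mem hγ _ n hu))]

lemma dxMulti_of_mem (hγ : 0 ≤ γ) (hu : u ∈ gamSpan γ) (α : Fin 3 → ℕ) :
    dxMulti α u = (tw (Pi.single 0 1, 0))^[α 0] ((tw (Pi.single 1 1, 0))^[α 1]
      ((tw (Pi.single 2 1, 0))^[α 2] u)) := by
  have h2 := tw_iterate_mem hγ (Pi.single 2 1, 0) (α 2) hu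
  have h1 := tw_iterate_mem hγ (Pi.single 1 1, 0) (α 1) h2
  rw [dxMulti, dx_iterate_of_mem hγ hu, dx_iterate_of_mem hγ h2, dx_iterate_of_mem hγ h1]

lemma dxMulti_mem (hγ : 0 ≤ γ) (hu : u ∈ gamSpan γ) (α : Fin 3 → ℕ) : dxMulti α u ∈ gamSpan γ := by
  rw [dxMulti_of_mem hγ hu]
  exact tw_iterate_mem hγ _ _ (tw_iterate_mem hγ _ _ (tw_iterate_mem hγ _ _ hu))

lemma dxMulti_sum_smul (hγ : 0 ≤ γ) {ι : Type*} (s : Finset ι) (c : ι → ℝ) {U : ι → X → V → ℝ}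
    (hU : ∀ i ∈ s, U i ∈ gamSpan γ) (α : Fin 3 → ℕ) :
    dxMulti α (∑ i ∈ s, c i • U i) = ∑ i ∈ s, c i • dxMulti α (U i) := by
  have hs : ∑ i ∈ s, c i • U i ∈ gamSpan γ :=
    Submodule.sum_mem _ fun i hi => Submodule.smul_mem _ _ (hU i hi)
  rw [dxMulti_of_mem hγ hs, tw_iterate_sum_smul hγ _ _ hU, tw_iterate_sum_smul hγ _ _
    fun i hi => tw_iterate_mem hγ _ _ (hU i hi), tw_iterate_sum_smul hγ _ _
    fun i hi => tw_iterate_mem hγ _ _ (tw_iterate_mem hγ _ _ (hU i hi))]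
  exact Finset.sum_congr rfl fun i hi => by rw [dxMulti_of_mem hγ (hU i hi)]

/-- The `L²_{x,v}` pairing. -/
def pair (u w : X → V → ℝ) : ℝ := ∫ x in torusBox, ∫ v, u x v * w x v

lemma pair_sum_smul {ι : Type*} (s : Finset ι) (c : ι → ℝ) {U : ι → X → V → ℝ}
    (hU : ∀ i ∈ s, Dec (U i)) (hw : Dec w) :
    pair (∑ i ∈ s, c i • U i) w = ∑ i ∈ s, c i * pair (U i) w := by
  have h1 : ∀ x, ∫ v, (∑ i ∈ s, c i • U i) x v * w x v = ∑ i ∈ s, c i * ∫ v, U i x v * w x v := by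
    intro x
    simp only [Finset.sum_apply, Pi.smul_apply, smul_eq_mul, Finset.sum_mul, mul_assoc]
    rw [integral_finsetSum _ fun i hi => (((hU i hi).mul hw).integrable x).const_mul (c i)]
    simp only [integral_const_mul]
  simp only [pair, h1]
  rw [integral_finsetSum _ fun i hi => (Continuous.integrableOn_box
    ((hU i hi).mul hw).continuous_integral).const_mul (c i)]
  simp only [integral_const_mul]

lemma pair_add (hu : Dec u) (hφ : Dec φ) (hw : Dec w) :
    pair (u + φ) w = pair u w + pair φ w := by
  have := pair_sum_smul (Finset.univ : Finset (Fin 2)) (fun _ => 1) (U := ![u, φ])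
    (by intro i _; fin_cases i <;> assumption) hw
  simpa [Fin.sum_univ_two] using this

/-- Membership in the span supplies the differentiability and integrability that linearity of
`fderiv` and of the integral requires. -/
lemma innerH2L2_sum_smul (hγ : 0 ≤ γ) {ι : Type*} (s : Finset ι) (c : ι → ℝ)
    {U : ι → X → V → ℝ} (hU : ∀ i ∈ s, U i ∈ gamSpan γ) (hχ : IsHInfSchwartz χ) :
    innerH2L2 (∑ i ∈ s, c i • U i) χ = ∑ i ∈ s, c i * innerH2L2 (U i) χ := by
  have h : ∀ α, pair (dxMulti α (∑ i ∈ s, c i • U i)) (dxMulti α χ) =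
      ∑ i ∈ s, c i * pair (dxMulti α (U i)) (dxMulti α χ) := by
    intro α
    rw [dxMulti_sum_smul hγ s c hU]
    exact pair_sum_smul s c (fun i hi => dec_of_mem hγ (dxMulti_mem hγ (hU i hi) α))
      (hχ.dxMulti α).dec
  change ∑ α ∈ multiIdx, pair (dxMulti α (∑ i ∈ s, c i • U i)) (dxMulti α χ) =
    ∑ i ∈ s, c i * ∑ α ∈ multiIdx, pair (dxMulti α (U i)) (dxMulti α χ)
  simp only [h, Finset.mul_sum]
  exact Finset.sum_comm

lemma dx_Gam (hγ : 0 ≤ γ) (hφ : IsHInfSchwartz φ) (hψ : IsHInfSchwartz ψ) (i : Fin 3) :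
    dx i (Gam γ φ ψ) = Gam γ (dx i φ) ψ + Gam γ φ (dx i ψ) := by
  rw [dx_eq (Gam_differentiable hγ hφ hψ), tw_Gam hγ hφ hψ, dx_eq hφ.differentiable,
    dx_eq hψ.differentiable]

lemma dx_dx_Gam (hγ : 0 ≤ γ) (hφ : IsHInfSchwartz φ) (hψ : IsHInfSchwartz ψ) (i j : Fin 3) :
    dx i (dx j (Gam γ φ ψ)) = (Gam γ (dx i (dx j φ)) ψ + Gam γ (dx j φ) (dx i ψ)) +
      (Gam γ (dx i φ) (dx j ψ) + Gam γ φ (dx i (dx j ψ))) := by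
  have h1 := Gam_differentiable hγ (hφ.dx j) hψ
  have h2 := Gam_differentiable hγ hφ (hψ.dx j)
  rw [dx_Gam hγ hφ hψ, dx_eq (h1.add h2), tw_add_apply h1 h2, ← dx_eq h1, ← dx_eq h2,
    dx_Gam hγ (hφ.dx j) hψ, dx_Gam hγ hφ (hψ.dx j)]

section Products

variable {A B : (X → V → ℝ) → X → ℝ}

lemma integral_mul_le_of_sup_left (hA : SobForm A) (hB : SobForm B) (hφ : IsHInfSchwartz φ)
    (hw : IsHInfSchwartz w) (h : ∃ α ∈ multiIdx, dxMulti α ψ = w) :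
    ∫ x in torusBox, A φ x * B w x ≤ 200000 * (energy A φ * energy B ψ) := by
  calc _ ≤ ∫ x in torusBox, (200000 * energy A φ) * B w x :=
        integral_mono (Continuous.integrableOn_box ((hA.cont _ hφ).mul (hB.cont _ hw)))
          (Continuous.integrableOn_box ((hB.cont _ hw).const_mul _)) fun x =>
          mul_le_mul_of_nonneg_right (hA.sup_le_energy hφ x) (hB.nonneg _ _)
    _ ≤ (200000 * energy A φ) * energy B ψ := by
        rw [integral_const_mul]
        have := hA.energy_nonneg φ
        gcongr
        exact hB.integral_le_energy h
    _ = _ := by ring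

lemma integral_mul_dx_le (hA : SobForm A) (hB : SobForm B) (hφ : IsHInfSchwartz φ)
    (hψ : IsHInfSchwartz ψ) (i j : Fin 3) :
    ∫ x in torusBox, A (dx i φ) x * B (dx j ψ) x ≤ 200000 * (energy A φ * energy B ψ) := by
  have ha := hA.cont _ (hφ.dx i)
  have hb := hB.cont _ (hψ.dx j)
  have h := sq_integral_mul_le (Continuous.integrableOn_box (ha.pow 2))
    (Continuous.integrableOn_box (hb.pow 2)) (Continuous.integrableOn_box (ha.mul hb))
  have h1 := hA.integral_dx_sq_le hφ i
  have h2 := hB.integral_dx_sq_le hψ j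
  have hEA := hA.energy_nonneg φ
  have hEB := hB.energy_nonneg ψ
  refine abs_le_of_sq_le_sq' (h.trans ?_) (by positivity) |>.2
  calc _ ≤ (165896 * energy A φ ^ 2) * (165896 * energy B ψ ^ 2) :=
        mul_le_mul h1 h2 (integral_nonneg fun x => sq_nonneg _) (by positivity)
    _ ≤ _ := by
        have : 0 ≤ energy A φ ^ 2 * energy B ψ ^ 2 := by positivity
        nlinarith

end Products

/-- The quadratic form `bForm` with `x` as a parameter. -/
def sForm (γ : ℝ) (φ : X → V → ℝ) (x : X) : ℝ := bForm γ (φ x)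

/-- The trilinear estimate integrated in `x`. -/
lemma abs_pair_Gam_le (hγ : 0 ≤ γ) : ∃ C : ℝ, 0 ≤ C ∧ ∀ φ ψ χ, IsHInfSchwartz φ →
    IsHInfSchwartz ψ → IsHInfSchwartz χ → |pair (Gam γ φ ψ) χ| ≤
      C * √(∫ x in torusBox, l2Form φ x * sForm γ ψ x) * √(∫ x in torusBox, sForm γ χ x) := by
  obtain ⟨C, hC, h⟩ := abs_integral_Gam_mul_le hγ
  have hA := sobForm_l2Form
  have hB : SobForm (sForm γ) := sobForm_bForm hγ
  refine ⟨C, hC, fun φ ψ χ hφ hψ hχ => ?_⟩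
  have c1 := (hA.cont φ hφ).mul (hB.cont ψ hψ)
  have c2 := hB.cont χ hχ
  have hcs := integral_mul_le_sqrt (μ := volume.restrict torusBox)
    (f := fun x => √(l2Form φ x * sForm γ ψ x)) (g := fun x => √(sForm γ χ x))
    (Continuous.integrableOn_box (c1.sqrt.pow 2)) (Continuous.integrableOn_box (c2.sqrt.pow 2))
    (Continuous.integrableOn_box (c1.sqrt.mul c2.sqrt))
  simp only [Real.sq_sqrt (mul_nonneg (hA.nonneg _ _) (hB.nonneg _ _)),
    Real.sq_sqrt (hB.nonneg _ _)] at hcs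
  calc |pair (Gam γ φ ψ) χ| ≤ ∫ x in torusBox, |∫ v, Gam γ φ ψ x v * χ x v| :=
        abs_integral_le_integral_abs
    _ ≤ ∫ x in torusBox, C * (√(l2Form φ x * sForm γ ψ x) * √(sForm γ χ x)) := by
        refine integral_mono (Continuous.integrableOn_box
          ((Gam_dec hγ hφ hψ).mul hχ.dec).continuous_integral.abs)
          (Continuous.integrableOn_box ((c1.sqrt.mul c2.sqrt).const_mul C)) fun x => ?_
        refine (h φ ψ χ hφ hψ hχ x).trans (le_of_eq ?_)
        rw [Real.sqrt_mul (hA.nonneg _ _)]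
        simp only [l2Form, sForm]
        ring
    _ ≤ C * (√(∫ x in torusBox, l2Form φ x * sForm γ ψ x) *
          √(∫ x in torusBox, sForm γ χ x)) := by
        rw [integral_const_mul]; gcongr
    _ = _ := by ring

/-- The trilinear estimate in `H²_x`, in terms of energies. -/
lemma abs_innerH2L2_Gam_le (hγ : 0 ≤ γ) : ∃ C : ℝ, 0 ≤ C ∧ ∀ φ ψ χ, IsHInfSchwartz φ →
    IsHInfSchwartz ψ → IsHInfSchwartz χ → |innerH2L2 (Gam γ φ ψ) χ| ≤
      C * √(energy l2Form φ) * √(energy (sForm γ) ψ) * √(energy (sForm γ) χ) := by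
  obtain ⟨C, hC, h⟩ := abs_pair_Gam_le hγ
  have hA := sobForm_l2Form
  have hB : SobForm (sForm γ) := sobForm_bForm hγ
  refine ⟨multiIdx.card * (4 * (C * √200000)), by positivity, fun φ ψ χ hφ hψ hχ => ?_⟩
  set K := C * √200000 * √(energy l2Form φ) * √(energy (sForm γ) ψ) * √(energy (sForm γ) χ)
    with hK
  have hK0 : 0 ≤ K := by positivity
  have term : ∀ {φ' ψ' : X → V → ℝ} (α : Fin 3 → ℕ), α ∈ multiIdx → IsHInfSchwartz φ' →
      IsHInfSchwartz ψ' → ∫ x in torusBox, l2Form φ' x * sForm γ ψ' x ≤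
        200000 * (energy l2Form φ * energy (sForm γ) ψ) →
      |pair (Gam γ φ' ψ') (dxMulti α χ)| ≤ K := by
    intro φ' ψ' α hα hφ' hψ' hle
    refine (h φ' ψ' _ hφ' hψ' (hχ.dxMulti α)).trans ?_
    have h1 := Real.sqrt_le_sqrt hle
    rw [Real.sqrt_mul (by norm_num), Real.sqrt_mul (hA.energy_nonneg φ)] at h1
    have h2 := Real.sqrt_le_sqrt (hB.integral_le_energy (φ := χ) ⟨α, hα, rfl⟩)
    calc _ ≤ C * (√200000 * (√(energy l2Form φ) * √(energy (sForm γ) ψ))) *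
          √(energy (sForm γ) χ) := by gcongr
      _ = K := by rw [hK]; ring
  have hswap : ∀ {φ' ψ' : X → V → ℝ}, ∫ x in torusBox, sForm γ ψ' x * l2Form φ' x ≤
      200000 * (energy (sForm γ) ψ * energy l2Form φ) →
      ∫ x in torusBox, l2Form φ' x * sForm γ ψ' x ≤
        200000 * (energy l2Form φ * energy (sForm γ) ψ) := by
    intro φ' ψ' hle
    simpa only [mul_comm (sForm γ ψ' _), mul_comm (energy (sForm γ) ψ)] using hle
  -- If all derivatives fall on one factor, the other is taken in `L^∞`; if each factor has one,
  -- both are taken in `L⁴`.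
  have t0 := fun α hα => term α hα hφ hψ
    (integral_mul_le_of_sup_left hA hB hφ hψ (exists_dxMulti_zero ψ))
  have t1 := fun i α hα => term α hα hφ (hψ.dx i)
    (integral_mul_le_of_sup_left hA hB hφ (hψ.dx i) (exists_dxMulti_one i ψ))
  have t2 := fun i j α hα => term α hα hφ ((hψ.dx j).dx i)
    (integral_mul_le_of_sup_left hA hB hφ ((hψ.dx j).dx i) (exists_dxMulti_two hψ i j))
  have t1' := fun i α hα => term α hα (hφ.dx i) hψ
    (hswap (integral_mul_le_of_sup_left hB hA hψ (hφ.dx i) (exists_dxMulti_one i φ)))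
  have t2' := fun i j α hα => term α hα ((hφ.dx j).dx i) hψ
    (hswap (integral_mul_le_of_sup_left hB hA hψ ((hφ.dx j).dx i) (exists_dxMulti_two hφ i j)))
  have t11 := fun i j α hα => term α hα (hφ.dx i) (hψ.dx j)
    (integral_mul_dx_le hA hB hφ hψ i j)
  -- At most two derivatives of a bilinear expression produce at most four terms.
  have hα : ∀ α ∈ multiIdx, |pair (dxMulti α (Gam γ φ ψ)) (dxMulti α χ)| ≤ 4 * K := by
    intro α hα
    have hd := (hχ.dxMulti α).dec
    rcases dxMulti_cases hα with e | ⟨i, e⟩ | ⟨i, j, e⟩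
    · have e1 : dxMulti α (Gam γ φ ψ) = Gam γ φ ψ := by rw [e]; rfl
      rw [e1]
      linarith [t0 α hα]
    · have e1 := (congrFun e (Gam γ φ ψ)).trans (dx_Gam hγ hφ hψ i)
      rw [e1, pair_add (Gam_dec hγ (hφ.dx i) hψ) (Gam_dec hγ hφ (hψ.dx i)) hd]
      refine (abs_add_le _ _).trans ?_
      linarith [t1 i α hα, t1' i α hα]
    · have e1 := (congrFun e (Gam γ φ ψ)).trans (dx_dx_Gam hγ hφ hψ i j)
      have d1 := Gam_dec hγ ((hφ.dx j).dx i) hψ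
      have d2 := Gam_dec hγ (hφ.dx j) (hψ.dx i)
      have d3 := Gam_dec hγ (hφ.dx i) (hψ.dx j)
      have d4 := Gam_dec hγ hφ ((hψ.dx j).dx i)
      have d12 : Dec (Gam γ (dx i (dx j φ)) ψ + Gam γ (dx j φ) (dx i ψ)) := d1.add d2
      have d34 : Dec (Gam γ (dx i φ) (dx j ψ) + Gam γ φ (dx i (dx j ψ))) := d3.add d4
      rw [e1, pair_add d12 d34 hd, pair_add d1 d2 hd, pair_add d3 d4 hd]
      refine (abs_add_le _ _).trans ((add_le_add (abs_add_le _ _) (abs_add_le _ _)).trans ?_)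
      linarith [t2' i j α hα, t11 j i α hα, t11 i j α hα, t2 i j α hα]
  calc |innerH2L2 (Gam γ φ ψ) χ|
      ≤ ∑ α ∈ multiIdx, |pair (dxMulti α (Gam γ φ ψ)) (dxMulti α χ)| :=
        Finset.abs_sum_le_sum_abs _ _
    _ ≤ ∑ _α ∈ multiIdx, 4 * K := Finset.sum_le_sum hα
    _ = _ := by rw [Finset.sum_const, nsmul_eq_mul, hK]; ring

lemma normH2L2_eq (φ : X → V → ℝ) : normH2L2 φ = √(energy l2Form φ) := by
  simp only [normH2L2, innerH2L2, energy, l2Form, pow_two]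

lemma sqrt_energy_le_normH2Sigma (hγ : 0 ≤ γ) : ∃ C : ℝ, 0 ≤ C ∧ ∀ φ, IsHInfSchwartz φ →
    √(energy (sForm γ) φ) ≤ C * normH2Sigma γ φ := by
  obtain ⟨C, hC, h⟩ := bForm_le_sigmaSq hγ
  refine ⟨√C, Real.sqrt_nonneg _, fun φ hφ => ?_⟩
  rw [normH2Sigma, ← Real.sqrt_mul hC]
  refine Real.sqrt_le_sqrt ?_
  rw [energy, Finset.mul_sum]
  refine Finset.sum_le_sum fun α _ => ?_
  have hα := hφ.dxMulti α
  obtain ⟨hd, he⟩ := sigmaSq_eq hγ hα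
  have hc : Continuous (fun x => sigmaSq γ (dxMulti α φ x)) := by
    simp only [he]; exact hd.continuous_integral
  rw [← integral_const_mul]
  exact integral_mono (Continuous.integrableOn_box ((sobForm_bForm hγ).cont _ hα))
    (Continuous.integrableOn_box (hc.const_mul C)) fun x => h _ hα x

/-- The trilinear estimate in `H²_x`. -/
lemma abs_innerH2L2_Gam_le_norms (hγ : 0 ≤ γ) : ∃ C : ℝ, 0 ≤ C ∧ ∀ φ ψ χ, IsHInfSchwartz φ →
    IsHInfSchwartz ψ → IsHInfSchwartz χ → |innerH2L2 (Gam γ φ ψ) χ| ≤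
      C * (normH2L2 φ * normH2Sigma γ ψ * normH2Sigma γ χ) := by
  obtain ⟨C, hC, h⟩ := abs_innerH2L2_Gam_le hγ
  obtain ⟨D, hD, h'⟩ := sqrt_energy_le_normH2Sigma hγ
  refine ⟨C * (D * D), by positivity, fun φ ψ χ hφ hψ hχ => (h φ ψ χ hφ hψ hχ).trans ?_⟩
  rw [← normH2L2_eq]
  have hn : 0 ≤ normH2L2 φ := Real.sqrt_nonneg _
  calc _ ≤ C * normH2L2 φ * (D * normH2Sigma γ ψ) * (D * normH2Sigma γ χ) := by
        have hs : 0 ≤ D * normH2Sigma γ ψ := mul_nonneg hD (Real.sqrt_nonneg _)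
        exact mul_le_mul (mul_le_mul_of_nonneg_left (h' ψ hψ) (by positivity)) (h' χ hχ)
          (Real.sqrt_nonneg _) (by positivity)
    _ = _ := by ring

end

end Landau

end

/-! ### The proposition -/

theorem proposition3p2 (γ : ℝ) (hγ : 0 ≤ γ) :
    (∀ (δ₁ δ₂ t : ℝ), 3 / 2 < δ₁ → 3 / 2 < δ₂ → 0 ≤ t →
      ∀ (m n : ℕ) (f g : Landau.X → Landau.V → ℝ),
        Landau.IsHInfSchwartz f → Landau.IsHInfSchwartz g →
        Landau.hPow δ₁ δ₂ t m n (Landau.Gam γ f g) =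
          ∑ l ∈ Finset.range (m + 1), ∑ p ∈ Finset.range (n + 1),
            ((m.choose l : ℝ) * (n.choose p : ℝ)) •
              Landau.Gam γ (Landau.hPow δ₁ δ₂ t l p f)
                (Landau.hPow δ₁ δ₂ t (m - l) (n - p) g)) ∧
    ∃ C : ℝ, 0 < C ∧
      ∀ (δ₁ δ₂ t : ℝ), 3 / 2 < δ₁ → 3 / 2 < δ₂ → 0 ≤ t →
      ∀ (m n : ℕ) (f g h : Landau.X → Landau.V → ℝ),
        Landau.IsHInfSchwartz f → Landau.IsHInfSchwartz g → Landau.IsHInfSchwartz h →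
        |Landau.innerH2L2 (Landau.hPow δ₁ δ₂ t m n (Landau.Gam γ f g))
            (Landau.hPow δ₁ δ₂ t m n h)| ≤
          C * ∑ l ∈ Finset.range (m + 1), ∑ p ∈ Finset.range (n + 1),
            (m.choose l : ℝ) * (n.choose p : ℝ) *
              Landau.normH2L2 (Landau.hPow δ₁ δ₂ t l p f) *
              Landau.normH2Sigma γ (Landau.hPow δ₁ δ₂ t (m - l) (n - p) g) *
              Landau.normH2Sigma γ (Landau.hPow δ₁ δ₂ t m n h) := by
  refine ⟨fun δ₁ δ₂ t _ _ _ m n f g hf hg => Landau.hPow_Gam hγ hf hg δ₁ δ₂ t m n, ?_⟩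
  obtain ⟨C, hC, h⟩ := Landau.abs_innerH2L2_Gam_le_norms hγ
  -- The trilinear constant is only known to be nonnegative; adding one makes it positive.
  refine ⟨C + 1, by positivity, fun δ₁ δ₂ t _ _ _ m n f g u hf hg hu => ?_⟩
  have hF := fun l p => hf.hPow δ₁ δ₂ t l p
  have hG := fun l p => hg.hPow δ₁ δ₂ t l p
  have hU := hu.hPow δ₁ δ₂ t m n
  rw [Landau.hPow_Gam hγ hf hg, ← Finset.sum_product', ← Finset.sum_product',
    Landau.innerH2L2_sum_smul hγ _ _ (fun q _ => Landau.Gam_mem γ (hF _ _) (hG _ _)) hU,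
    Finset.mul_sum]
  refine (Finset.abs_sum_le_sum_abs _ _).trans (Finset.sum_le_sum fun q _ => ?_)
  have hnn : 0 ≤ Landau.normH2L2 (Landau.hPow δ₁ δ₂ t q.1 q.2 f) *
      Landau.normH2Sigma γ (Landau.hPow δ₁ δ₂ t (m - q.1) (n - q.2) g) *
      Landau.normH2Sigma γ (Landau.hPow δ₁ δ₂ t m n u) :=
    mul_nonneg (mul_nonneg (Real.sqrt_nonneg _) (Real.sqrt_nonneg _)) (Real.sqrt_nonneg _)
  rw [abs_mul, abs_of_nonneg (by positivity)]
  calc _ ≤ ((m.choose q.1 : ℝ) * (n.choose q.2 : ℝ)) * ((C + 1) *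
        (Landau.normH2L2 (Landau.hPow δ₁ δ₂ t q.1 q.2 f) *
          Landau.normH2Sigma γ (Landau.hPow δ₁ δ₂ t (m - q.1) (n - q.2) g) *
          Landau.normH2Sigma γ (Landau.hPow δ₁ δ₂ t m n u))) := by
        refine mul_le_mul_of_nonneg_left ((h _ _ _ (hF _ _) (hG _ _) hU).trans ?_) (by positivity)
        exact mul_le_mul_of_nonneg_right (by linarith) hnn
    _ = _ := by ring
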